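/- Let $(M',J,g')$ be a Kähler manifold with Norden metric of real dimension $2n+2$: $g'$ is a pseudo-Riemannian metric, $J$ is an almost complex structure with $g'(JX,JY)=-g'(X,Y)$, and $\nabla' J=0$ for the Levi-Civita connection $\nabla'$ of $g'$. For any connection put $R(X,Y)Z=\nabla_X\nabla_YZ-\nabla_Y\nabla_XZ-\nabla_{[X,Y]}Z$ and $R(x,y,z,u)=g(R(x,y)z,u)$. Assume that $M'$ has constant totally real sectional curvatures $\nu',\tilde\nu'$ (functions on $M'$): at each point $q\in M'$, for every basis $\{x,y\}$ of a nondegenerate $2$-plane $\alpha'\subset T_qM'$ with $J\alpha'\perp\alpha'$, $$\frac{R'(x,y,y,x)}{\Delta}=\nu'(q),\qquad \frac{R'(x,y,y,Jx)}{\Delta}=\tilde\nu'(q),\qquad \Delta=g'(x,x)g'(y,y)-g'(x,y)^2 .$$ Let $M$ be a (possibly only immersed) hypersurface of $M'$, $\dim M=2n+1$, with a smooth unit normal field $N$, $g'(N,N)=-1$. Put $t=\arctan g'(N,JN)$ and equip $M$ with $$\varphi=J+\cos t\; g'(\cdot,JN)\{\cos t\,N-\sin t\,JN\},\quad \xi=\sin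 t\,N+\cos t\,JN,\quad \eta=\cos t\; g'(\cdot,JN),\quad g=g'|_M ,$$ (a real time-like hypersurface). Let $A$ be the second fundamental tensor, $\nabla'_XN=-AX$, let $\nabla$ be the Levi-Civita connection of $g$, let $$D_XY=\nabla_XY+\tfrac12\{(\nabla_X\varphi)\varphi Y+(\nabla_X\eta)(Y)\,\xi\}-\eta(Y)\nabla_X\xi$$ be the canonical connection, and let $K$ be its curvature tensor, $K(x,y,z,u)=g(K(x,y)z,u)$. Put $$\begin{aligned} \pi_1(x,y,z,u)&=g(y,z)g(x,u)-g(x,z)g(y,u),\\ \pi_2(x,y,z,u)&=g(y,\varphi z)g(x,\varphi u)-g(x,\varphi z)g(y,\varphi u),\\ \pi_3(x,y,z,u)&=-g(y,z)g(x,\varphi u)+g(x,z)g(y,\varphi u)-g(y,\varphi z)g(x,u)+g(x,\varphi z)g(y,u),\\ \pi_4(x,y,z,u)&=\eta(y)\eta(z)g(x,u)-\eta(x)\eta(z)g(y,u)+\eta(x)\eta(u)g(y,z)-\eta(y)\eta(u)g(x,z),\\ \pi_5(x,y,z,u)&=\eta(y)\eta(z)g(x,\varphi u)-\eta(x)\eta(z)g(y,\varphi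 u)+\eta(x)\eta(u)g(y,\varphi z)-\eta(y)\eta(u)g(x,\varphi z). \end{aligned}$$ For a $(0,4)$-tensor $L$ let $\tau(L)=g^{ij}g^{kl}L(e_i,e_k,e_l,e_j)$ in any basis $(e_i)$ of $T_pM$, and $\tilde\tau(L)=\tau(\tilde L)$ with $\tilde L(x,y,z,u)=L(x,y,z,\varphi u)$. Then, at every point of $M$, with $\nu',\tilde\nu'$ evaluated at that point: 1. $K$ is Kählerian, that is, $K(x,y,z,u)=-K(y,x,z,u)=-K(x,y,u,z)$ and $K(x,y,z,u)=-K(x,y,\varphi z,\varphi u)$; 2. $$\begin{aligned}K(x,y,z,u)={}&\{\nu'[\pi_1-\pi_2-\pi_4]+\tilde\nu'[\pi_3+\pi_5]\}(x,y,z,u)\\&-\cos t\,\{\cos t[\pi_1-\pi_2-\pi_4]+\sin t[\pi_3+\pi_5]\}(Ax,Ay,z,u);\end{aligned}$$ 3. $\tau(K)=4n(n-1)\nu'-\cos t\,(a\cos t+2b\sin t)$ and $\tilde\tau(K)=4n(n-1)\tilde\nu'-\cos t\,(a\sin t-2b\cos t)$, where $$\begin{aligned} a&=(\operatorname{tr}A)^2-\operatorname{tr}A^2-[\operatorname{tr}(A\circ\varphi)]^2+\operatorname{tr}(A\circ\varphi)^2-2\eta(A\xi)\operatorname{tr}A+2g(A\xi,A\xi),\\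 b&=\operatorname{tr}(A^2\circ\varphi)-\operatorname{tr}A\operatorname{tr}(A\circ\varphi)+\eta(A\xi)\operatorname{tr}(A\circ\varphi)-g(\varphi A\xi,A\xi). \end{aligned}$$ -/

import Mathlib

open scoped Manifold ContDiff

noncomputable section

namespace NordenGeometry

/-! ### Algebraic curvature tensors on a real vector space -/

section Algebra

variable {V : Type*} [AddCommGroup V] [Module ℝ V]

/-- `π₁(x,y,z,u) = g(y,z) g(x,u) - g(x,z) g(y,u)`. -/
def pi1 (g : V → V → ℝ) (x y z u : V) : ℝ :=
  g y z * g x u - g x z * g y u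

/-- `π₂(x,y,z,u) = g(y,φz) g(x,φu) - g(x,φz) g(y,φu)`. -/
def pi2 (g : V → V → ℝ) (φ : V → V) (x y z u : V) : ℝ :=
  g y (φ z) * g x (φ u) - g x (φ z) * g y (φ u)

/-- `π₃(x,y,z,u) = -g(y,z) g(x,φu) + g(x,z) g(y,φu) - g(y,φz) g(x,u) + g(x,φz) g(y,u)`. -/
def pi3 (g : V → V → ℝ) (φ : V → V) (x y z u : V) : ℝ :=
  -(g y z * g x (φ u)) + g x z * g y (φ u) - g y (φ z) * g x u + g x (φ z) * g y u

/-- `π₄(x,y,z,u) = η(y)η(z) g(x,u) - η(x)η(z) g(y,u) + η(x)η(u) g(y,z) - η(y)η(u) g(x,z)`. -/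
def pi4 (g : V → V → ℝ) (η : V → ℝ) (x y z u : V) : ℝ :=
  η y * η z * g x u - η x * η z * g y u + η x * η u * g y z - η y * η u * g x z

/-- `π₅(x,y,z,u) = η(y)η(z) g(x,φu) - η(x)η(z) g(y,φu) + η(x)η(u) g(y,φz) - η(y)η(u) g(x,φz)`. -/
def pi5 (g : V → V → ℝ) (φ : V → V) (η : V → ℝ) (x y z u : V) : ℝ :=
  η y * η z * g x (φ u) - η x * η z * g y (φ u) + η x * η u * g y (φ z) - η y * η u * g x (φ z)

/-- A `(0,4)`-tensor `L` is Kählerian with respect to `φ`: it is skew-symmetric in its first and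
in its last pair of arguments, and `L(x,y,z,u) = -L(x,y,φz,φu)`. (The first Bianchi identity is
not part of the notion: the curvature tensor of a connection with torsion need not satisfy it.) -/
structure IsKaehlerian (φ : V → V) (L : V → V → V → V → ℝ) : Prop where
  skew_left : ∀ x y z u, L x y z u = -L y x z u
  skew_right : ∀ x y z u, L x y z u = -L x y u z
  anti_invariant : ∀ x y z u, L x y z u = -L x y (φ z) (φ u)

/-- The scalar curvature `g^{ij} g^{kl} L(e_i, e_k, e_l, e_j)` of a `(0,4)`-tensor `L`, where
`(g^{ij})` is the inverse of the matrix `(g(e_i, e_j))` of `g` in the basis `e`. -/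
def scalarCurvature {ι : Type*} [Fintype ι] [DecidableEq ι] (e : Module.Basis ι ℝ V)
    (g : V → V → ℝ) (L : V → V → V → V → ℝ) : ℝ :=
  let G : Matrix ι ι ℝ := Matrix.of fun i j => g (e i) (e j)
  ∑ i, ∑ j, ∑ k, ∑ l, G⁻¹ i j * G⁻¹ k l * L (e i) (e k) (e l) (e j)

end Algebra

/-! ### Connections and curvature -/

section Connections

variable {E : Type*} [NormedAddCommGroup E] [NormedSpace ℝ E] [FiniteDimensional ℝ E]
  {H : Type*} [TopologicalSpace H] {I : ModelWithCorners ℝ E H}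
  {M : Type*} [TopologicalSpace M] [ChartedSpace H M] [IsManifold I ∞ M]

/-- `(∇_x P) Y = ∇_x (P Y) - P (∇_x Y)` at the point `p`, for a field `P` of endomorphisms. -/
def covDerivEnd (cov : (Π p : M, TangentSpace I p) → Π p : M, TangentSpace I p → TangentSpace I p)
    (P : Π p : M, TangentSpace I p → TangentSpace I p) (Y : Π p : M, TangentSpace I p)
    (p : M) (x : TangentSpace I p) : TangentSpace I p :=
  cov (fun q => P q (Y q)) p x - P p (cov Y p x)

/-- `(∇_x α) Y = x (α(Y)) - α (∇_x Y)` at the point `p`, for a `1`-form `α`. -/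
def covDerivForm (cov : (Π p : M, TangentSpace I p) → Π p : M, TangentSpace I p → TangentSpace I p)
    (α : Π p : M, TangentSpace I p → ℝ) (Y : Π p : M, TangentSpace I p)
    (p : M) (x : TangentSpace I p) : ℝ :=
  mvfderiv I (fun q => α q (Y q)) p x - α p (cov Y p x)

/-- `∇_X ∇_Y Z - ∇_Y ∇_X Z - ∇_{[X,Y]} Z`, for vector fields `X`, `Y`, `Z`. -/
def curvatureField
    (cov : (Π p : M, TangentSpace I p) → Π p : M, TangentSpace I p → TangentSpace I p)
    (X Y Z : Π p : M, TangentSpace I p) (p : M) : TangentSpace I p :=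
  cov (fun q => cov Z q (Y q)) p (X p) - cov (fun q => cov Z q (X q)) p (Y p)
    - cov Z p (VectorField.mlieBracket I X Y p)

/-- The curvature tensor of type `(0,4)` at the point `p`, `g(R(x,y)z, u)`: the tangent vectors
`x`, `y`, `z` are extended to vector fields that are smooth near `p` (the value does not depend on
the extensions). -/
def curvatureTensor (g : Π p : M, TangentSpace I p → TangentSpace I p → ℝ)
    (cov : (Π p : M, TangentSpace I p) → Π p : M, TangentSpace I p → TangentSpace I p)
    (p : M) (x y z u : TangentSpace I p) : ℝ :=
  g p (curvatureField cov (FiberBundle.extend E x) (FiberBundle.extend E y)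
    (FiberBundle.extend E z) p) u

/-- `∇` is the Levi-Civita connection of `g`: it is torsion-free and `∇ g = 0`. -/
structure IsLeviCivita (g : Π p : M, TangentSpace I p → TangentSpace I p → ℝ)
    (nabla : CovariantDerivative I E (TangentSpace I : M → Type _)) : Prop where
  torsion_free : nabla.torsion = 0
  metric : ∀ (Y Z : Π p : M, TangentSpace I p) (p : M) (x : TangentSpace I p),
    MDiffAt (T% Y) p → MDiffAt (T% Z) p →
      mvfderiv I (fun q => g q (Y q) (Z q)) p x
        = g p (nabla Y p x) (Z p) + g p (Y p) (nabla Z p x)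

/-- `(M, J, g)` is an almost complex manifold with Norden metric: `g` is a smooth
pseudo-Riemannian metric, `J` a smooth field of endomorphisms with `J² = -1`, and
`g(JX, JY) = -g(X, Y)`. -/
structure IsAlmostComplexNorden (J : Π p : M, TangentSpace I p →L[ℝ] TangentSpace I p)
    (g : Π p : M, TangentSpace I p →L[ℝ] TangentSpace I p →L[ℝ] ℝ) : Prop where
  smooth_metric : ContMDiff I (I.prod 𝓘(ℝ, E →L[ℝ] E →L[ℝ] ℝ)) ∞
    (fun p => Bundle.TotalSpace.mk' (E →L[ℝ] E →L[ℝ] ℝ)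
      (E := fun p : M => TangentSpace I p →L[ℝ] TangentSpace I p →L[ℝ] ℝ) p (g p))
  smooth_structure : ContMDiff I (I.prod 𝓘(ℝ, E →L[ℝ] E)) ∞
    (fun p => Bundle.TotalSpace.mk' (E →L[ℝ] E)
      (E := fun p : M => TangentSpace I p →L[ℝ] TangentSpace I p) p (J p))
  symm : ∀ p x y, g p x y = g p y x
  nondegenerate : ∀ p x, (∀ y, g p x y = 0) → x = 0
  sq : ∀ p x, J p (J p x) = -x
  norden : ∀ p x y, g p (J p x) (J p y) = -g p x y

/-- `(M, J, g)` is a Kähler manifold with Norden metric, and `∇` is its Levi-Civita connection: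
`∇ J = 0`. -/
structure IsKaehlerNorden (J : Π p : M, TangentSpace I p →L[ℝ] TangentSpace I p)
    (g : Π p : M, TangentSpace I p →L[ℝ] TangentSpace I p →L[ℝ] ℝ)
    (nabla : CovariantDerivative I E (TangentSpace I : M → Type _)) : Prop where
  almost_complex : IsAlmostComplexNorden J g
  levi_civita : IsLeviCivita (fun p x y => g p x y) nabla
  parallel : ∀ (Y : Π p : M, TangentSpace I p) (p : M) (x : TangentSpace I p),
    MDiffAt (T% Y) p → covDerivEnd (fun Y p x => nabla Y p x) (fun p x => J p x) Y p x = 0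

/-- The section spanned by `x`, `y` is totally real: it is orthogonal to its image under `J`. -/
def IsTotallyReal {V : Type*} (g : V → V → ℝ) (J : V → V) (x y : V) : Prop :=
  g (J x) x = 0 ∧ g (J x) y = 0 ∧ g (J y) x = 0 ∧ g (J y) y = 0

/-- The manifold has constant totally real sectional curvatures `ν` and `ν̃`: for all bases
`{x, y}` of nondegenerate totally real sections at `p`,
`R(x,y,y,x) / π₁(x,y,y,x) = ν(p)` and `R(x,y,y,Jx) / π₁(x,y,y,x) = ν̃(p)`. -/
def HasConstantTotallyRealCurvatures (J : Π p : M, TangentSpace I p →L[ℝ] TangentSpace I p)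
    (g : Π p : M, TangentSpace I p →L[ℝ] TangentSpace I p →L[ℝ] ℝ)
    (nabla : CovariantDerivative I E (TangentSpace I : M → Type _)) (ν νt : M → ℝ) : Prop :=
  ∀ (p : M) (x y : TangentSpace I p),
    pi1 (fun a b => g p a b) x y y x ≠ 0 →
    IsTotallyReal (fun a b => g p a b) (fun a => J p a) x y →
    curvatureTensor (fun p a b => g p a b) (fun Y p x => nabla Y p x) p x y y x
          / pi1 (fun a b => g p a b) x y y x
        = ν p ∧
      curvatureTensor (fun p a b => g p a b) (fun Y p x => nabla Y p x) p x y y (J p x)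
          / pi1 (fun a b => g p a b) x y y x
        = νt p

/-- The canonical connection of an almost contact structure `(φ, ξ, η)` with Levi-Civita
connection `∇`:
`D_x Y = ∇_x Y + 1/2 {(∇_x φ) φY + (∇_x η)(Y) ξ} - η(Y) ∇_x ξ`. -/
def canonicalConnection (nabla : CovariantDerivative I E (TangentSpace I : M → Type _))
    (φ : Π p : M, TangentSpace I p →ₗ[ℝ] TangentSpace I p) (ξ : Π p : M, TangentSpace I p)
    (η : Π p : M, TangentSpace I p →ₗ[ℝ] ℝ) (Y : Π p : M, TangentSpace I p)
    (p : M) (x : TangentSpace I p) : TangentSpace I p :=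
  nabla Y p x
    + (1 / 2 : ℝ) • (covDerivEnd (fun Y p x => nabla Y p x) (fun p x => φ p x)
          (fun q => φ q (Y q)) p x
        + covDerivForm (fun Y p x => nabla Y p x) (fun p x => η p x) Y p x • ξ p)
    - η p (Y p) • nabla ξ p x

end Connections

/-! ### Real time-like hypersurfaces -/

section Hypersurfaces

variable {E : Type*} [NormedAddCommGroup E] [NormedSpace ℝ E] [FiniteDimensional ℝ E]
  {H : Type*} [TopologicalSpace H] {I : ModelWithCorners ℝ E H}
  {M : Type*} [TopologicalSpace M] [ChartedSpace H M] [IsManifold I ∞ M]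
  {E' : Type*} [NormedAddCommGroup E'] [NormedSpace ℝ E'] [FiniteDimensional ℝ E']
  {H' : Type*} [TopologicalSpace H'] {I' : ModelWithCorners ℝ E' H'}
  {M' : Type*} [TopologicalSpace M'] [ChartedSpace H' M'] [IsManifold I' ∞ M']

/-- `f` is a smooth immersion of `M` in `M'` and `N` a smooth field of time-like unit normals
along `f`. -/
structure IsTimelikeImmersion (g' : Π p : M', TangentSpace I' p →L[ℝ] TangentSpace I' p →L[ℝ] ℝ)
    (f : M → M') (N : Π p : M, TangentSpace I' (f p)) : Prop where
  smooth : ContMDiff I I' ∞ f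
  immersion : ∀ p, Function.Injective (mfderiv I I' f p)
  smooth_normal : ContMDiff I I'.tangent ∞
    (fun p => (⟨f p, N p⟩ : TangentBundle I' M'))
  normal : ∀ p x, g' (f p) (N p) (mfderiv I I' f p x) = 0
  timelike_unit : ∀ p, g' (f p) (N p) (N p) = -1

/-- The induced metric `g = g'|_M`. -/
def inducedMetric (g' : Π p : M', TangentSpace I' p →L[ℝ] TangentSpace I' p →L[ℝ] ℝ)
    (f : M → M') (p : M) (x y : TangentSpace I p) : ℝ :=
  g' (f p) (mfderiv I I' f p x) (mfderiv I I' f p y)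

/-- For a vector `w` of `M'` at `f p` that is tangent to the immersed manifold, the vector of `M`
at `p` whose image under the (injective) differential of `f` is `w`. -/
def toTangent (I : ModelWithCorners ℝ E H) [IsManifold I ∞ M] (I' : ModelWithCorners ℝ E' H')
    (f : M → M') (p : M) : TangentSpace I' (f p) →ₗ[ℝ] TangentSpace I p :=
  (mfderiv I I' f p : TangentSpace I p →ₗ[ℝ] TangentSpace I' (f p)).leftInverse

/-- The covariant derivative `∇'_x V` at `p` of a vector field `V` along the map `f`. In the frame
`(e_i)` of `TM'` near `f p` given by the bundle chart at `f p`, one has `V = ∑ V^i (e_i ∘ f)`, and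
`∇'_x V = ∑ (dV^i(x) e_i + V^i ∇'_{df(x)} e_i)`; the second summand is `∇'_{df(x)}` of the section
with constant components `V^i(p)`. -/
def covAlong (nabla' : CovariantDerivative I' E' (TangentSpace I' : M' → Type _))
    (f : M → M') (V : Π p : M, TangentSpace I' (f p)) (p : M) :
    TangentSpace I p →L[ℝ] TangentSpace I' (f p) :=
  (Bundle.Trivialization.symmL ℝ (trivializationAt E' (TangentSpace I' : M' → Type _) (f p)) (f p)) ∘L
      mvfderiv I (fun q => (trivializationAt E' (TangentSpace I' : M' → Type _) (f p)
        ⟨f q, V q⟩).2) p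
    + (nabla' (FiberBundle.extend E' (V p)) (f p)) ∘L mfderiv I I' f p

/-- The second fundamental tensor `A` given by the Weingarten formula `∇'_x N = -A x`. -/
def shapeOperator (nabla' : CovariantDerivative I' E' (TangentSpace I' : M' → Type _))
    (f : M → M') (N : Π p : M, TangentSpace I' (f p)) (p : M) :
    TangentSpace I p →ₗ[ℝ] TangentSpace I p :=
  -(toTangent I I' f p ∘ₗ (covAlong (I := I) nabla' f N p).toLinearMap)

variable (J : Π p : M', TangentSpace I' p →L[ℝ] TangentSpace I' p)
  (g' : Π p : M', TangentSpace I' p →L[ℝ] TangentSpace I' p →L[ℝ] ℝ)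
  (f : M → M') (N : Π p : M, TangentSpace I' (f p))

/-- `t = arctan g'(N, JN)`. -/
def angle (p : M) : ℝ := Real.arctan (g' (f p) (N p) (J (f p) (N p)))

/-- `η = cos t · g'(·, JN)`, where `g'(·, JN) = g'(JN, ·)`. -/
def eta (I : ModelWithCorners ℝ E H) [IsManifold I ∞ M] (p : M) : TangentSpace I p →ₗ[ℝ] ℝ :=
  Real.cos (angle J g' f N p) •
    (g' (f p) (J (f p) (N p)) ∘L mfderiv I I' f p : TangentSpace I p →L[ℝ] ℝ).toLinearMap

/-- `ξ = sin t · N + cos t · JN`. -/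
def xi (I : ModelWithCorners ℝ E H) [IsManifold I ∞ M] (p : M) : TangentSpace I p :=
  toTangent I I' f p
    (Real.sin (angle J g' f N p) • N p + Real.cos (angle J g' f N p) • J (f p) (N p))

/-- `φ = J + cos t · g'(·, JN) {cos t · N - sin t · JN}`. -/
def phi (I : ModelWithCorners ℝ E H) [IsManifold I ∞ M] (p : M) :
    TangentSpace I p →ₗ[ℝ] TangentSpace I p :=
  toTangent I I' f p ∘ₗ
    ((J (f p) ∘L mfderiv I I' f p : TangentSpace I p →L[ℝ] TangentSpace I' (f p)).toLinearMap
      + (eta J g' f N I p).smulRight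
        (Real.cos (angle J g' f N p) • N p - Real.sin (angle J g' f N p) • J (f p) (N p)))

/-- The canonical curvature tensor `K`: the curvature tensor of the canonical connection of the
induced almost contact structure, where `∇` is the Levi-Civita connection of the induced metric. -/
def canonicalCurvature (nabla : CovariantDerivative I E (TangentSpace I : M → Type _)) (p : M)
    (x y z u : TangentSpace I p) : ℝ :=
  curvatureTensor (inducedMetric g' f)
    (canonicalConnection nabla (phi J g' f N I) (xi J g' f N I) (eta J g' f N I)) p x y z u

end Hypersurfaces

end NordenGeometry

end

open NordenGeometry

/-!
The proof reduces everything to one identity: the canonical connection `D` of the hypersurface is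
the connection that the ambient `∇'` induces on the contact distribution `ker η`, made trivial on
`ξ`. Let `P` be the orthogonal projection of the ambient tangent space along `N` and `JN`; its image
is the `J`-invariant image of `ker η`, and `df φ = J P df`. The Gauss formula and `∇' J = 0` turn the
definition of `D` into
`df (D_x Z) = P ∇'_x (P df Z) + x(η Z) ξ` (`mfderiv_canonicalConnection`).

Differentiating once more, the only correction comes from moving `P` past `∇'`
(`proj_covAlong_proj`): it is a combination of `P ∇'_x N = -P df (A x)` and its image under `J`,
whose coefficients are those of `N` and `JN` in `∇'_y (P df Z)`. Since `P df Z` is orthogonal to `N`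
and `JN`, these coefficients are again values of `A`. The result is a Gauss equation
(`mfderiv_curvatureField`): `K` is `R'` with its third argument projected to `ker η`, plus terms that
are quadratic in `A`, and the derivatives of `η Z` along `ξ` cancel.

The ambient curvature is `R' = ν' (π₁ - π₂) + ν̃' π₃` (`riemann_eq`). A nondegenerate Norden metric is
the real part of a complex bilinear form, so that the tangent space is `W ⊕ J W`, with `W` the real
span of a complex orthonormal basis (`exists_realForm`). All planes in `W` are totally real and the
metric is positive definite on `W`; hence the difference of both sides has vanishing sectional values
on `W`, and vanishes there by polarization. Since `R'` commutes with `J`, it can be moved between any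
two arguments (`pure_second`), and the difference vanishes everywhere (`eq_of_constant_totallyReal`).

Inserting this into the Gauss equation gives the formula for `K` (`canonicalCurvature_eq`). The rest
is linear algebra at one point: the formula expresses `K` in terms of the tensors
`g(Sy, z) g(Tx, u) - g(Sx, z) g(Ty, u)` with `S`, `T` among `-φ²`, `φ` and their compositions with
`A` (`eq_wedge`); the contractions of these are traces (`scalarCurvature_wedge`).

The covariant derivative along `f` and the curvature tensors are handled in the charts of `M'`:
the Levi-Civita connection is given there by the Christoffel symbols of the metric (`coord_nabla`),
hence it is regular, and so is `covAlong` (`coord_covAlong`), for which the Leibniz rules, the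
symmetry of second derivatives and the curvature identity follow by computation.
-/

noncomputable section

open scoped Topology

set_option linter.unusedSectionVars false
set_option maxSynthPendingDepth 3

namespace NordenGeometry

/-! ### Functions, coordinates of tangent vectors, and vector fields along maps -/

section FunctionCalculus

variable {E : Type*} [NormedAddCommGroup E] [NormedSpace ℝ E]
  {M : Type*} [TopologicalSpace M] [ChartedSpace E M]
  {F G : Type*} [NormedAddCommGroup F] [NormedSpace ℝ F] [NormedAddCommGroup G] [NormedSpace ℝ G]

theorem hasMFDerivAt_mvfderiv {h : M → F} {q : M} (hh : MDifferentiableAt 𝓘(ℝ, E) 𝓘(ℝ, F) h q) :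
    HasMFDerivAt 𝓘(ℝ, E) 𝓘(ℝ, F) h q (mvfderiv 𝓘(ℝ, E) h q) :=
  hh.hasMFDerivAt

theorem mvfderiv_eq_of_hasMFDerivAt {h : M → F} {q : M} {L : TangentSpace 𝓘(ℝ, E) q →L[ℝ] F}
    (hh : HasMFDerivAt 𝓘(ℝ, E) 𝓘(ℝ, F) h q L) : mvfderiv 𝓘(ℝ, E) h q = L :=
  hh.mfderiv

theorem mvfderiv_eq_of_eventuallyEq {h k : M → F} {q : M} (hk : h =ᶠ[𝓝 q] k) :
    mvfderiv 𝓘(ℝ, E) h q = mvfderiv 𝓘(ℝ, E) k q := by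
  have h1 : mfderiv 𝓘(ℝ, E) 𝓘(ℝ, F) h q = mfderiv 𝓘(ℝ, E) 𝓘(ℝ, F) k q := hk.mfderiv_eq
  ext x
  exact congrArg (fun L => (L x : F)) h1

theorem mvfderiv_fderiv_comp {φ : F → G} {h : M → F} {q : M} (hφ : DifferentiableAt ℝ φ (h q))
    (hh : MDifferentiableAt 𝓘(ℝ, E) 𝓘(ℝ, F) h q) :
    mvfderiv 𝓘(ℝ, E) (fun y => φ (h y)) q = (fderiv ℝ φ (h q)).comp (mvfderiv 𝓘(ℝ, E) h q) :=
  mvfderiv_eq_of_hasMFDerivAt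
    (hφ.hasFDerivAt.hasMFDerivAt.comp q (hasMFDerivAt_mvfderiv hh))

theorem mdifferentiableAt_comp_of_differentiableAt {φ : F → G} {h : M → F} {q : M}
    (hφ : DifferentiableAt ℝ φ (h q)) (hh : MDifferentiableAt 𝓘(ℝ, E) 𝓘(ℝ, F) h q) :
    MDifferentiableAt 𝓘(ℝ, E) 𝓘(ℝ, G) (fun y => φ (h y)) q :=
  hφ.mdifferentiableAt.comp q hh

theorem mdifferentiableAt_clm_apply {A : M → F →L[ℝ] G} {v : M → F} {q : M}
    (hA : MDifferentiableAt 𝓘(ℝ, E) 𝓘(ℝ, F →L[ℝ] G) A q)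
    (hv : MDifferentiableAt 𝓘(ℝ, E) 𝓘(ℝ, F) v q) :
    MDifferentiableAt 𝓘(ℝ, E) 𝓘(ℝ, G) (fun y => A y (v y)) q := by
  exact hA.clm_apply hv

theorem mvfderiv_clm_apply {A : M → F →L[ℝ] G} {v : M → F} {q : M}
    (hA : MDifferentiableAt 𝓘(ℝ, E) 𝓘(ℝ, F →L[ℝ] G) A q)
    (hv : MDifferentiableAt 𝓘(ℝ, E) 𝓘(ℝ, F) v q) (x : TangentSpace 𝓘(ℝ, E) q) :
    mvfderiv 𝓘(ℝ, E) (fun y => A y (v y)) q x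
      = mvfderiv 𝓘(ℝ, E) A q x (v q) + A q (mvfderiv 𝓘(ℝ, E) v q x) := by
  have h1 := mvfderiv_fderiv_comp (φ := fun z : (F →L[ℝ] G) × F => z.1 z.2)
    (h := fun y => (A y, v y)) (q := q) (E := E)
    ((isBoundedBilinearMap_apply.differentiableAt _)) (hA.prodMk_space hv)
  have h2 : mvfderiv 𝓘(ℝ, E) (fun y => (A y, v y)) q
      = (mvfderiv 𝓘(ℝ, E) A q).prod (mvfderiv 𝓘(ℝ, E) v q) :=
    mvfderiv_eq_of_hasMFDerivAt
      (HasMFDerivAt.prodMk (hasMFDerivAt_mvfderiv hA) (hasMFDerivAt_mvfderiv hv))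
  rw [h1, h2, (isBoundedBilinearMap_apply.hasFDerivAt (A q, v q)).fderiv]
  simp [add_comm]

end FunctionCalculus

section Coordinates

variable {E : Type*} [NormedAddCommGroup E] [NormedSpace ℝ E]
  {M : Type*} [TopologicalSpace M] [ChartedSpace E M] [IsManifold 𝓘(ℝ, E) ∞ M]
  {F : Type*} [NormedAddCommGroup F] [NormedSpace ℝ F]

/-- The components of tangent vectors at `y` in the coordinate frame of the chart at `y₀`. -/
def coord (y₀ y : M) : TangentSpace 𝓘(ℝ, E) y →L[ℝ] E :=
  (trivializationAt E (TangentSpace 𝓘(ℝ, E) : M → Type _) y₀).continuousLinearMapAt ℝ y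

/-- The tangent vector at `y` with given components in the coordinate frame of the chart
at `y₀`. -/
def coordSymm (y₀ y : M) : E →L[ℝ] TangentSpace 𝓘(ℝ, E) y :=
  (trivializationAt E (TangentSpace 𝓘(ℝ, E) : M → Type _) y₀).symmL ℝ y

variable {y₀ y : M}

theorem coord_eq_trivialization (hy : y ∈ (chartAt E y₀).source) (v : TangentSpace 𝓘(ℝ, E) y) :
    coord y₀ y v = (trivializationAt E (TangentSpace 𝓘(ℝ, E) : M → Type _) y₀ ⟨y, v⟩).2 := by
  unfold coord
  rw [Bundle.Trivialization.continuousLinearMapAt_apply_of_mem]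
  simpa using hy

@[simp] theorem coordSymm_coord (hy : y ∈ (chartAt E y₀).source) (v : TangentSpace 𝓘(ℝ, E) y) :
    coordSymm y₀ y (coord y₀ y v) = v :=
  Bundle.Trivialization.symmL_continuousLinearMapAt _ (by simpa using hy) v

@[simp] theorem coord_coordSymm (hy : y ∈ (chartAt E y₀).source) (v : E) :
    coord y₀ y (coordSymm y₀ y v) = v :=
  Bundle.Trivialization.continuousLinearMapAt_symmL _ (by simpa using hy) v

theorem coord_injective (hy : y ∈ (chartAt E y₀).source) :
    Function.Injective (coord y₀ y : TangentSpace 𝓘(ℝ, E) y → E) := by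
  intro v w h
  rw [← coordSymm_coord hy v, h, coordSymm_coord hy]

theorem coord_eq_mvfderiv (hy : y ∈ (chartAt E y₀).source) :
    coord y₀ y = mvfderiv 𝓘(ℝ, E) (extChartAt 𝓘(ℝ, E) y₀) y :=
  TangentBundle.continuousLinearMapAt_trivializationAt hy

theorem mdifferentiableAt_chart (hy : y ∈ (chartAt E y₀).source) :
    MDifferentiableAt 𝓘(ℝ, E) 𝓘(ℝ, E) (extChartAt 𝓘(ℝ, E) y₀) y :=
  mdifferentiableAt_extChartAt hy

theorem extend_eq_coordSymm (hy : y ∈ (chartAt E y₀).source) (v : TangentSpace 𝓘(ℝ, E) y₀) :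
    (FiberBundle.extend E v : Π z : M, TangentSpace 𝓘(ℝ, E) z) y
      = coordSymm y₀ y (coord y₀ y₀ v) := by
  rw [coord_eq_trivialization (mem_chart_source E y₀)]
  unfold FiberBundle.extend coordSymm
  rw [Bundle.Trivialization.symmL_apply]
  simpa using hy

end Coordinates

section AlongMaps

variable {E : Type*} [NormedAddCommGroup E] [NormedSpace ℝ E]
  {M : Type*} [TopologicalSpace M] [ChartedSpace E M] [IsManifold 𝓘(ℝ, E) ∞ M]
  {E' : Type*} [NormedAddCommGroup E'] [NormedSpace ℝ E']
  {M' : Type*} [TopologicalSpace M'] [ChartedSpace E' M'] [IsManifold 𝓘(ℝ, E') ∞ M']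
  {f : M → M'} {V : Π p : M, TangentSpace 𝓘(ℝ, E') (f p)}

variable (E) in
/-- The vector field `V` along the map `f` is of class `C^k` at `q`. -/
def ContAlongAt (k : ℕ∞ω) (f : M → M') (V : Π p : M, TangentSpace 𝓘(ℝ, E') (f p)) (q : M) : Prop :=
  ContMDiffAt 𝓘(ℝ, E) 𝓘(ℝ, E').tangent k (fun p => (⟨f p, V p⟩ : TangentBundle 𝓘(ℝ, E') M')) q

variable (E) in
/-- The vector field `V` along the map `f` is differentiable at `q`. -/
def DiffAlongAt (f : M → M') (V : Π p : M, TangentSpace 𝓘(ℝ, E') (f p)) (q : M) : Prop :=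
  MDifferentiableAt 𝓘(ℝ, E) 𝓘(ℝ, E').tangent
    (fun p => (⟨f p, V p⟩ : TangentBundle 𝓘(ℝ, E') M')) q

theorem contMDiffVectorBundle_tangent (k : ℕ) :
    ContMDiffVectorBundle k E' (TangentSpace 𝓘(ℝ, E') : M' → Type _) 𝓘(ℝ, E') :=
  have : IsManifold 𝓘(ℝ, E') ((k : ℕ∞ω) + 1) M' := IsManifold.of_le (n := ∞) (by
    exact_mod_cast (le_top : ((k + 1 : ℕ) : ℕ∞) ≤ ⊤))
  inferInstance

theorem coord_eventuallyEq {q : M} {y₀ : M'} (hq : f q ∈ (chartAt E' y₀).source)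
    (hf : ContinuousAt f q) :
    (fun p => coord y₀ (f p) (V p)) =ᶠ[𝓝 q] fun p =>
      (trivializationAt E' (TangentSpace 𝓘(ℝ, E') : M' → Type _) y₀ ⟨f p, V p⟩).2 := by
  filter_upwards [hf ((chartAt E' y₀).open_source.mem_nhds hq)] with p hp
  exact coord_eq_trivialization hp (V p)

theorem contAlongAt_iff {k : ℕ} {q : M} {y₀ : M'} (hq : f q ∈ (chartAt E' y₀).source)
    (hf : ContMDiffAt 𝓘(ℝ, E) 𝓘(ℝ, E') k f q) :
    ContAlongAt E k f V q ↔
      ContMDiffAt 𝓘(ℝ, E) 𝓘(ℝ, E') k (fun p => coord y₀ (f p) (V p)) q := by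
  have := contMDiffVectorBundle_tangent (E' := E') (M' := M') k
  unfold ContAlongAt
  rw [(coord_eventuallyEq hq hf.continuousAt).contMDiffAt_iff]
  refine (Bundle.Trivialization.contMDiffAt_iff
    (e := trivializationAt E' (TangentSpace 𝓘(ℝ, E') : M' → Type _) y₀) ?_).trans ?_
  · simpa using hq
  · exact and_iff_right hf

theorem diffAlongAt_iff {q : M} {y₀ : M'} (hq : f q ∈ (chartAt E' y₀).source)
    (hf : MDifferentiableAt 𝓘(ℝ, E) 𝓘(ℝ, E') f q) :
    DiffAlongAt E f V q ↔
      MDifferentiableAt 𝓘(ℝ, E) 𝓘(ℝ, E') (fun p => coord y₀ (f p) (V p)) q := by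
  unfold DiffAlongAt
  rw [(coord_eventuallyEq hq hf.continuousAt).mdifferentiableAt_iff]
  refine (Bundle.Trivialization.mdifferentiableAt_totalSpace_iff 𝓘(ℝ, E')
    (trivializationAt E' (TangentSpace 𝓘(ℝ, E') : M' → Type _) y₀) _ ?_).trans ?_
  · simpa using hq
  · exact and_iff_right hf

theorem ContAlongAt.diffAlongAt {k : ℕ} {q : M} (h : ContAlongAt E k f V q) (hk : k ≠ 0) :
    DiffAlongAt E f V q :=
  ContMDiffAt.mdifferentiableAt h (by exact_mod_cast hk)

end AlongMaps

/-! ### The Lie bracket as a commutator of derivations -/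

section Brackets

variable {E : Type*} [NormedAddCommGroup E] [NormedSpace ℝ E] [FiniteDimensional ℝ E]
  {M : Type*} [TopologicalSpace M] [ChartedSpace E M] [IsManifold 𝓘(ℝ, E) ∞ M]
  {F : Type*} [NormedAddCommGroup F] [NormedSpace ℝ F]
  {X Y : Π p : M, TangentSpace 𝓘(ℝ, E) p}

theorem mvfderiv_eq_fderiv_chart {h : M → F} {q₀ q : M} (hq : q ∈ (chartAt E q₀).source)
    (hh : MDifferentiableAt 𝓘(ℝ, E) 𝓘(ℝ, F) h q) (x : TangentSpace 𝓘(ℝ, E) q) :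
    mvfderiv 𝓘(ℝ, E) h q x
      = fderiv ℝ (h ∘ (extChartAt 𝓘(ℝ, E) q₀).symm) (extChartAt 𝓘(ℝ, E) q₀ q) (coord q₀ q x) := by
  have hsymm : MDifferentiableAt 𝓘(ℝ, E) 𝓘(ℝ, E) (extChartAt 𝓘(ℝ, E) q₀).symm
      (extChartAt 𝓘(ℝ, E) q₀ q) := by
    have := mdifferentiableWithinAt_extChartAt_symm (I := 𝓘(ℝ, E)) (x := q₀)
      (z := extChartAt 𝓘(ℝ, E) q₀ q)
      ((extChartAt 𝓘(ℝ, E) q₀).map_source (by simpa using hq))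
    simpa [mdifferentiableWithinAt_univ] using this
  have hleft : (extChartAt 𝓘(ℝ, E) q₀).symm (extChartAt 𝓘(ℝ, E) q₀ q) = q :=
    (extChartAt 𝓘(ℝ, E) q₀).left_inv (by simpa using hq)
  have hcomp : MDifferentiableAt 𝓘(ℝ, E) 𝓘(ℝ, F) (h ∘ (extChartAt 𝓘(ℝ, E) q₀).symm)
      (extChartAt 𝓘(ℝ, E) q₀ q) :=
    MDifferentiableAt.comp _ (by rw [hleft]; exact hh) hsymm
  have hev : h =ᶠ[𝓝 q] fun p =>
      (h ∘ (extChartAt 𝓘(ℝ, E) q₀).symm) (extChartAt 𝓘(ℝ, E) q₀ p) := by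
    filter_upwards [(chartAt E q₀).open_source.mem_nhds hq] with p hp
    simp only [Function.comp]
    rw [(extChartAt 𝓘(ℝ, E) q₀).left_inv (by simpa using hp)]
  rw [mvfderiv_eq_of_eventuallyEq hev, mvfderiv_fderiv_comp hcomp.differentiableAt
    (mdifferentiableAt_chart hq), coord_eq_mvfderiv hq]
  rfl

theorem contDiffAt_comp_chart_symm {k : ℕ∞ω} (hk : k ≤ ∞) {h : M → F} {q : M}
    (hh : ContMDiffAt 𝓘(ℝ, E) 𝓘(ℝ, F) k h q) :
    ContDiffAt ℝ k (h ∘ (extChartAt 𝓘(ℝ, E) q).symm) (extChartAt 𝓘(ℝ, E) q q) := by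
  have hsymm : ContMDiffAt 𝓘(ℝ, E) 𝓘(ℝ, E) ∞ (extChartAt 𝓘(ℝ, E) q).symm
      (extChartAt 𝓘(ℝ, E) q q) := by
    have := contMDiffWithinAt_extChartAt_symm_range (I := 𝓘(ℝ, E)) (n := ∞) q
      (mem_extChartAt_target (I := 𝓘(ℝ, E)) q)
    simpa [contMDiffWithinAt_univ] using this
  have hleft : (extChartAt 𝓘(ℝ, E) q).symm (extChartAt 𝓘(ℝ, E) q q) = q :=
    extChartAt_to_inv q
  exact (ContMDiffAt.comp _ (by rw [hleft]; exact hh) (hsymm.of_le hk)).contDiffAt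

theorem contMDiffAt_chart (q : M) {k : ℕ∞ω} (hk : k ≤ ∞) :
    ContMDiffAt 𝓘(ℝ, E) 𝓘(ℝ, E) k (extChartAt 𝓘(ℝ, E) q) q :=
  (contMDiffAt_extChartAt (n := ∞)).of_le hk

theorem tendsto_chart_symm (q : M) :
    Filter.Tendsto (extChartAt 𝓘(ℝ, E) q).symm (𝓝 (extChartAt 𝓘(ℝ, E) q q)) (𝓝 q) := by
  have := continuousAt_extChartAt_symm (I := 𝓘(ℝ, E)) q
  unfold ContinuousAt at this
  rwa [extChartAt_to_inv] at this

theorem eventually_mem_target (q : M) :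
    ∀ᶠ z in 𝓝 (extChartAt 𝓘(ℝ, E) q q), z ∈ (extChartAt 𝓘(ℝ, E) q).target :=
  extChartAt_target_mem_nhds q

theorem mpullbackWithin_chart_symm_eventuallyEq (X : Π p : M, TangentSpace 𝓘(ℝ, E) p) (q : M) :
    VectorField.mpullbackWithin 𝓘(ℝ, E) 𝓘(ℝ, E) (extChartAt 𝓘(ℝ, E) q).symm X
        (Set.range 𝓘(ℝ, E)) =ᶠ[𝓝 (extChartAt 𝓘(ℝ, E) q q)]
      fun z => coord q ((extChartAt 𝓘(ℝ, E) q).symm z) (X ((extChartAt 𝓘(ℝ, E) q).symm z)) := by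
  filter_upwards [eventually_mem_target q] with z hz
  have hysrc : (extChartAt 𝓘(ℝ, E) q).symm z ∈ (chartAt E q).source := by
    have := (extChartAt 𝓘(ℝ, E) q).map_target hz
    rwa [extChartAt_source] at this
  have hinv := isInvertible_mfderivWithin_extChartAt_symm (I := 𝓘(ℝ, E)) hz
  rw [VectorField.mpullbackWithin_apply]
  have h1 : ∀ v : TangentSpace 𝓘(ℝ, E) z, mfderivWithin 𝓘(ℝ, E) 𝓘(ℝ, E) (extChartAt 𝓘(ℝ, E) q).symm
      (Set.range 𝓘(ℝ, E)) z v = coordSymm (E := E) q ((extChartAt 𝓘(ℝ, E) q).symm z) v := by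
    intro v
    have h2 := TangentBundle.symmL_trivializationAt (𝕜 := ℝ) (I := 𝓘(ℝ, E)) hysrc
    rw [(extChartAt 𝓘(ℝ, E) q).right_inv hz] at h2
    exact (congrArg (fun L => L v) h2).symm
  have h3 := hinv.inverse_apply_self
    (coord (E := E) q ((extChartAt 𝓘(ℝ, E) q).symm z) (X ((extChartAt 𝓘(ℝ, E) q).symm z)))
  refine Eq.trans (congrArg _ ?_) h3
  exact ((h1 _).trans (coordSymm_coord hysrc _)).symm

theorem eventually_contMDiffAt {k : ℕ} {h : M → F} {q : M}
    (hh : ContMDiffAt 𝓘(ℝ, E) 𝓘(ℝ, F) k h q) :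
    ∀ᶠ y in 𝓝 q, ContMDiffAt 𝓘(ℝ, E) 𝓘(ℝ, F) k h y :=
  (contMDiffAt_iff_contMDiffAt_nhds (by simp)).1 hh

theorem mvfderiv_apply_eventuallyEq {h : M → F} {q : M}
    (hh : ContMDiffAt 𝓘(ℝ, E) 𝓘(ℝ, F) (1 : ℕ) h q) (X : Π p : M, TangentSpace 𝓘(ℝ, E) p) :
    (fun y => mvfderiv 𝓘(ℝ, E) h y (X y)) =ᶠ[𝓝 q] fun y =>
      fderiv ℝ (h ∘ (extChartAt 𝓘(ℝ, E) q).symm) (extChartAt 𝓘(ℝ, E) q y) (coord q y (X y)) := by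
  filter_upwards [eventually_contMDiffAt hh, (chartAt E q).open_source.mem_nhds
    (mem_chart_source E q)] with y hy hy'
  exact mvfderiv_eq_fderiv_chart hy' (ContMDiffAt.mdifferentiableAt hy (by simp)) _

theorem mdifferentiableAt_mvfderiv_apply {h : M → F} {q : M}
    (hh : ContMDiffAt 𝓘(ℝ, E) 𝓘(ℝ, F) (2 : ℕ) h q) (hX : DiffAlongAt E id X q) :
    MDifferentiableAt 𝓘(ℝ, E) 𝓘(ℝ, F) (fun y => mvfderiv 𝓘(ℝ, E) h y (X y)) q := by
  refine MDifferentiableAt.congr_of_eventuallyEq ?_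
    (mvfderiv_apply_eventuallyEq (hh.of_le (by norm_num)) X)
  have hd : ContDiffAt ℝ 1 (fderiv ℝ (h ∘ (extChartAt 𝓘(ℝ, E) q).symm))
      (extChartAt 𝓘(ℝ, E) q q) :=
    (contDiffAt_comp_chart_symm (by norm_cast) hh).fderiv_right (by norm_num)
  have hX' := (diffAlongAt_iff (y₀ := q) (mem_chart_source E q) mdifferentiableAt_id).1 hX
  exact mdifferentiableAt_clm_apply (mdifferentiableAt_comp_of_differentiableAt
    (hd.differentiableAt one_ne_zero) (mdifferentiableAt_chart (mem_chart_source E q))) hX'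

/-- The Lie bracket acts on vector-valued functions as the commutator of the directional
derivatives. -/
theorem mvfderiv_mlieBracket {h : M → F} {q : M} (hh : ContMDiffAt 𝓘(ℝ, E) 𝓘(ℝ, F) (2 : ℕ) h q)
    (hX : DiffAlongAt E id X q) (hY : DiffAlongAt E id Y q) :
    mvfderiv 𝓘(ℝ, E) h q (VectorField.mlieBracket 𝓘(ℝ, E) X Y q)
      = mvfderiv 𝓘(ℝ, E) (fun y => mvfderiv 𝓘(ℝ, E) h y (Y y)) q (X q)
        - mvfderiv 𝓘(ℝ, E) (fun y => mvfderiv 𝓘(ℝ, E) h y (X y)) q (Y q) := by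
  have hq := mem_chart_source E q
  have hleft : (extChartAt 𝓘(ℝ, E) q).symm (extChartAt 𝓘(ℝ, E) q q) = q := extChartAt_to_inv q
  have hd : ∀ {Z : Π p : M, TangentSpace 𝓘(ℝ, E) p}, DiffAlongAt E id Z q →
      DifferentiableAt ℝ (fun z => coord q ((extChartAt 𝓘(ℝ, E) q).symm z)
        (Z ((extChartAt 𝓘(ℝ, E) q).symm z))) (extChartAt 𝓘(ℝ, E) q q) := by
    intro Z hZ
    have hZ' := (diffAlongAt_iff (y₀ := q) (mem_chart_source E q) mdifferentiableAt_id).1 hZ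
    have hsymm : MDifferentiableAt 𝓘(ℝ, E) 𝓘(ℝ, E) (extChartAt 𝓘(ℝ, E) q).symm
        (extChartAt 𝓘(ℝ, E) q q) := by
      have := mdifferentiableWithinAt_extChartAt_symm (I := 𝓘(ℝ, E)) (x := q)
        (z := extChartAt 𝓘(ℝ, E) q q) (mem_extChartAt_target (I := 𝓘(ℝ, E)) q)
      simpa [mdifferentiableWithinAt_univ] using this
    have h3 : MDifferentiableAt 𝓘(ℝ, E) 𝓘(ℝ, E) (fun p => coord q p (Z p))
        ((extChartAt 𝓘(ℝ, E) q).symm (extChartAt 𝓘(ℝ, E) q q)) := by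
      rw [hleft]; exact hZ'
    exact (MDifferentiableAt.comp _ h3 hsymm).differentiableAt
  have hfd : ∀ (Z W : Π p : M, TangentSpace 𝓘(ℝ, E) p), DiffAlongAt E id Z q →
      mvfderiv 𝓘(ℝ, E) (fun y => mvfderiv 𝓘(ℝ, E) h y (Z y)) q (W q)
        = fderiv ℝ (fun z => fderiv ℝ (h ∘ (extChartAt 𝓘(ℝ, E) q).symm) z
            (coord q ((extChartAt 𝓘(ℝ, E) q).symm z) (Z ((extChartAt 𝓘(ℝ, E) q).symm z))))
          (extChartAt 𝓘(ℝ, E) q q) (coord q q (W q)) := by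
    intro Z W hZ
    rw [mvfderiv_eq_fderiv_chart hq (mdifferentiableAt_mvfderiv_apply hh hZ)]
    congr 1
    apply Filter.EventuallyEq.fderiv_eq
    have h4 := (tendsto_chart_symm (E := E) q).eventually
      (mvfderiv_apply_eventuallyEq (hh.of_le (by norm_num)) Z)
    filter_upwards [h4, eventually_mem_target q] with z hz hz'
    simp only [Function.comp] at hz ⊢
    rw [hz, (extChartAt 𝓘(ℝ, E) q).right_inv hz']
  rw [hfd Y X hY, hfd X Y hX,
    mvfderiv_eq_fderiv_chart hq (ContMDiffAt.mdifferentiableAt hh (by simp))]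
  have hbr : coord q q (VectorField.mlieBracket 𝓘(ℝ, E) X Y q)
      = VectorField.lieBracket ℝ (fun z => coord q ((extChartAt 𝓘(ℝ, E) q).symm z)
        (X ((extChartAt 𝓘(ℝ, E) q).symm z))) (fun z => coord q ((extChartAt 𝓘(ℝ, E) q).symm z)
        (Y ((extChartAt 𝓘(ℝ, E) q).symm z))) (extChartAt 𝓘(ℝ, E) q q) := by
    rw [← VectorField.mlieBracketWithin_univ, VectorField.mlieBracketWithin_apply]
    have hu : (extChartAt 𝓘(ℝ, E) q).symm ⁻¹' Set.univ ∩ Set.range 𝓘(ℝ, E)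
        = (Set.univ : Set E) := by simp
    rw [hu, coord_eq_mvfderiv hq]
    have hinv := isInvertible_mfderiv_extChartAt (I := 𝓘(ℝ, E))
      (mem_extChartAt_source (I := 𝓘(ℝ, E)) q)
    refine (hinv.self_apply_inverse _).trans ?_
    refine (congrFun (VectorField.lieBracketWithin_univ (E := E)) _).trans ?_
    exact Filter.EventuallyEq.lieBracket_vectorField_eq (E := E)
      (mpullbackWithin_chart_symm_eventuallyEq X q) (mpullbackWithin_chart_symm_eventuallyEq Y q)
  have h5 := contDiffAt_comp_chart_symm (by norm_cast) hh
  rw [hbr, VectorField.fderiv_apply_lieBracket h5 (by simp) (hd hY) (hd hX)]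
  rw [hleft]

theorem contMDiffAt_mvfderiv_apply {k : ℕ} {h : M → F} {q : M}
    (hh : ContMDiffAt 𝓘(ℝ, E) 𝓘(ℝ, F) ((k + 1 : ℕ) : ℕ∞ω) h q) (hX : ContAlongAt E k id X q) :
    ContMDiffAt 𝓘(ℝ, E) 𝓘(ℝ, F) k (fun y => mvfderiv 𝓘(ℝ, E) h y (X y)) q := by
  have h1 : ((1 : ℕ) : ℕ∞ω) ≤ ((k + 1 : ℕ) : ℕ∞ω) := by exact_mod_cast Nat.le_add_left 1 k
  refine ContMDiffAt.congr_of_eventuallyEq ?_ (mvfderiv_apply_eventuallyEq (hh.of_le h1) X)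
  have hk : ((k : ℕ) : ℕ∞ω) ≤ ∞ := by exact_mod_cast (le_top : ((k : ℕ) : ℕ∞) ≤ ⊤)
  have hk1 : ((k + 1 : ℕ) : ℕ∞ω) ≤ ∞ := by exact_mod_cast (le_top : ((k + 1 : ℕ) : ℕ∞) ≤ ⊤)
  have hd : ContDiffAt ℝ k (fderiv ℝ (h ∘ (extChartAt 𝓘(ℝ, E) q).symm))
      (extChartAt 𝓘(ℝ, E) q q) :=
    (contDiffAt_comp_chart_symm hk1 hh).fderiv_right (by norm_cast)
  have hX' := (contAlongAt_iff (y₀ := q) (mem_chart_source E q) contMDiffAt_id).1 hX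
  exact (hd.contMDiffAt.comp q (contMDiffAt_chart q hk)).clm_apply hX'

end Brackets

/-! ### Coordinate vector fields and connections -/

section ConstantSections

variable {E : Type*} [NormedAddCommGroup E] [NormedSpace ℝ E] [FiniteDimensional ℝ E]
  {M : Type*} [TopologicalSpace M] [ChartedSpace E M] [IsManifold 𝓘(ℝ, E) ∞ M]
  {y₀ y : M}

theorem diffAlongAt_coordSymm (hy : y ∈ (chartAt E y₀).source) (v : E) :
    DiffAlongAt E id (fun z : M => coordSymm y₀ z v) y := by
  rw [diffAlongAt_iff (f := id) hy mdifferentiableAt_id]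
  refine MDifferentiableAt.congr_of_eventuallyEq (mdifferentiableAt_const (c := v)) ?_
  filter_upwards [(chartAt E y₀).open_source.mem_nhds hy] with z hz
  exact coord_coordSymm hz v

theorem contAlongAt_coordSymm (hy : y ∈ (chartAt E y₀).source) (v : E) (k : ℕ) :
    ContAlongAt E k id (fun z : M => coordSymm y₀ z v) y := by
  rw [contAlongAt_iff (f := id) hy contMDiffAt_id]
  refine ContMDiffAt.congr_of_eventuallyEq (contMDiffAt_const (c := v)) ?_
  filter_upwards [(chartAt E y₀).open_source.mem_nhds hy] with z hz
  exact coord_coordSymm hz v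

theorem mvfderiv_chart_coordSymm_eventuallyEq (hy : y ∈ (chartAt E y₀).source) (v : E) :
    (fun z => mvfderiv 𝓘(ℝ, E) (extChartAt 𝓘(ℝ, E) y₀) z (coordSymm y₀ z v))
      =ᶠ[𝓝 y] fun _ => v := by
  filter_upwards [(chartAt E y₀).open_source.mem_nhds hy] with z hz
  rw [← coord_eq_mvfderiv hz, coord_coordSymm hz]

/-- Coordinate vector fields commute. -/
theorem mlieBracket_coordSymm (hy : y ∈ (chartAt E y₀).source) (v w : E) :
    VectorField.mlieBracket 𝓘(ℝ, E) (fun z : M => coordSymm y₀ z v)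
      (fun z : M => coordSymm y₀ z w) y = 0 := by
  have hψ : ContMDiffAt 𝓘(ℝ, E) 𝓘(ℝ, E) (2 : ℕ) (extChartAt 𝓘(ℝ, E) y₀) y :=
    (contMDiffAt_extChartAt' (n := ∞) hy).of_le (by norm_cast)
  have h := mvfderiv_mlieBracket hψ (diffAlongAt_coordSymm hy v) (diffAlongAt_coordSymm hy w)
  rw [mvfderiv_eq_of_eventuallyEq (mvfderiv_chart_coordSymm_eventuallyEq hy w),
    mvfderiv_eq_of_eventuallyEq (mvfderiv_chart_coordSymm_eventuallyEq hy v),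
    mvfderiv_const, mvfderiv_const, ← coord_eq_mvfderiv hy] at h
  apply coord_injective hy
  rw [h]
  simp

/-- The derivative, in the coordinate frame of the chart at `y₀`, of the components of a vector
field. -/
def flatDerivative (y₀ : M) (s : Π z : M, TangentSpace 𝓘(ℝ, E) z) (y : M) :
    TangentSpace 𝓘(ℝ, E) y →L[ℝ] TangentSpace 𝓘(ℝ, E) y :=
  (coordSymm y₀ y).comp (mvfderiv 𝓘(ℝ, E) (fun z => coord y₀ z (s z)) y)

/-- The flat connection of the coordinate frame. -/
theorem isCovariantDerivativeOn_flatDerivative (y₀ : M) :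
    IsCovariantDerivativeOn E (flatDerivative (E := E) y₀) (chartAt E y₀).source where
  add {σ σ' x} hσ hσ' hx := by
    have h1 : MDifferentiableAt 𝓘(ℝ, E) 𝓘(ℝ, E) (fun z => coord y₀ z (σ z)) x :=
      (diffAlongAt_iff (f := id) hx mdifferentiableAt_id).1 hσ
    have h2 : MDifferentiableAt 𝓘(ℝ, E) 𝓘(ℝ, E) (fun z => coord y₀ z (σ' z)) x :=
      (diffAlongAt_iff (f := id) hx mdifferentiableAt_id).1 hσ'
    have h3 : (fun z => coord y₀ z ((σ + σ') z))
        = (fun z => coord y₀ z (σ z)) + fun z => coord y₀ z (σ' z) := by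
      ext z; simp
    unfold flatDerivative
    rw [h3, mvfderiv_add h1 h2, ContinuousLinearMap.comp_add]
  leibniz {σ g x} hσ hg hx := by
    have h1 : MDifferentiableAt 𝓘(ℝ, E) 𝓘(ℝ, E) (fun z => coord y₀ z (σ z)) x :=
      (diffAlongAt_iff (f := id) hx mdifferentiableAt_id).1 hσ
    have h3 : (fun z => coord y₀ z ((g • σ) z)) = g • fun z => coord y₀ z (σ z) := by
      ext z; simp
    unfold flatDerivative
    rw [h3, mvfderiv_smul hg h1]
    ext v
    simp [coordSymm_coord hx]

/-- A covariant derivative differs from the derivative of the components by a term that depends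
only on the value of the field: the difference with `flatDerivative` is tensorial. -/
theorem coord_nabla_eq (nabla : CovariantDerivative 𝓘(ℝ, E) E (TangentSpace 𝓘(ℝ, E) : M → Type _))
    (hy : y ∈ (chartAt E y₀).source) {s : Π z : M, TangentSpace 𝓘(ℝ, E) z}
    (hs : DiffAlongAt E id s y) (w : TangentSpace 𝓘(ℝ, E) y) :
    coord y₀ y (nabla s y w) = mvfderiv 𝓘(ℝ, E) (fun z => coord y₀ z (s z)) y w
      + coord y₀ y (nabla (fun z => coordSymm y₀ z (coord y₀ y (s y))) y w) := by
  have h1 : IsCovariantDerivativeOn E nabla.toFun (chartAt E y₀).source :=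
    nabla.isCovariantDerivativeOn
  have h2 := isCovariantDerivativeOn_flatDerivative (E := E) y₀
  have hc := diffAlongAt_coordSymm hy (coord y₀ y (s y))
  have h3 := IsCovariantDerivativeOn.difference_apply h1 h2 hy hs
  have h4 := IsCovariantDerivativeOn.difference_apply h1 h2 hy hc
  rw [coordSymm_coord hy, h3] at h4
  have h5 := congrArg (fun L => coord y₀ y (L w)) h4
  have h6 : mvfderiv 𝓘(ℝ, E) (fun z => coord y₀ z (coordSymm y₀ z (coord y₀ y (s y)))) y = 0 := by
    rw [mvfderiv_eq_of_eventuallyEq (k := fun _ => coord y₀ y (s y)), mvfderiv_const]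
    filter_upwards [(chartAt E y₀).open_source.mem_nhds hy] with z hz
    exact coord_coordSymm hz _
  simp only [sub_apply, map_sub, flatDerivative, h6,
    ContinuousLinearMap.comp_apply, coord_coordSymm hy, ContinuousLinearMap.comp_zero, sub_zero] at h5
  rw [← h5]
  abel

end ConstantSections

/-! ### The metric, the complex structure and the Christoffel symbols in a chart -/

section MetricInCoordinates

variable {E : Type*} [NormedAddCommGroup E] [NormedSpace ℝ E] [FiniteDimensional ℝ E]
  {M : Type*} [TopologicalSpace M] [ChartedSpace E M] [IsManifold 𝓘(ℝ, E) ∞ M]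

/-- The components of a field of bilinear forms in the chart at `y₀`, as a function on the model
space. -/
def metricCoord (g : Π p : M, TangentSpace 𝓘(ℝ, E) p →L[ℝ] TangentSpace 𝓘(ℝ, E) p →L[ℝ] ℝ)
    (y₀ : M) (x : E) : E →L[ℝ] E →L[ℝ] ℝ :=
  (ContinuousLinearMap.precomp ℝ (coordSymm y₀ ((extChartAt 𝓘(ℝ, E) y₀).symm x))).comp
    ((g ((extChartAt 𝓘(ℝ, E) y₀).symm x)).comp
      (coordSymm y₀ ((extChartAt 𝓘(ℝ, E) y₀).symm x)))

/-- The components of a field of endomorphisms in the chart at `y₀`, as a function on the model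
space. -/
def endCoord (J : Π p : M, TangentSpace 𝓘(ℝ, E) p →L[ℝ] TangentSpace 𝓘(ℝ, E) p)
    (y₀ : M) (x : E) : E →L[ℝ] E :=
  (coord y₀ ((extChartAt 𝓘(ℝ, E) y₀).symm x)).comp
    ((J ((extChartAt 𝓘(ℝ, E) y₀).symm x)).comp
      (coordSymm y₀ ((extChartAt 𝓘(ℝ, E) y₀).symm x)))

variable {J : Π p : M, TangentSpace 𝓘(ℝ, E) p →L[ℝ] TangentSpace 𝓘(ℝ, E) p}
  {g : Π p : M, TangentSpace 𝓘(ℝ, E) p →L[ℝ] TangentSpace 𝓘(ℝ, E) p →L[ℝ] ℝ}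
  {y₀ y : M}

theorem metricCoord_apply (x : E) (v w : E) :
    metricCoord g y₀ x v w
      = g ((extChartAt 𝓘(ℝ, E) y₀).symm x) (coordSymm y₀ ((extChartAt 𝓘(ℝ, E) y₀).symm x) v)
          (coordSymm y₀ ((extChartAt 𝓘(ℝ, E) y₀).symm x) w) := rfl

theorem metricCoord_chart (hy : y ∈ (chartAt E y₀).source) (v w : E) :
    metricCoord g y₀ (extChartAt 𝓘(ℝ, E) y₀ y) v w
      = g y (coordSymm y₀ y v) (coordSymm y₀ y w) := by
  rw [metricCoord_apply, (extChartAt 𝓘(ℝ, E) y₀).left_inv (by rwa [extChartAt_source])]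

theorem metricCoord_coord (hy : y ∈ (chartAt E y₀).source) (v w : TangentSpace 𝓘(ℝ, E) y) :
    metricCoord g y₀ (extChartAt 𝓘(ℝ, E) y₀ y) (coord y₀ y v) (coord y₀ y w) = g y v w := by
  rw [metricCoord_chart hy, coordSymm_coord hy, coordSymm_coord hy]

theorem endCoord_chart (hy : y ∈ (chartAt E y₀).source) (v : E) :
    endCoord J y₀ (extChartAt 𝓘(ℝ, E) y₀ y) v = coord y₀ y (J y (coordSymm y₀ y v)) := by
  have : endCoord J y₀ (extChartAt 𝓘(ℝ, E) y₀ y) v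
      = coord y₀ ((extChartAt 𝓘(ℝ, E) y₀).symm (extChartAt 𝓘(ℝ, E) y₀ y))
        (J ((extChartAt 𝓘(ℝ, E) y₀).symm (extChartAt 𝓘(ℝ, E) y₀ y))
          (coordSymm y₀ ((extChartAt 𝓘(ℝ, E) y₀).symm (extChartAt 𝓘(ℝ, E) y₀ y)) v)) := rfl
  rw [this, (extChartAt 𝓘(ℝ, E) y₀).left_inv (by rwa [extChartAt_source])]

theorem endCoord_coord (hy : y ∈ (chartAt E y₀).source) (v : TangentSpace 𝓘(ℝ, E) y) :
    endCoord J y₀ (extChartAt 𝓘(ℝ, E) y₀ y) (coord y₀ y v) = coord y₀ y (J y v) := by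
  rw [endCoord_chart hy, coordSymm_coord hy]

theorem contDiffOn_of_comp_chart {F : Type*} [NormedAddCommGroup F] [NormedSpace ℝ F]
    {h : M → F} {k : ℕ}
    (hh : ∀ y ∈ (chartAt E y₀).source, ContMDiffAt 𝓘(ℝ, E) 𝓘(ℝ, F) k h y) :
    ContDiffOn ℝ k (h ∘ (extChartAt 𝓘(ℝ, E) y₀).symm) (extChartAt 𝓘(ℝ, E) y₀).target := by
  have hs : ContMDiffOn 𝓘(ℝ, E) 𝓘(ℝ, E) ∞ (extChartAt 𝓘(ℝ, E) y₀).symm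
      (extChartAt 𝓘(ℝ, E) y₀).target := contMDiffOn_extChartAt_symm y₀
  refine ContMDiffOn.contDiffOn ?_
  intro x hx
  have hx' := (extChartAt 𝓘(ℝ, E) y₀).map_target hx
  rw [extChartAt_source] at hx'
  exact (hh _ hx').comp_contMDiffWithinAt x ((hs x hx).of_le (by
    exact_mod_cast (le_top : ((k : ℕ) : ℕ∞) ≤ ⊤)))

theorem contDiffOn_metricCoord (hJ : IsAlmostComplexNorden J g) (y₀ : M) (k : ℕ) :
    ContDiffOn ℝ k (metricCoord g y₀) (extChartAt 𝓘(ℝ, E) y₀).target := by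
  rw [contDiffOn_clm_apply]
  intro v
  rw [contDiffOn_clm_apply]
  intro w
  refine contDiffOn_of_comp_chart (h := fun z => g z (coordSymm y₀ z v) (coordSymm y₀ z w)) ?_
  intro y hy
  have h1 := (hJ.smooth_metric y).of_le
    (by exact_mod_cast (le_top : ((k : ℕ) : ℕ∞) ≤ ⊤) : ((k : ℕ) : ℕ∞ω) ≤ ∞)
  have hk := contMDiffVectorBundle_tangent (E' := E) (M' := M) k
  have h2 := contAlongAt_coordSymm hy v k
  have h3 := contAlongAt_coordSymm hy w k
  have h4 := ContMDiffAt.clm_bundle_apply₂ (F₁ := E) (F₂ := E) (F₃ := ℝ)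
    (E₁ := fun p : M => TangentSpace 𝓘(ℝ, E) p) (E₂ := fun p : M => TangentSpace 𝓘(ℝ, E) p)
    (E₃ := Bundle.Trivial M ℝ) (b := id) (ψ := g) h1 h2 h3
  exact (Bundle.contMDiffAt_totalSpace.1 h4).2

theorem contDiffOn_endCoord (hJ : IsAlmostComplexNorden J g) (y₀ : M) (k : ℕ) :
    ContDiffOn ℝ k (endCoord J y₀) (extChartAt 𝓘(ℝ, E) y₀).target := by
  rw [contDiffOn_clm_apply]
  intro v
  refine contDiffOn_of_comp_chart (h := fun z => coord y₀ z (J z (coordSymm y₀ z v))) ?_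
  intro y hy
  have h1 := (hJ.smooth_structure y).of_le
    (by exact_mod_cast (le_top : ((k : ℕ) : ℕ∞) ≤ ⊤) : ((k : ℕ) : ℕ∞ω) ≤ ∞)
  have hk := contMDiffVectorBundle_tangent (E' := E) (M' := M) k
  have h2 := contAlongAt_coordSymm hy v k
  have h4 := ContMDiffAt.clm_bundle_apply (F₁ := E) (F₂ := E)
    (E₁ := fun p : M => TangentSpace 𝓘(ℝ, E) p) (E₂ := fun p : M => TangentSpace 𝓘(ℝ, E) p)
    (b := id) (ϕ := J) h1 h2
  exact (contAlongAt_iff (f := id) hy contMDiffAt_id).1 h4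

/-- Nondegeneracy, as invertibility of the map to the dual; it makes the Christoffel symbols smooth. -/
theorem isInvertible_metricCoord (hJ : IsAlmostComplexNorden J g)
    (hy : y ∈ (chartAt E y₀).source) :
    (metricCoord g y₀ (extChartAt 𝓘(ℝ, E) y₀ y)).IsInvertible := by
  set B := metricCoord g y₀ (extChartAt 𝓘(ℝ, E) y₀ y) with hB
  have hinj : Function.Injective B := by
    rw [injective_iff_map_eq_zero]
    intro v hv
    have h0 : coordSymm y₀ y v = 0 := by
      refine hJ.nondegenerate y _ fun w => ?_
      have := congrArg (fun L => L (coord y₀ y w)) hv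
      simp only [hB, metricCoord_chart hy, coordSymm_coord hy] at this
      simpa using this
    rw [← coord_coordSymm hy v, h0, map_zero]
  have hfin : Module.finrank ℝ E = Module.finrank ℝ (E →L[ℝ] ℝ) := by
    rw [← (LinearMap.toContinuousLinearMap (𝕜 := ℝ) (E := E) (F' := ℝ)).finrank_eq]
    exact (Subspace.dual_finrank_eq (K := ℝ) (V := E)).symm
  refine ⟨(LinearEquiv.ofInjectiveOfFinrankEq (B : E →ₗ[ℝ] E →L[ℝ] ℝ) hinj
    hfin).toContinuousLinearEquiv, ?_⟩
  ext v w
  exact congrArg (fun L : E →ₗ[ℝ] E →L[ℝ] ℝ => L v w)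
    (LinearEquiv.coe_ofInjectiveOfFinrankEq (B : E →ₗ[ℝ] E →L[ℝ] ℝ) hinj hfin)

/-- The first-kind Christoffel symbols
`θ(w, a, b) = ½ (∂_w g(a, b) + ∂_a g(w, b) - ∂_b g(w, a))` of a field of bilinear forms on the
model space. -/
def christoffelFirst (γ : E → E →L[ℝ] E →L[ℝ] ℝ) (x : E) : E →L[ℝ] E →L[ℝ] E →L[ℝ] ℝ :=
  (1 / 2 : ℝ) • (fderiv ℝ γ x + (fderiv ℝ γ x).flip
    - ((ContinuousLinearMap.flipₗᵢ ℝ E E ℝ : (E →L[ℝ] E →L[ℝ] ℝ) →L[ℝ] (E →L[ℝ] E →L[ℝ] ℝ)).comp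
        (fderiv ℝ γ x).flip))

/-- The Christoffel symbols of a field of nondegenerate symmetric bilinear forms on the model
space. -/
def christoffel (γ : E → E →L[ℝ] E →L[ℝ] ℝ) (x : E) : E →L[ℝ] E →L[ℝ] E :=
  (ContinuousLinearMap.compL ℝ E (E →L[ℝ] ℝ) E (γ x).inverse).comp (christoffelFirst γ x)

theorem christoffelFirst_apply (γ : E → E →L[ℝ] E →L[ℝ] ℝ) (x w a b : E) :
    christoffelFirst γ x w a b
      = 1 / 2 * (fderiv ℝ γ x w a b + fderiv ℝ γ x a w b - fderiv ℝ γ x b w a) := by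
  simp [christoffelFirst]

theorem christoffel_apply (γ : E → E →L[ℝ] E →L[ℝ] ℝ) (x w a : E) :
    christoffel γ x w a = (γ x).inverse (christoffelFirst γ x w a) := rfl

theorem contDiffAt_christoffel {γ : E → E →L[ℝ] E →L[ℝ] ℝ} {x : E} {k : ℕ}
    (hγ : ContDiffAt ℝ ((k + 1 : ℕ) : ℕ∞ω) γ x) (hinv : (γ x).IsInvertible) :
    ContDiffAt ℝ k (christoffel γ) x := by
  have h1 : ContDiffAt ℝ k (fderiv ℝ γ) x := hγ.fderiv_right (by norm_cast)
  have h2 : ContDiffAt ℝ k (fun z => (fderiv ℝ γ z).flip) x :=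
    (ContinuousLinearMap.flipₗᵢ ℝ E E (E →L[ℝ] ℝ)).contDiff.contDiffAt.comp x h1
  have h3 : ContDiffAt ℝ k (christoffelFirst γ) x :=
    ((h1.add h2).sub (contDiffAt_const.clm_comp h2)).const_smul _
  have h4 : ContDiffAt ℝ k (fun z => (γ z).inverse) x :=
    hinv.contDiffAt_map_inverse.comp x (hγ.of_le (by norm_cast; exact Nat.le_succ k))
  exact ((ContinuousLinearMap.compL ℝ E (E →L[ℝ] ℝ) E).contDiff.contDiffAt.comp x h4).clm_comp h3

end MetricInCoordinates

/-! ### The Levi-Civita connection in a chart -/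

section LeviCivitaInCoordinates

variable {E : Type*} [NormedAddCommGroup E] [NormedSpace ℝ E] [FiniteDimensional ℝ E]
  {M : Type*} [TopologicalSpace M] [ChartedSpace E M] [IsManifold 𝓘(ℝ, E) ∞ M]
  {J : Π p : M, TangentSpace 𝓘(ℝ, E) p →L[ℝ] TangentSpace 𝓘(ℝ, E) p}
  {g : Π p : M, TangentSpace 𝓘(ℝ, E) p →L[ℝ] TangentSpace 𝓘(ℝ, E) p →L[ℝ] ℝ}
  {nabla : CovariantDerivative 𝓘(ℝ, E) E (TangentSpace 𝓘(ℝ, E) : M → Type _)}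
  {y₀ y : M}

theorem chart_mem_target (hy : y ∈ (chartAt E y₀).source) :
    extChartAt 𝓘(ℝ, E) y₀ y ∈ (extChartAt 𝓘(ℝ, E) y₀).target :=
  (extChartAt 𝓘(ℝ, E) y₀).map_source (by rwa [extChartAt_source])

theorem target_mem_nhds_chart (hy : y ∈ (chartAt E y₀).source) :
    (extChartAt 𝓘(ℝ, E) y₀).target ∈ 𝓝 (extChartAt 𝓘(ℝ, E) y₀ y) :=
  (isOpen_extChartAt_target y₀).mem_nhds (chart_mem_target hy)

theorem contDiffAt_metricCoord (hA : IsAlmostComplexNorden J g)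
    (hy : y ∈ (chartAt E y₀).source) (k : ℕ) :
    ContDiffAt ℝ k (metricCoord g y₀) (extChartAt 𝓘(ℝ, E) y₀ y) :=
  (contDiffOn_metricCoord hA y₀ k).contDiffAt (target_mem_nhds_chart hy)

theorem contDiffAt_endCoord (hA : IsAlmostComplexNorden J g)
    (hy : y ∈ (chartAt E y₀).source) (k : ℕ) :
    ContDiffAt ℝ k (endCoord J y₀) (extChartAt 𝓘(ℝ, E) y₀ y) :=
  (contDiffOn_endCoord hA y₀ k).contDiffAt (target_mem_nhds_chart hy)

theorem differentiableAt_metricCoord (hA : IsAlmostComplexNorden J g)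
    (hy : y ∈ (chartAt E y₀).source) :
    DifferentiableAt ℝ (metricCoord g y₀) (extChartAt 𝓘(ℝ, E) y₀ y) :=
  (contDiffAt_metricCoord hA hy 1).differentiableAt (by simp)

theorem differentiableAt_endCoord (hA : IsAlmostComplexNorden J g)
    (hy : y ∈ (chartAt E y₀).source) :
    DifferentiableAt ℝ (endCoord J y₀) (extChartAt 𝓘(ℝ, E) y₀ y) :=
  (contDiffAt_endCoord hA hy 1).differentiableAt (by simp)

theorem contDiffAt_christoffel_metricCoord (hA : IsAlmostComplexNorden J g)
    (hy : y ∈ (chartAt E y₀).source) (k : ℕ) :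
    ContDiffAt ℝ k (christoffel (metricCoord g y₀)) (extChartAt 𝓘(ℝ, E) y₀ y) :=
  contDiffAt_christoffel (contDiffAt_metricCoord hA hy _) (isInvertible_metricCoord hA hy)

theorem IsLeviCivita.nabla_sub_nabla {g : Π p : M, TangentSpace 𝓘(ℝ, E) p →
    TangentSpace 𝓘(ℝ, E) p → ℝ} (hL : IsLeviCivita g nabla)
    {X Y : Π p : M, TangentSpace 𝓘(ℝ, E) p} (hX : DiffAlongAt E id X y)
    (hY : DiffAlongAt E id Y y) :
    nabla Y y (X y) - nabla X y (Y y) = VectorField.mlieBracket 𝓘(ℝ, E) X Y y :=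
  (CovariantDerivative.torsion_eq_zero_iff nabla).1 hL.torsion_free hX hY

theorem nabla_coordSymm_comm (hL : IsLeviCivita (fun p x y => g p x y) nabla)
    (hy : y ∈ (chartAt E y₀).source) (a w : E) :
    nabla (fun z => coordSymm y₀ z a) y (coordSymm y₀ y w)
      = nabla (fun z => coordSymm y₀ z w) y (coordSymm y₀ y a) := by
  have h := hL.nabla_sub_nabla (diffAlongAt_coordSymm hy w) (diffAlongAt_coordSymm hy a)
  rw [mlieBracket_coordSymm hy] at h
  exact sub_eq_zero.1 h

/-- The condition `∇ g = 0` in a chart. -/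
theorem fderiv_metricCoord_apply (hA : IsAlmostComplexNorden J g)
    (hL : IsLeviCivita (fun p x y => g p x y) nabla)
    (hy : y ∈ (chartAt E y₀).source) (w a b : E) :
    fderiv ℝ (metricCoord g y₀) (extChartAt 𝓘(ℝ, E) y₀ y) w a b
      = g y (nabla (fun z => coordSymm y₀ z a) y (coordSymm y₀ y w)) (coordSymm y₀ y b)
        + g y (coordSymm y₀ y a) (nabla (fun z => coordSymm y₀ z b) y (coordSymm y₀ y w)) := by
  rw [← hL.metric (fun z => coordSymm y₀ z a) (fun z => coordSymm y₀ z b) y (coordSymm y₀ y w)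
    (diffAlongAt_coordSymm hy a) (diffAlongAt_coordSymm hy b)]
  have hd := differentiableAt_metricCoord hA hy
  have hev : (fun q => g q (coordSymm y₀ q a) (coordSymm y₀ q b)) =ᶠ[𝓝 y]
      fun q => metricCoord g y₀ (extChartAt 𝓘(ℝ, E) y₀ q) a b := by
    filter_upwards [(chartAt E y₀).open_source.mem_nhds hy] with q hq
    rw [metricCoord_chart hq]
  rw [mvfderiv_eq_of_eventuallyEq hev, mvfderiv_fderiv_comp (φ := fun x => metricCoord g y₀ x a b)
    ((hd.clm_apply (differentiableAt_const a)).clm_apply (differentiableAt_const b))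
    (mdifferentiableAt_chart hy), ContinuousLinearMap.comp_apply, ← coord_eq_mvfderiv hy,
    coord_coordSymm hy, fderiv_clm_apply (hd.clm_apply (differentiableAt_const a))
    (differentiableAt_const b), fderiv_clm_apply hd (differentiableAt_const a)]
  simp

/-- The Koszul formula on coordinate vector fields, whose brackets vanish. -/
theorem coord_nabla_coordSymm (hA : IsAlmostComplexNorden J g)
    (hL : IsLeviCivita (fun p x y => g p x y) nabla)
    (hy : y ∈ (chartAt E y₀).source) (w a : E) :
    coord y₀ y (nabla (fun z => coordSymm y₀ z a) y (coordSymm y₀ y w))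
      = christoffel (metricCoord g y₀) (extChartAt 𝓘(ℝ, E) y₀ y) w a := by
  have hinv := isInvertible_metricCoord hA hy
  rw [christoffel_apply, ← hinv.inverse_apply_self
    (coord y₀ y (nabla (fun z => coordSymm y₀ z a) y (coordSymm y₀ y w)))]
  congr 1
  ext b
  rw [christoffelFirst_apply, fderiv_metricCoord_apply hA hL hy, fderiv_metricCoord_apply hA hL hy,
    fderiv_metricCoord_apply hA hL hy, metricCoord_chart hy, coordSymm_coord hy,
    nabla_coordSymm_comm hL hy a w, nabla_coordSymm_comm hL hy b w, nabla_coordSymm_comm hL hy b a,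
    hA.symm y (coordSymm y₀ y a) (nabla (fun z => coordSymm y₀ z w) y (coordSymm y₀ y b))]
  ring

theorem christoffel_metricCoord_symm (hA : IsAlmostComplexNorden J g)
    (hL : IsLeviCivita (fun p x y => g p x y) nabla)
    (hy : y ∈ (chartAt E y₀).source) (w a : E) :
    christoffel (metricCoord g y₀) (extChartAt 𝓘(ℝ, E) y₀ y) w a
      = christoffel (metricCoord g y₀) (extChartAt 𝓘(ℝ, E) y₀ y) a w := by
  rw [← coord_nabla_coordSymm hA hL hy, ← coord_nabla_coordSymm hA hL hy,
    nabla_coordSymm_comm hL hy]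

/-- The Levi-Civita connection in a chart: `∇_w s = ds(w) + Γ(w, s)`. -/
theorem coord_nabla (hA : IsAlmostComplexNorden J g)
    (hL : IsLeviCivita (fun p x y => g p x y) nabla)
    (hy : y ∈ (chartAt E y₀).source) {s : Π z : M, TangentSpace 𝓘(ℝ, E) z}
    (hs : DiffAlongAt E id s y) (w : TangentSpace 𝓘(ℝ, E) y) :
    coord y₀ y (nabla s y w) = mvfderiv 𝓘(ℝ, E) (fun z => coord y₀ z (s z)) y w
      + christoffel (metricCoord g y₀) (extChartAt 𝓘(ℝ, E) y₀ y) (coord y₀ y w)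
        (coord y₀ y (s y)) := by
  rw [coord_nabla_eq nabla hy hs, ← coord_nabla_coordSymm hA hL hy, coordSymm_coord hy]

theorem fderiv_metricCoord (hA : IsAlmostComplexNorden J g)
    (hL : IsLeviCivita (fun p x y => g p x y) nabla)
    (hy : y ∈ (chartAt E y₀).source) (w a b : E) :
    fderiv ℝ (metricCoord g y₀) (extChartAt 𝓘(ℝ, E) y₀ y) w a b
      = metricCoord g y₀ (extChartAt 𝓘(ℝ, E) y₀ y)
          (christoffel (metricCoord g y₀) (extChartAt 𝓘(ℝ, E) y₀ y) w a) b
        + metricCoord g y₀ (extChartAt 𝓘(ℝ, E) y₀ y) a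
          (christoffel (metricCoord g y₀) (extChartAt 𝓘(ℝ, E) y₀ y) w b) := by
  rw [fderiv_metricCoord_apply hA hL hy, ← coord_nabla_coordSymm hA hL hy,
    ← coord_nabla_coordSymm hA hL hy, metricCoord_chart hy, metricCoord_chart hy,
    coordSymm_coord hy, coordSymm_coord hy]

/-- The condition `∇ J = 0` in a chart. -/
theorem fderiv_endCoord (hK : IsKaehlerNorden J g nabla)
    (hy : y ∈ (chartAt E y₀).source) (w a : E) :
    fderiv ℝ (endCoord J y₀) (extChartAt 𝓘(ℝ, E) y₀ y) w a
        + christoffel (metricCoord g y₀) (extChartAt 𝓘(ℝ, E) y₀ y) w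
          (endCoord J y₀ (extChartAt 𝓘(ℝ, E) y₀ y) a)
      = endCoord J y₀ (extChartAt 𝓘(ℝ, E) y₀ y)
          (christoffel (metricCoord g y₀) (extChartAt 𝓘(ℝ, E) y₀ y) w a) := by
  have hA := hK.almost_complex
  have hL := hK.levi_civita
  have hd := differentiableAt_endCoord hA hy
  have hev : (fun q => coord y₀ q (J q (coordSymm y₀ q a))) =ᶠ[𝓝 y]
      fun q => endCoord J y₀ (extChartAt 𝓘(ℝ, E) y₀ q) a := by
    filter_upwards [(chartAt E y₀).open_source.mem_nhds hy] with q hq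
    rw [endCoord_chart hq]
  have hda : DifferentiableAt ℝ (fun x => endCoord J y₀ x a) (extChartAt 𝓘(ℝ, E) y₀ y) :=
    hd.clm_apply (differentiableAt_const a)
  have hJs : DiffAlongAt E id (fun q => J q (coordSymm y₀ q a)) y := by
    rw [diffAlongAt_iff (f := id) hy mdifferentiableAt_id]
    exact (mdifferentiableAt_comp_of_differentiableAt hda
      (mdifferentiableAt_chart hy)).congr_of_eventuallyEq hev
  have h1 := hK.parallel (fun q => coordSymm y₀ q a) y (coordSymm y₀ y w)
    (diffAlongAt_coordSymm hy a)
  unfold covDerivEnd at h1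
  have h2 : coord y₀ y (nabla (fun q => J q (coordSymm y₀ q a)) y (coordSymm y₀ y w))
      = coord y₀ y (J y (nabla (fun q => coordSymm y₀ q a) y (coordSymm y₀ y w))) :=
    congrArg (coord y₀ y) (sub_eq_zero.1 h1)
  rw [coord_nabla hA hL hy hJs, mvfderiv_eq_of_eventuallyEq hev,
    mvfderiv_fderiv_comp (φ := fun x => endCoord J y₀ x a) hda (mdifferentiableAt_chart hy),
    ContinuousLinearMap.comp_apply, ← coord_eq_mvfderiv hy, coord_coordSymm hy,
    fderiv_clm_apply hd (differentiableAt_const a), ← endCoord_coord hy, ← endCoord_coord hy,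
    coord_coordSymm hy, coord_nabla_coordSymm hA hL hy] at h2
  simpa using h2

end LeviCivitaInCoordinates

/-! ### The covariant derivative along a map in a chart -/

section ChainRule

variable {E : Type*} [NormedAddCommGroup E] [NormedSpace ℝ E]
  {M : Type*} [TopologicalSpace M] [ChartedSpace E M]
  {E' : Type*} [NormedAddCommGroup E'] [NormedSpace ℝ E']
  {M' : Type*} [TopologicalSpace M'] [ChartedSpace E' M']
  {F : Type*} [NormedAddCommGroup F] [NormedSpace ℝ F] {f : M → M'} {q : M}

theorem mvfderiv_comp_mfderiv {h : M' → F} (hh : MDifferentiableAt 𝓘(ℝ, E') 𝓘(ℝ, F) h (f q))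
    (hf : MDifferentiableAt 𝓘(ℝ, E) 𝓘(ℝ, E') f q) (x : TangentSpace 𝓘(ℝ, E) q) :
    mvfderiv 𝓘(ℝ, E) (fun p => h (f p)) q x
      = mvfderiv 𝓘(ℝ, E') h (f q) (mfderiv 𝓘(ℝ, E) 𝓘(ℝ, E') f q x) := by
  have h1 : mvfderiv 𝓘(ℝ, E) (fun p => h (f p)) q
      = (mvfderiv 𝓘(ℝ, E') h (f q)).comp (mfderiv 𝓘(ℝ, E) 𝓘(ℝ, E') f q) :=
    mvfderiv_eq_of_hasMFDerivAt ((hasMFDerivAt_mvfderiv hh).comp q hf.hasMFDerivAt)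
  rw [h1]; rfl

end ChainRule

section AlongInCoordinates

variable {E : Type*} [NormedAddCommGroup E] [NormedSpace ℝ E] [FiniteDimensional ℝ E]
  {M : Type*} [TopologicalSpace M] [ChartedSpace E M] [IsManifold 𝓘(ℝ, E) ∞ M]
  {E' : Type*} [NormedAddCommGroup E'] [NormedSpace ℝ E'] [FiniteDimensional ℝ E']
  {M' : Type*} [TopologicalSpace M'] [ChartedSpace E' M'] [IsManifold 𝓘(ℝ, E') ∞ M']
  {J : Π p : M', TangentSpace 𝓘(ℝ, E') p →L[ℝ] TangentSpace 𝓘(ℝ, E') p}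
  {g : Π p : M', TangentSpace 𝓘(ℝ, E') p →L[ℝ] TangentSpace 𝓘(ℝ, E') p →L[ℝ] ℝ}
  {nabla : CovariantDerivative 𝓘(ℝ, E') E' (TangentSpace 𝓘(ℝ, E') : M' → Type _)}
  {f : M → M'} {V : Π p : M, TangentSpace 𝓘(ℝ, E') (f p)} {q : M} {y₀ : M'}

theorem coord_mfderiv (hf : MDifferentiableAt 𝓘(ℝ, E) 𝓘(ℝ, E') f q)
    (hq : f q ∈ (chartAt E' y₀).source) (x : TangentSpace 𝓘(ℝ, E) q) :
    coord y₀ (f q) (mfderiv 𝓘(ℝ, E) 𝓘(ℝ, E') f q x)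
      = mvfderiv 𝓘(ℝ, E) (fun p => extChartAt 𝓘(ℝ, E') y₀ (f p)) q x := by
  rw [mvfderiv_comp_mfderiv (mdifferentiableAt_chart hq) hf, coord_eq_mvfderiv hq]

theorem mdifferentiableAt_coord_comp_coordSymm {y₁ y : M'} (h₀ : y ∈ (chartAt E' y₀).source)
    (h₁ : y ∈ (chartAt E' y₁).source) :
    MDifferentiableAt 𝓘(ℝ, E') 𝓘(ℝ, E' →L[ℝ] E')
      (fun z => (coord (E := E') y₀ z).comp (coordSymm y₁ z)) y := by
  have := contMDiffVectorBundle_tangent (E' := E') (M' := M') 1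
  have h := (contMDiffAt_coordChangeL (n := ((1 : ℕ) : ℕ∞ω)) (IB := 𝓘(ℝ, E'))
    (e := trivializationAt E' (TangentSpace 𝓘(ℝ, E') : M' → Type _) y₁)
    (e' := trivializationAt E' (TangentSpace 𝓘(ℝ, E') : M' → Type _) y₀) (x := y)
    (by simpa using h₁) (by simpa using h₀)).mdifferentiableAt (by simp)
  refine h.congr_of_eventuallyEq ?_
  filter_upwards [(chartAt E' y₀).open_source.mem_nhds h₀,
    (chartAt E' y₁).open_source.mem_nhds h₁] with z hz₀ hz₁
  ext v
  rw [ContinuousLinearMap.comp_apply, coord_eq_trivialization hz₀]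
  unfold coordSymm
  rw [Bundle.Trivialization.symmL_apply _ (by simpa using hz₁)]
  exact (Bundle.Trivialization.coordChangeL_apply (R := ℝ)
    (trivializationAt E' (TangentSpace 𝓘(ℝ, E') : M' → Type _) y₁)
    (trivializationAt E' (TangentSpace 𝓘(ℝ, E') : M' → Type _) y₀) (b := z)
    ⟨by simpa using hz₁, by simpa using hz₀⟩ v).symm

theorem DiffAlongAt.congr {W : Π p : M, TangentSpace 𝓘(ℝ, E') (f p)} (hV : DiffAlongAt E f V q)
    (h : ∀ᶠ p in 𝓝 q, W p = V p) : DiffAlongAt E f W q :=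
  MDifferentiableAt.congr_of_eventuallyEq hV (h.mono fun p hp => by simp only [hp])

theorem ContAlongAt.congr {k : ℕ∞ω} {W : Π p : M, TangentSpace 𝓘(ℝ, E') (f p)}
    (hV : ContAlongAt E k f V q) (h : ∀ᶠ p in 𝓝 q, W p = V p) : ContAlongAt E k f W q :=
  ContMDiffAt.congr_of_eventuallyEq hV (h.mono fun p hp => by simp only [hp])

theorem nabla_congr (nabla : CovariantDerivative 𝓘(ℝ, E') E' (TangentSpace 𝓘(ℝ, E') : M' → Type _))
    {s s' : Π z : M', TangentSpace 𝓘(ℝ, E') z} {y : M'} (hs : DiffAlongAt E' id s y)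
    (h : ∀ᶠ z in 𝓝 y, s' z = s z) : nabla s' y = nabla s y :=
  (nabla.isCovariantDerivativeOn (s := Set.univ)).congr_of_eventuallyEq
    (DiffAlongAt.congr (f := id) hs h) hs Filter.univ_mem h

/-- The covariant derivative along a map in a chart of the target:
`∇_x V = dV(x) + Γ(df(x), V)`. -/
theorem coord_covAlong (hA : IsAlmostComplexNorden J g)
    (hL : IsLeviCivita (fun p x y => g p x y) nabla)
    (hf : MDifferentiableAt 𝓘(ℝ, E) 𝓘(ℝ, E') f q)
    (hq : f q ∈ (chartAt E' y₀).source) (hV : DiffAlongAt E f V q) (x : TangentSpace 𝓘(ℝ, E) q) :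
    coord y₀ (f q) (covAlong nabla f V q x)
      = mvfderiv 𝓘(ℝ, E) (fun p => coord y₀ (f p) (V p)) q x
        + christoffel (metricCoord g y₀) (extChartAt 𝓘(ℝ, E') y₀ (f q))
          (coord y₀ (f q) (mfderiv 𝓘(ℝ, E) 𝓘(ℝ, E') f q x)) (coord y₀ (f q) (V q)) := by
  have hq₁ : f q ∈ (chartAt E' (f q)).source := mem_chart_source E' (f q)
  have hT := mdifferentiableAt_coord_comp_coordSymm hq hq₁
  have hTf : MDifferentiableAt 𝓘(ℝ, E) 𝓘(ℝ, E' →L[ℝ] E')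
      (fun p => (coord (E := E') y₀ (f p)).comp (coordSymm (f q) (f p))) q :=
    MDifferentiableAt.comp q hT hf
  have hV₁ := (diffAlongAt_iff hq₁ hf).1 hV
  have hev : (fun p => coord y₀ (f p) (V p)) =ᶠ[𝓝 q] fun p =>
      ((coord y₀ (f p)).comp (coordSymm (f q) (f p))) (coord (f q) (f p) (V p)) := by
    filter_upwards [hf.continuousAt ((chartAt E' (f q)).open_source.mem_nhds hq₁)] with p hp
    rw [ContinuousLinearMap.comp_apply, coordSymm_coord hp]
  rw [mvfderiv_eq_of_eventuallyEq hev, mvfderiv_clm_apply hTf hV₁,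
    mvfderiv_comp_mfderiv hT hf]
  set v := coord (f q) (f q) (V q) with hv
  have hconst : mvfderiv 𝓘(ℝ, E') (fun z => (coord y₀ z).comp (coordSymm (f q) z)) (f q)
        (mfderiv 𝓘(ℝ, E) 𝓘(ℝ, E') f q x) v
      = mvfderiv 𝓘(ℝ, E') (fun z => coord y₀ z (coordSymm (f q) z v)) (f q)
        (mfderiv 𝓘(ℝ, E) 𝓘(ℝ, E') f q x) := by
    have h := mvfderiv_clm_apply hT (mdifferentiableAt_const (c := v))
      (mfderiv 𝓘(ℝ, E) 𝓘(ℝ, E') f q x)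
    rw [mvfderiv_const] at h
    simpa using h.symm
  rw [hconst]
  have hs : (FiberBundle.extend E' (V q) : Π z : M', TangentSpace 𝓘(ℝ, E') z)
      =ᶠ[𝓝 (f q)] fun z => coordSymm (f q) z v := by
    filter_upwards [(chartAt E' (f q)).open_source.mem_nhds hq₁] with z hz
    exact extend_eq_coordSymm hz _
  have h1 : nabla (FiberBundle.extend E' (V q)) (f q)
      = nabla (fun z => coordSymm (f q) z v) (f q) :=
    nabla_congr nabla (diffAlongAt_coordSymm hq₁ v) hs
  have h2 : covAlong nabla f V q x = coordSymm (f q) (f q)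
        (mvfderiv 𝓘(ℝ, E) (fun p => coord (f q) (f p) (V p)) q x)
      + nabla (FiberBundle.extend E' (V q)) (f q) (mfderiv 𝓘(ℝ, E) 𝓘(ℝ, E') f q x) := by
    rw [mvfderiv_eq_of_eventuallyEq (coord_eventuallyEq (V := V) hq₁ hf.continuousAt)]
    rfl
  rw [h2, map_add, h1, coord_nabla hA hL hq (diffAlongAt_coordSymm hq₁ v), hv,
    coordSymm_coord hq₁, ContinuousLinearMap.comp_apply]
  abel

end AlongInCoordinates

/-! ### Regularity and rules for the covariant derivative along a map -/

section Regularity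

variable {E : Type*} [NormedAddCommGroup E] [NormedSpace ℝ E] [FiniteDimensional ℝ E]
  {M : Type*} [TopologicalSpace M] [ChartedSpace E M] [IsManifold 𝓘(ℝ, E) ∞ M]
  {E' : Type*} [NormedAddCommGroup E'] [NormedSpace ℝ E'] [FiniteDimensional ℝ E']
  {M' : Type*} [TopologicalSpace M'] [ChartedSpace E' M'] [IsManifold 𝓘(ℝ, E') ∞ M']
  {J : Π p : M', TangentSpace 𝓘(ℝ, E') p →L[ℝ] TangentSpace 𝓘(ℝ, E') p}
  {g : Π p : M', TangentSpace 𝓘(ℝ, E') p →L[ℝ] TangentSpace 𝓘(ℝ, E') p →L[ℝ] ℝ}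
  {nabla : CovariantDerivative 𝓘(ℝ, E') E' (TangentSpace 𝓘(ℝ, E') : M' → Type _)}
  {f : M → M'} {V W : Π p : M, TangentSpace 𝓘(ℝ, E') (f p)} {q : M} {y₀ : M'}

theorem contMDiffAt_nat (hf : ContMDiff 𝓘(ℝ, E) 𝓘(ℝ, E') ∞ f) (q : M) (k : ℕ) :
    ContMDiffAt 𝓘(ℝ, E) 𝓘(ℝ, E') k f q :=
  (hf q).of_le (by exact_mod_cast (le_top : ((k : ℕ) : ℕ∞) ≤ ⊤))

theorem mdifferentiableAt_of_smooth (hf : ContMDiff 𝓘(ℝ, E) 𝓘(ℝ, E') ∞ f) (q : M) :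
    MDifferentiableAt 𝓘(ℝ, E) 𝓘(ℝ, E') f q :=
  (hf q).mdifferentiableAt (by simp)

theorem eventually_mem_chart_source (hf : ContMDiff 𝓘(ℝ, E) 𝓘(ℝ, E') ∞ f)
    (hq : f q ∈ (chartAt E' y₀).source) : ∀ᶠ p in 𝓝 q, f p ∈ (chartAt E' y₀).source :=
  hf.continuous.continuousAt ((chartAt E' y₀).open_source.mem_nhds hq)

theorem ContAlongAt.contMDiffAt_coord {k : ℕ} (hf : ContMDiff 𝓘(ℝ, E) 𝓘(ℝ, E') ∞ f)
    (hq : f q ∈ (chartAt E' y₀).source) (hV : ContAlongAt E k f V q) :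
    ContMDiffAt 𝓘(ℝ, E) 𝓘(ℝ, E') k (fun p => coord y₀ (f p) (V p)) q :=
  (contAlongAt_iff hq (contMDiffAt_nat hf q k)).1 hV

theorem DiffAlongAt.mdifferentiableAt_coord (hf : ContMDiff 𝓘(ℝ, E) 𝓘(ℝ, E') ∞ f)
    (hq : f q ∈ (chartAt E' y₀).source) (hV : DiffAlongAt E f V q) :
    MDifferentiableAt 𝓘(ℝ, E) 𝓘(ℝ, E') (fun p => coord y₀ (f p) (V p)) q :=
  (diffAlongAt_iff hq (mdifferentiableAt_of_smooth hf q)).1 hV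

theorem contAlongAt_of_coord {k : ℕ} (hf : ContMDiff 𝓘(ℝ, E) 𝓘(ℝ, E') ∞ f)
    {v : M → E'} (hv : ContMDiffAt 𝓘(ℝ, E) 𝓘(ℝ, E') k v q)
    (h : ∀ᶠ p in 𝓝 q, f p ∈ (chartAt E' (f q)).source → coord (f q) (f p) (V p) = v p) :
    ContAlongAt E k f V q := by
  have hq : f q ∈ (chartAt E' (f q)).source := mem_chart_source E' (f q)
  refine (contAlongAt_iff hq (contMDiffAt_nat hf q k)).2 (hv.congr_of_eventuallyEq ?_)
  filter_upwards [h, eventually_mem_chart_source hf hq] with p hp hs using hp hs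

theorem ContAlongAt.of_le {k l : ℕ} (hV : ContAlongAt E l f V q) (h : k ≤ l) :
    ContAlongAt E k f V q :=
  ContMDiffAt.of_le hV (by exact_mod_cast h)

theorem ContAlongAt.eventually {k : ℕ} (hf : ContMDiff 𝓘(ℝ, E) 𝓘(ℝ, E') ∞ f)
    (hV : ContAlongAt E k f V q) : ∀ᶠ p in 𝓝 q, ContAlongAt E k f V p := by
  have hq : f q ∈ (chartAt E' (f q)).source := mem_chart_source E' (f q)
  filter_upwards [eventually_contMDiffAt (hV.contMDiffAt_coord hf hq),
    eventually_mem_chart_source hf hq] with p hp hs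
  exact (contAlongAt_iff hs (contMDiffAt_nat hf p k)).2 hp

theorem ContAlongAt.add {k : ℕ} (hf : ContMDiff 𝓘(ℝ, E) 𝓘(ℝ, E') ∞ f)
    (hV : ContAlongAt E k f V q) (hW : ContAlongAt E k f W q) :
    ContAlongAt E k f (fun p => V p + W p) q := by
  have hq : f q ∈ (chartAt E' (f q)).source := mem_chart_source E' (f q)
  exact contAlongAt_of_coord hf ((hV.contMDiffAt_coord hf hq).add (hW.contMDiffAt_coord hf hq))
    (.of_forall fun p _ => map_add _ _ _)

theorem ContAlongAt.smul {k : ℕ} (hf : ContMDiff 𝓘(ℝ, E) 𝓘(ℝ, E') ∞ f) {h : M → ℝ}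
    (hh : ContMDiffAt 𝓘(ℝ, E) 𝓘(ℝ, ℝ) k h q) (hV : ContAlongAt E k f V q) :
    ContAlongAt E k f (fun p => h p • V p) q := by
  have hq : f q ∈ (chartAt E' (f q)).source := mem_chart_source E' (f q)
  exact contAlongAt_of_coord hf (hh.smul (hV.contMDiffAt_coord hf hq))
    (.of_forall fun p _ => map_smul _ _ _)

theorem ContAlongAt.neg {k : ℕ} (hf : ContMDiff 𝓘(ℝ, E) 𝓘(ℝ, E') ∞ f)
    (hV : ContAlongAt E k f V q) : ContAlongAt E k f (fun p => -V p) q := by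
  have hq : f q ∈ (chartAt E' (f q)).source := mem_chart_source E' (f q)
  exact contAlongAt_of_coord hf (hV.contMDiffAt_coord hf hq).neg
    (.of_forall fun p _ => map_neg _ _)

theorem ContAlongAt.sub {k : ℕ} (hf : ContMDiff 𝓘(ℝ, E) 𝓘(ℝ, E') ∞ f)
    (hV : ContAlongAt E k f V q) (hW : ContAlongAt E k f W q) :
    ContAlongAt E k f (fun p => V p - W p) q := by
  simpa only [sub_eq_add_neg] using hV.add hf (hW.neg hf)

theorem contMDiffAt_chart_comp (hf : ContMDiff 𝓘(ℝ, E) 𝓘(ℝ, E') ∞ f)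
    (hq : f q ∈ (chartAt E' y₀).source) (k : ℕ) :
    ContMDiffAt 𝓘(ℝ, E) 𝓘(ℝ, E') k (fun p => extChartAt 𝓘(ℝ, E') y₀ (f p)) q := by
  have h : ContMDiffAt 𝓘(ℝ, E') 𝓘(ℝ, E') (k : ℕ∞ω) (extChartAt 𝓘(ℝ, E') y₀) (f q) :=
    (contMDiffAt_extChartAt' (n := ∞) hq).of_le (by exact_mod_cast (le_top : ((k : ℕ) : ℕ∞) ≤ ⊤))
  exact ContMDiffAt.comp q h (contMDiffAt_nat hf q k)

theorem ContAlongAt.metric {k : ℕ} (hA : IsAlmostComplexNorden J g)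
    (hf : ContMDiff 𝓘(ℝ, E) 𝓘(ℝ, E') ∞ f)
    (hV : ContAlongAt E k f V q) (hW : ContAlongAt E k f W q) :
    ContMDiffAt 𝓘(ℝ, E) 𝓘(ℝ, ℝ) k (fun p => g (f p) (V p) (W p)) q := by
  have hq : f q ∈ (chartAt E' (f q)).source := mem_chart_source E' (f q)
  have h1 : ContMDiffAt 𝓘(ℝ, E) 𝓘(ℝ, E' →L[ℝ] E' →L[ℝ] ℝ) k
      (fun p => metricCoord g (f q) (extChartAt 𝓘(ℝ, E') (f q) (f p))) q :=
    (contDiffAt_metricCoord hA hq k).contMDiffAt.comp q (contMDiffAt_chart_comp hf hq k)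
  refine ((h1.clm_apply (hV.contMDiffAt_coord hf hq)).clm_apply
    (hW.contMDiffAt_coord hf hq)).congr_of_eventuallyEq ?_
  filter_upwards [eventually_mem_chart_source hf hq] with p hp
  rw [metricCoord_coord hp]

theorem ContAlongAt.structure {k : ℕ} (hA : IsAlmostComplexNorden J g)
    (hf : ContMDiff 𝓘(ℝ, E) 𝓘(ℝ, E') ∞ f) (hV : ContAlongAt E k f V q) :
    ContAlongAt E k f (fun p => J (f p) (V p)) q := by
  have hq : f q ∈ (chartAt E' (f q)).source := mem_chart_source E' (f q)
  have h1 : ContMDiffAt 𝓘(ℝ, E) 𝓘(ℝ, E' →L[ℝ] E') k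
      (fun p => endCoord J (f q) (extChartAt 𝓘(ℝ, E') (f q) (f p))) q :=
    (contDiffAt_endCoord hA hq k).contMDiffAt.comp q (contMDiffAt_chart_comp hf hq k)
  exact contAlongAt_of_coord hf (h1.clm_apply (hV.contMDiffAt_coord hf hq))
    (.of_forall fun p hp => (endCoord_coord hp _).symm)

theorem ContAlongAt.mfderiv_apply {k : ℕ} (hf : ContMDiff 𝓘(ℝ, E) 𝓘(ℝ, E') ∞ f)
    {X : Π p : M, TangentSpace 𝓘(ℝ, E) p} (hX : ContAlongAt E k id X q) :
    ContAlongAt E k f (fun p => mfderiv 𝓘(ℝ, E) 𝓘(ℝ, E') f p (X p)) q := by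
  have hq : f q ∈ (chartAt E' (f q)).source := mem_chart_source E' (f q)
  exact contAlongAt_of_coord hf
    (contMDiffAt_mvfderiv_apply (contMDiffAt_chart_comp hf hq (k + 1)) hX)
    (.of_forall fun p hp => coord_mfderiv (mdifferentiableAt_of_smooth hf p) hp _)

/-- The covariant derivative along `f` of a field of class `C^{k+1}` is of class `C^k`. -/
theorem ContAlongAt.covAlong {k : ℕ} (hA : IsAlmostComplexNorden J g)
    (hL : IsLeviCivita (fun p x y => g p x y) nabla)
    (hf : ContMDiff 𝓘(ℝ, E) 𝓘(ℝ, E') ∞ f) (hV : ContAlongAt E ((k + 1 : ℕ) : ℕ∞ω) f V q)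
    {X : Π p : M, TangentSpace 𝓘(ℝ, E) p} (hX : ContAlongAt E k id X q) :
    ContAlongAt E k f (fun p => covAlong nabla f V p (X p)) q := by
  have hq : f q ∈ (chartAt E' (f q)).source := mem_chart_source E' (f q)
  have h1 : ContMDiffAt 𝓘(ℝ, E) 𝓘(ℝ, E' →L[ℝ] E' →L[ℝ] E') k
      (fun p => christoffel (metricCoord g (f q)) (extChartAt 𝓘(ℝ, E') (f q) (f p))) q :=
    (contDiffAt_christoffel_metricCoord hA hq k).contMDiffAt.comp q
      (contMDiffAt_chart_comp hf hq k)
  have h2 := contMDiffAt_mvfderiv_apply (hV.contMDiffAt_coord hf hq) hX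
  have h3 := contMDiffAt_mvfderiv_apply (contMDiffAt_chart_comp hf hq (k + 1)) hX
  have h4 := (hV.of_le k.le_succ).contMDiffAt_coord hf hq
  refine contAlongAt_of_coord hf (h2.add ((h1.clm_apply h3).clm_apply h4)) ?_
  filter_upwards [hV.eventually hf] with p hV' hp
  rw [coord_covAlong hA hL (mdifferentiableAt_of_smooth hf p) hp (hV'.diffAlongAt (by simp)),
    coord_mfderiv (mdifferentiableAt_of_smooth hf p) hp]
  rfl

end Regularity

section AlongRules

variable {E : Type*} [NormedAddCommGroup E] [NormedSpace ℝ E] [FiniteDimensional ℝ E]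
  {M : Type*} [TopologicalSpace M] [ChartedSpace E M] [IsManifold 𝓘(ℝ, E) ∞ M]
  {E' : Type*} [NormedAddCommGroup E'] [NormedSpace ℝ E'] [FiniteDimensional ℝ E']
  {M' : Type*} [TopologicalSpace M'] [ChartedSpace E' M'] [IsManifold 𝓘(ℝ, E') ∞ M']
  {J : Π p : M', TangentSpace 𝓘(ℝ, E') p →L[ℝ] TangentSpace 𝓘(ℝ, E') p}
  {g : Π p : M', TangentSpace 𝓘(ℝ, E') p →L[ℝ] TangentSpace 𝓘(ℝ, E') p →L[ℝ] ℝ}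
  {nabla : CovariantDerivative 𝓘(ℝ, E') E' (TangentSpace 𝓘(ℝ, E') : M' → Type _)}
  {f : M → M'} {V W : Π p : M, TangentSpace 𝓘(ℝ, E') (f p)} {q : M}

theorem covAlong_congr (h : ∀ᶠ p in 𝓝 q, W p = V p) :
    covAlong (I := 𝓘(ℝ, E)) nabla f W q = covAlong nabla f V q := by
  have h1 : (fun p => (trivializationAt E' (TangentSpace 𝓘(ℝ, E') : M' → Type _) (f q)
        ⟨f p, W p⟩).2) =ᶠ[𝓝 q] fun p =>
      (trivializationAt E' (TangentSpace 𝓘(ℝ, E') : M' → Type _) (f q) ⟨f p, V p⟩).2 :=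
    h.mono fun p hp => by simp only [hp]
  unfold covAlong
  rw [mvfderiv_eq_of_eventuallyEq h1, h.self_of_nhds]

theorem covAlong_add (hA : IsAlmostComplexNorden J g)
    (hL : IsLeviCivita (fun p x y => g p x y) nabla) (hf : ContMDiff 𝓘(ℝ, E) 𝓘(ℝ, E') ∞ f)
    (hV : ContAlongAt E (1 : ℕ) f V q) (hW : ContAlongAt E (1 : ℕ) f W q)
    (x : TangentSpace 𝓘(ℝ, E) q) :
    covAlong nabla f (fun p => V p + W p) q x = covAlong nabla f V q x + covAlong nabla f W q x := by
  have hq : f q ∈ (chartAt E' (f q)).source := mem_chart_source E' (f q)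
  have hd := mdifferentiableAt_of_smooth hf q
  have hV₁ := (hV.diffAlongAt one_ne_zero).mdifferentiableAt_coord hf hq
  have hW₁ := (hW.diffAlongAt one_ne_zero).mdifferentiableAt_coord hf hq
  apply coord_injective hq
  rw [map_add, coord_covAlong hA hL hd hq (hV.diffAlongAt one_ne_zero),
    coord_covAlong hA hL hd hq (hW.diffAlongAt one_ne_zero),
    coord_covAlong hA hL hd hq ((hV.add hf hW).diffAlongAt one_ne_zero)]
  have h1 : (fun p => coord (f q) (f p) (V p + W p))
      = (fun p => coord (f q) (f p) (V p)) + fun p => coord (f q) (f p) (W p) := by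
    ext p; simp
  rw [h1, mvfderiv_add hV₁ hW₁, map_add, map_add]
  simp only [add_apply]
  abel

theorem covAlong_smul (hA : IsAlmostComplexNorden J g)
    (hL : IsLeviCivita (fun p x y => g p x y) nabla) (hf : ContMDiff 𝓘(ℝ, E) 𝓘(ℝ, E') ∞ f)
    {h : M → ℝ} (hh : ContMDiffAt 𝓘(ℝ, E) 𝓘(ℝ, ℝ) (1 : ℕ) h q)
    (hV : ContAlongAt E (1 : ℕ) f V q) (x : TangentSpace 𝓘(ℝ, E) q) :
    covAlong nabla f (fun p => h p • V p) q x
      = h q • covAlong nabla f V q x + mvfderiv 𝓘(ℝ, E) h q x • V q := by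
  have hq : f q ∈ (chartAt E' (f q)).source := mem_chart_source E' (f q)
  have hd := mdifferentiableAt_of_smooth hf q
  have hV₁ := (hV.diffAlongAt one_ne_zero).mdifferentiableAt_coord hf hq
  apply coord_injective hq
  rw [map_add, map_smul, map_smul, coord_covAlong hA hL hd hq (hV.diffAlongAt one_ne_zero),
    coord_covAlong hA hL hd hq ((hV.smul hf hh).diffAlongAt one_ne_zero)]
  have h1 : (fun p => coord (f q) (f p) (h p • V p))
      = h • fun p => coord (f q) (f p) (V p) := by
    ext p; simp
  rw [h1, mvfderiv_smul (hh.mdifferentiableAt (by simp)) hV₁]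
  simp only [add_apply, map_smul, smul_add, ContinuousLinearMap.smulRight_apply, smul_apply]
  abel

theorem covAlong_neg (hA : IsAlmostComplexNorden J g)
    (hL : IsLeviCivita (fun p x y => g p x y) nabla) (hf : ContMDiff 𝓘(ℝ, E) 𝓘(ℝ, E') ∞ f)
    (hV : ContAlongAt E (1 : ℕ) f V q) (x : TangentSpace 𝓘(ℝ, E) q) :
    covAlong nabla f (fun p => -V p) q x = -covAlong nabla f V q x := by
  have h := covAlong_smul hA hL hf (h := fun _ => -1) contMDiffAt_const hV x
  rw [mvfderiv_const] at h
  simpa using h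

theorem covAlong_sub (hA : IsAlmostComplexNorden J g)
    (hL : IsLeviCivita (fun p x y => g p x y) nabla) (hf : ContMDiff 𝓘(ℝ, E) 𝓘(ℝ, E') ∞ f)
    (hV : ContAlongAt E (1 : ℕ) f V q) (hW : ContAlongAt E (1 : ℕ) f W q)
    (x : TangentSpace 𝓘(ℝ, E) q) :
    covAlong nabla f (fun p => V p - W p) q x = covAlong nabla f V q x - covAlong nabla f W q x := by
  simp only [sub_eq_add_neg]
  rw [covAlong_add hA hL hf hV (hW.neg hf), covAlong_neg hA hL hf hW]

/-- The metric is parallel along `f`. -/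
theorem mvfderiv_metric_along (hA : IsAlmostComplexNorden J g)
    (hL : IsLeviCivita (fun p x y => g p x y) nabla) (hf : ContMDiff 𝓘(ℝ, E) 𝓘(ℝ, E') ∞ f)
    (hV : ContAlongAt E (1 : ℕ) f V q) (hW : ContAlongAt E (1 : ℕ) f W q)
    (x : TangentSpace 𝓘(ℝ, E) q) :
    mvfderiv 𝓘(ℝ, E) (fun p => g (f p) (V p) (W p)) q x
      = g (f q) (covAlong nabla f V q x) (W q) + g (f q) (V q) (covAlong nabla f W q x) := by
  have hq : f q ∈ (chartAt E' (f q)).source := mem_chart_source E' (f q)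
  have hd := mdifferentiableAt_of_smooth hf q
  have hV₁ := (hV.diffAlongAt one_ne_zero).mdifferentiableAt_coord hf hq
  have hW₁ := (hW.diffAlongAt one_ne_zero).mdifferentiableAt_coord hf hq
  have hF := (contMDiffAt_chart_comp hf hq 1).mdifferentiableAt (by simp)
  have hm := differentiableAt_metricCoord hA hq
  have hm' := mdifferentiableAt_comp_of_differentiableAt
    (h := fun p => extChartAt 𝓘(ℝ, E') (f q) (f p)) hm hF
  have hev : (fun p => g (f p) (V p) (W p)) =ᶠ[𝓝 q] fun p =>
      metricCoord g (f q) (extChartAt 𝓘(ℝ, E') (f q) (f p)) (coord (f q) (f p) (V p))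
        (coord (f q) (f p) (W p)) := by
    filter_upwards [eventually_mem_chart_source hf hq] with p hp
    rw [metricCoord_coord hp]
  rw [mvfderiv_eq_of_eventuallyEq hev,
    mvfderiv_clm_apply (mdifferentiableAt_clm_apply hm' hV₁) hW₁, mvfderiv_clm_apply hm' hV₁,
    mvfderiv_fderiv_comp (h := fun p => extChartAt 𝓘(ℝ, E') (f q) (f p)) hm hF,
    ContinuousLinearMap.comp_apply, add_apply,
    fderiv_metricCoord hA hL hq, ← metricCoord_coord hq (covAlong nabla f V q x),
    ← metricCoord_coord hq (V q),
    coord_covAlong hA hL hd hq (hV.diffAlongAt one_ne_zero),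
    coord_covAlong hA hL hd hq (hW.diffAlongAt one_ne_zero), coord_mfderiv hd hq]
  simp only [map_add, add_apply]
  ring

/-- `J` is parallel along `f`. -/
theorem covAlong_structure (hK : IsKaehlerNorden J g nabla)
    (hf : ContMDiff 𝓘(ℝ, E) 𝓘(ℝ, E') ∞ f) (hV : ContAlongAt E (1 : ℕ) f V q)
    (x : TangentSpace 𝓘(ℝ, E) q) :
    covAlong nabla f (fun p => J (f p) (V p)) q x = J (f q) (covAlong nabla f V q x) := by
  have hA := hK.almost_complex
  have hL := hK.levi_civita
  have hq : f q ∈ (chartAt E' (f q)).source := mem_chart_source E' (f q)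
  have hd := mdifferentiableAt_of_smooth hf q
  have hV₁ := (hV.diffAlongAt one_ne_zero).mdifferentiableAt_coord hf hq
  have hF := (contMDiffAt_chart_comp hf hq 1).mdifferentiableAt (by simp)
  have hm := differentiableAt_endCoord hA hq
  have hm' := mdifferentiableAt_comp_of_differentiableAt
    (h := fun p => extChartAt 𝓘(ℝ, E') (f q) (f p)) hm hF
  have hev : (fun p => coord (f q) (f p) (J (f p) (V p))) =ᶠ[𝓝 q] fun p =>
      endCoord J (f q) (extChartAt 𝓘(ℝ, E') (f q) (f p)) (coord (f q) (f p) (V p)) := by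
    filter_upwards [eventually_mem_chart_source hf hq] with p hp
    rw [endCoord_coord hp]
  apply coord_injective hq
  rw [coord_covAlong hA hL hd hq ((hV.structure hA hf).diffAlongAt one_ne_zero),
    mvfderiv_eq_of_eventuallyEq hev, mvfderiv_clm_apply hm' hV₁,
    mvfderiv_fderiv_comp (h := fun p => extChartAt 𝓘(ℝ, E') (f q) (f p)) hm hF,
    ContinuousLinearMap.comp_apply, ← endCoord_coord hq,
    ← endCoord_coord hq, coord_covAlong hA hL hd hq (hV.diffAlongAt one_ne_zero),
    coord_mfderiv hd hq, map_add, ← fderiv_endCoord hK hq]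
  abel

/-- The covariant derivative along a map is torsion-free. -/
theorem covAlong_mfderiv_comm (hA : IsAlmostComplexNorden J g)
    (hL : IsLeviCivita (fun p x y => g p x y) nabla) (hf : ContMDiff 𝓘(ℝ, E) 𝓘(ℝ, E') ∞ f)
    {X Y : Π p : M, TangentSpace 𝓘(ℝ, E) p} (hX : ContAlongAt E (1 : ℕ) id X q)
    (hY : ContAlongAt E (1 : ℕ) id Y q) :
    covAlong nabla f (fun p => mfderiv 𝓘(ℝ, E) 𝓘(ℝ, E') f p (Y p)) q (X q)
        - covAlong nabla f (fun p => mfderiv 𝓘(ℝ, E) 𝓘(ℝ, E') f p (X p)) q (Y q)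
      = mfderiv 𝓘(ℝ, E) 𝓘(ℝ, E') f q (VectorField.mlieBracket 𝓘(ℝ, E) X Y q) := by
  have hq : f q ∈ (chartAt E' (f q)).source := mem_chart_source E' (f q)
  have hd := mdifferentiableAt_of_smooth hf q
  have hev (Z : Π p : M, TangentSpace 𝓘(ℝ, E) p) :
      (fun p => coord (f q) (f p) (mfderiv 𝓘(ℝ, E) 𝓘(ℝ, E') f p (Z p))) =ᶠ[𝓝 q] fun p =>
      mvfderiv 𝓘(ℝ, E) (fun p => extChartAt 𝓘(ℝ, E') (f q) (f p)) p (Z p) := by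
    filter_upwards [eventually_mem_chart_source hf hq] with p hp
    rw [coord_mfderiv (mdifferentiableAt_of_smooth hf p) hp]
  apply coord_injective hq
  rw [map_sub, coord_covAlong hA hL hd hq ((hY.mfderiv_apply hf).diffAlongAt one_ne_zero),
    coord_covAlong hA hL hd hq ((hX.mfderiv_apply hf).diffAlongAt one_ne_zero),
    mvfderiv_eq_of_eventuallyEq (hev X), mvfderiv_eq_of_eventuallyEq (hev Y),
    coord_mfderiv hd hq (VectorField.mlieBracket 𝓘(ℝ, E) X Y q),
    mvfderiv_mlieBracket (contMDiffAt_chart_comp hf hq 2) (hX.diffAlongAt one_ne_zero)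
      (hY.diffAlongAt one_ne_zero),
    christoffel_metricCoord_symm hA hL hq (coord (f q) (f q) (mfderiv 𝓘(ℝ, E) 𝓘(ℝ, E') f q (X q)))]
  abel

end AlongRules

/-! ### The Riemann tensor and its symmetries -/

section RiemannTensor

variable {E : Type*} [NormedAddCommGroup E] [NormedSpace ℝ E] [FiniteDimensional ℝ E]
  {M : Type*} [TopologicalSpace M] [ChartedSpace E M] [IsManifold 𝓘(ℝ, E) ∞ M]
  {E' : Type*} [NormedAddCommGroup E'] [NormedSpace ℝ E'] [FiniteDimensional ℝ E']
  {M' : Type*} [TopologicalSpace M'] [ChartedSpace E' M'] [IsManifold 𝓘(ℝ, E') ∞ M']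
  {J : Π p : M', TangentSpace 𝓘(ℝ, E') p →L[ℝ] TangentSpace 𝓘(ℝ, E') p}
  {g : Π p : M', TangentSpace 𝓘(ℝ, E') p →L[ℝ] TangentSpace 𝓘(ℝ, E') p →L[ℝ] ℝ}
  {nabla : CovariantDerivative 𝓘(ℝ, E') E' (TangentSpace 𝓘(ℝ, E') : M' → Type _)}
  {f : M → M'} {V W : Π p : M, TangentSpace 𝓘(ℝ, E') (f p)} {q : M}

/-- The curvature of a connection with Christoffel symbols `Γ`, in coordinates. -/
def riemannCoord (Γ : E' → E' →L[ℝ] E' →L[ℝ] E') (x w₁ w₂ v : E') : E' :=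
  fderiv ℝ Γ x w₁ w₂ v - fderiv ℝ Γ x w₂ w₁ v + Γ x w₁ (Γ x w₂ v) - Γ x w₂ (Γ x w₁ v)

/-- The Riemann tensor of type `(1,3)` of `g`, computed in the chart at the given point. -/
def riemann (g : Π p : M', TangentSpace 𝓘(ℝ, E') p →L[ℝ] TangentSpace 𝓘(ℝ, E') p →L[ℝ] ℝ)
    (y : M') (w₁ w₂ v : TangentSpace 𝓘(ℝ, E') y) : TangentSpace 𝓘(ℝ, E') y :=
  coordSymm y y (riemannCoord (christoffel (metricCoord g y)) (extChartAt 𝓘(ℝ, E') y y)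
    (coord y y w₁) (coord y y w₂) (coord y y v))

theorem coord_riemann (y : M') (w₁ w₂ v : TangentSpace 𝓘(ℝ, E') y) :
    coord y y (riemann g y w₁ w₂ v)
      = riemannCoord (christoffel (metricCoord g y)) (extChartAt 𝓘(ℝ, E') y y)
          (coord y y w₁) (coord y y w₂) (coord y y v) :=
  coord_coordSymm (mem_chart_source E' y) _

/-- The components of `∇_X ∇_Y V` in a chart of the target. -/
theorem coord_covAlong_covAlong (hA : IsAlmostComplexNorden J g)
    (hL : IsLeviCivita (fun p x y => g p x y) nabla) (hf : ContMDiff 𝓘(ℝ, E) 𝓘(ℝ, E') ∞ f)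
    {X Y : Π p : M, TangentSpace 𝓘(ℝ, E) p} (hY : ContAlongAt E (1 : ℕ) id Y q)
    (hV : ContAlongAt E (2 : ℕ) f V q) :
    coord (f q) (f q) (covAlong nabla f (fun p => covAlong nabla f V p (Y p)) q (X q))
      = mvfderiv 𝓘(ℝ, E) (fun p => mvfderiv 𝓘(ℝ, E) (fun p => coord (f q) (f p) (V p)) p (Y p))
            q (X q)
        + christoffel (metricCoord g (f q)) (extChartAt 𝓘(ℝ, E') (f q) (f q))
            (mvfderiv 𝓘(ℝ, E) (fun p => mvfderiv 𝓘(ℝ, E)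
              (fun p => extChartAt 𝓘(ℝ, E') (f q) (f p)) p (Y p)) q (X q)) (coord (f q) (f q) (V q))
        + christoffel (metricCoord g (f q)) (extChartAt 𝓘(ℝ, E') (f q) (f q))
            (coord (f q) (f q) (mfderiv 𝓘(ℝ, E) 𝓘(ℝ, E') f q (Y q)))
            (mvfderiv 𝓘(ℝ, E) (fun p => coord (f q) (f p) (V p)) q (X q))
        + christoffel (metricCoord g (f q)) (extChartAt 𝓘(ℝ, E') (f q) (f q))
            (coord (f q) (f q) (mfderiv 𝓘(ℝ, E) 𝓘(ℝ, E') f q (X q)))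
            (mvfderiv 𝓘(ℝ, E) (fun p => coord (f q) (f p) (V p)) q (Y q))
        + fderiv ℝ (christoffel (metricCoord g (f q))) (extChartAt 𝓘(ℝ, E') (f q) (f q))
            (coord (f q) (f q) (mfderiv 𝓘(ℝ, E) 𝓘(ℝ, E') f q (X q)))
            (coord (f q) (f q) (mfderiv 𝓘(ℝ, E) 𝓘(ℝ, E') f q (Y q))) (coord (f q) (f q) (V q))
        + christoffel (metricCoord g (f q)) (extChartAt 𝓘(ℝ, E') (f q) (f q))
            (coord (f q) (f q) (mfderiv 𝓘(ℝ, E) 𝓘(ℝ, E') f q (X q)))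
            (christoffel (metricCoord g (f q)) (extChartAt 𝓘(ℝ, E') (f q) (f q))
              (coord (f q) (f q) (mfderiv 𝓘(ℝ, E) 𝓘(ℝ, E') f q (Y q)))
              (coord (f q) (f q) (V q))) := by
  have hq : f q ∈ (chartAt E' (f q)).source := mem_chart_source E' (f q)
  have hd := mdifferentiableAt_of_smooth hf q
  have hV₁ := (hV.diffAlongAt two_ne_zero).mdifferentiableAt_coord hf hq
  have hV₂ := mdifferentiableAt_mvfderiv_apply (hV.contMDiffAt_coord hf hq)
    (hY.diffAlongAt one_ne_zero)
  have hF := (contMDiffAt_chart_comp hf hq 1).mdifferentiableAt (by simp)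
  have hF₂ := mdifferentiableAt_mvfderiv_apply (contMDiffAt_chart_comp hf hq 2)
    (hY.diffAlongAt one_ne_zero)
  have hΓ := (contDiffAt_christoffel_metricCoord hA hq 1).differentiableAt (by simp)
  have hΓ' := mdifferentiableAt_comp_of_differentiableAt
    (h := fun p => extChartAt 𝓘(ℝ, E') (f q) (f p)) hΓ hF
  have hev : (fun p => coord (f q) (f p) (covAlong nabla f V p (Y p))) =ᶠ[𝓝 q]
      (fun p => mvfderiv 𝓘(ℝ, E) (fun p => coord (f q) (f p) (V p)) p (Y p))
        + fun p => christoffel (metricCoord g (f q)) (extChartAt 𝓘(ℝ, E') (f q) (f p))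
          (mvfderiv 𝓘(ℝ, E) (fun p => extChartAt 𝓘(ℝ, E') (f q) (f p)) p (Y p))
          (coord (f q) (f p) (V p)) := by
    filter_upwards [hV.eventually hf, eventually_mem_chart_source hf hq] with p hp hs
    rw [coord_covAlong hA hL (mdifferentiableAt_of_smooth hf p) hs (hp.diffAlongAt two_ne_zero),
      coord_mfderiv (mdifferentiableAt_of_smooth hf p) hs]
    rfl
  rw [coord_covAlong hA hL hd hq ((hV.covAlong hA hL hf hY).diffAlongAt one_ne_zero),
    mvfderiv_eq_of_eventuallyEq hev, mvfderiv_add hV₂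
      (mdifferentiableAt_clm_apply (mdifferentiableAt_clm_apply hΓ' hF₂) hV₁), add_apply,
    mvfderiv_clm_apply (mdifferentiableAt_clm_apply hΓ' hF₂) hV₁, mvfderiv_clm_apply hΓ' hF₂,
    mvfderiv_fderiv_comp (h := fun p => extChartAt 𝓘(ℝ, E') (f q) (f p)) hΓ hF,
    ContinuousLinearMap.comp_apply, ← coord_mfderiv hd hq, ← coord_mfderiv hd hq,
    coord_covAlong hA hL hd hq (hV.diffAlongAt two_ne_zero)]
  simp only [map_add, add_apply]
  abel

/-- The curvature of the covariant derivative along `f` is the pull-back of the Riemann tensor. -/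
theorem covAlong_curvature (hA : IsAlmostComplexNorden J g)
    (hL : IsLeviCivita (fun p x y => g p x y) nabla) (hf : ContMDiff 𝓘(ℝ, E) 𝓘(ℝ, E') ∞ f)
    {X Y : Π p : M, TangentSpace 𝓘(ℝ, E) p} (hX : ContAlongAt E (1 : ℕ) id X q)
    (hY : ContAlongAt E (1 : ℕ) id Y q) (hV : ContAlongAt E (2 : ℕ) f V q) :
    covAlong nabla f (fun p => covAlong nabla f V p (Y p)) q (X q)
        - covAlong nabla f (fun p => covAlong nabla f V p (X p)) q (Y q)
        - covAlong nabla f V q (VectorField.mlieBracket 𝓘(ℝ, E) X Y q)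
      = riemann g (f q) (mfderiv 𝓘(ℝ, E) 𝓘(ℝ, E') f q (X q))
          (mfderiv 𝓘(ℝ, E) 𝓘(ℝ, E') f q (Y q)) (V q) := by
  have hq : f q ∈ (chartAt E' (f q)).source := mem_chart_source E' (f q)
  have hd := mdifferentiableAt_of_smooth hf q
  apply coord_injective hq
  rw [map_sub, map_sub, coord_covAlong_covAlong hA hL hf hY hV,
    coord_covAlong_covAlong hA hL hf hX hV, coord_riemann,
    coord_covAlong hA hL hd hq (hV.diffAlongAt two_ne_zero),
    mvfderiv_mlieBracket (hV.contMDiffAt_coord hf hq) (hX.diffAlongAt one_ne_zero)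
      (hY.diffAlongAt one_ne_zero), coord_mfderiv hd hq (VectorField.mlieBracket 𝓘(ℝ, E) X Y q),
    mvfderiv_mlieBracket (contMDiffAt_chart_comp hf hq 2) (hX.diffAlongAt one_ne_zero)
      (hY.diffAlongAt one_ne_zero)]
  unfold riemannCoord
  simp only [map_sub, sub_apply]
  abel

theorem covAlong_id (hA : IsAlmostComplexNorden J g)
    (hL : IsLeviCivita (fun p x y => g p x y) nabla) {s : Π z : M', TangentSpace 𝓘(ℝ, E') z}
    {y : M'} (hs : DiffAlongAt E' id s y) : covAlong nabla id s y = nabla s y := by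
  have hy : y ∈ (chartAt E' y).source := mem_chart_source E' y
  ext x
  apply coord_injective hy
  have h := coord_covAlong (f := id) (y₀ := y) hA hL mdifferentiableAt_id hy hs x
  rw [mfderiv_id] at h
  rw [coord_nabla hA hL hy hs]
  exact h

/-- A vector field on a neighbourhood of `y` with constant coordinates and value `v` at `y`. -/
def frameField (y : M') (v : TangentSpace 𝓘(ℝ, E') y) (z : M') : TangentSpace 𝓘(ℝ, E') z :=
  coordSymm y z (coord y y v)

theorem frameField_self (y : M') (v : TangentSpace 𝓘(ℝ, E') y) : frameField y v y = v :=
  coordSymm_coord (mem_chart_source E' y) v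

theorem contAlongAt_frameField (y : M') (v : TangentSpace 𝓘(ℝ, E') y) (k : ℕ) :
    ContAlongAt E' k id (frameField y v) y :=
  contAlongAt_coordSymm (mem_chart_source E' y) _ k

theorem contAlongAt_extend (y : M') (v : TangentSpace 𝓘(ℝ, E') y) (k : ℕ) :
    ContAlongAt E' k id (FiberBundle.extend E' v : Π z : M', TangentSpace 𝓘(ℝ, E') z) y := by
  refine ContAlongAt.congr (f := id) (contAlongAt_frameField y v k) ?_
  filter_upwards [(chartAt E' y).open_source.mem_nhds (mem_chart_source E' y)] with z hz
  exact extend_eq_coordSymm hz v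

theorem extend_self (y : M') (v : TangentSpace 𝓘(ℝ, E') y) :
    (FiberBundle.extend E' v : Π z : M', TangentSpace 𝓘(ℝ, E') z) y = v :=
  (extend_eq_coordSymm (mem_chart_source E' y) v).trans (frameField_self y v)

/-- The curvature of `∇` on vector fields is the Riemann tensor. -/
theorem curvatureField_eq_riemann (hA : IsAlmostComplexNorden J g)
    (hL : IsLeviCivita (fun p x y => g p x y) nabla) {X Y Z : Π z : M', TangentSpace 𝓘(ℝ, E') z}
    {y : M'} (hX : ContAlongAt E' (1 : ℕ) id X y) (hY : ContAlongAt E' (1 : ℕ) id Y y)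
    (hZ : ContAlongAt E' (2 : ℕ) id Z y) :
    curvatureField (fun Y p x => nabla Y p x) X Y Z y = riemann g y (X y) (Y y) (Z y) := by
  have hid : ContMDiff 𝓘(ℝ, E') 𝓘(ℝ, E') ∞ (id : M' → M') := contMDiff_id
  have h := covAlong_curvature (f := id) hA hL hid hX hY hZ
  rw [mfderiv_id] at h
  have hev (X : Π z : M', TangentSpace 𝓘(ℝ, E') z) :
      ∀ᶠ z in 𝓝 y, nabla Z z (X z) = covAlong nabla id Z z (X z) := by
    filter_upwards [ContAlongAt.eventually (f := id) hid hZ] with z hz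
    rw [covAlong_id hA hL (hz.diffAlongAt two_ne_zero)]
  have hc (X : Π z : M', TangentSpace 𝓘(ℝ, E') z) (hX : ContAlongAt E' (1 : ℕ) id X y) :
      nabla (fun z => nabla Z z (X z)) y
        = covAlong nabla id (fun z => covAlong nabla id Z z (X z)) y := by
    have h1 := (ContAlongAt.covAlong (f := id) hA hL hid hZ hX).diffAlongAt one_ne_zero
    rw [covAlong_id hA hL h1]
    exact nabla_congr nabla h1 (hev X)
  unfold curvatureField
  beta_reduce
  rw [hc X hX, hc Y hY, ← covAlong_id hA hL (hZ.diffAlongAt two_ne_zero)]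
  exact h

theorem curvatureTensor_eq (hA : IsAlmostComplexNorden J g)
    (hL : IsLeviCivita (fun p x y => g p x y) nabla) (p : M')
    (x y z u : TangentSpace 𝓘(ℝ, E') p) :
    curvatureTensor (fun p a b => g p a b) (fun Y p x => nabla Y p x) p x y z u
      = g p (riemann g p x y z) u := by
  unfold curvatureTensor
  rw [curvatureField_eq_riemann hA hL (contAlongAt_extend p x 1) (contAlongAt_extend p y 1)
    (contAlongAt_extend p z 2), extend_self, extend_self, extend_self]

theorem riemann_skew_left (y : M') (w₁ w₂ v : TangentSpace 𝓘(ℝ, E') y) :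
    riemann g y w₁ w₂ v = -riemann g y w₂ w₁ v := by
  unfold riemann riemannCoord
  rw [← map_neg]
  congr 1
  abel

theorem riemann_add_left (y : M') (w w' w₂ v : TangentSpace 𝓘(ℝ, E') y) :
    riemann g y (w + w') w₂ v = riemann g y w w₂ v + riemann g y w' w₂ v := by
  unfold riemann riemannCoord
  rw [← map_add]
  congr 1
  simp only [map_add, add_apply]
  abel

theorem riemann_smul_left (y : M') (c : ℝ) (w w₂ v : TangentSpace 𝓘(ℝ, E') y) :
    riemann g y (c • w) w₂ v = c • riemann g y w w₂ v := by
  unfold riemann riemannCoord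
  rw [← map_smul]
  congr 1
  simp only [map_smul, smul_apply, smul_sub, smul_add]

theorem riemann_bianchi (hA : IsAlmostComplexNorden J g)
    (hL : IsLeviCivita (fun p x y => g p x y) nabla) (y : M')
    (u v w : TangentSpace 𝓘(ℝ, E') y) :
    riemann g y u v w + riemann g y v w u + riemann g y w u v = 0 := by
  have hy : y ∈ (chartAt E' y).source := mem_chart_source E' y
  have hΓ := (contDiffAt_christoffel_metricCoord hA hy 1).differentiableAt (by simp)
  have hsymm (a b : E') : ∀ᶠ x in 𝓝 (extChartAt 𝓘(ℝ, E') y y),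
      christoffel (metricCoord g y) x a b = christoffel (metricCoord g y) x b a := by
    filter_upwards [target_mem_nhds_chart hy] with x hx
    have h := christoffel_metricCoord_symm hA hL (y₀ := y)
      (y := (extChartAt 𝓘(ℝ, E') y).symm x)
      (by simpa [extChartAt_source] using (extChartAt 𝓘(ℝ, E') y).map_target hx) a b
    rwa [(extChartAt 𝓘(ℝ, E') y).right_inv hx] at h
  have hd (c a b : E') :
      fderiv ℝ (christoffel (metricCoord g y)) (extChartAt 𝓘(ℝ, E') y y) c a b
        = fderiv ℝ (christoffel (metricCoord g y)) (extChartAt 𝓘(ℝ, E') y y) c b a := by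
    have h := congrArg (fun L => L c) (Filter.EventuallyEq.fderiv_eq (𝕜 := ℝ) (hsymm a b))
    rw [fderiv_clm_apply (hΓ.clm_apply (differentiableAt_const a)) (differentiableAt_const b),
      fderiv_clm_apply (hΓ.clm_apply (differentiableAt_const b)) (differentiableAt_const a),
      fderiv_clm_apply hΓ (differentiableAt_const a),
      fderiv_clm_apply hΓ (differentiableAt_const b)] at h
    simpa using h
  have hs (a b : E') := (hsymm a b).self_of_nhds
  unfold riemann riemannCoord
  rw [← map_add, ← map_add]
  set a := coord y y u
  set b := coord y y v
  set c := coord y y w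
  rw [hd a b c, hd b c a, hd c a b, hs b c, hs c a, hs a b]
  refine (congrArg _ ?_).trans (map_zero (coordSymm y y))
  abel

/-- `R(u, v)` commutes with `J`, because `∇ J = 0`. -/
theorem riemann_structure (hK : IsKaehlerNorden J g nabla) (y : M')
    (u v w : TangentSpace 𝓘(ℝ, E') y) :
    riemann g y u v (J y w) = J y (riemann g y u v w) := by
  have hA := hK.almost_complex
  have hL := hK.levi_civita
  have hid : ContMDiff 𝓘(ℝ, E') 𝓘(ℝ, E') ∞ (id : M' → M') := contMDiff_id
  have hU := contAlongAt_frameField y u 1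
  have hV := contAlongAt_frameField y v 1
  have hW := contAlongAt_frameField y w 2
  have hJW : ContAlongAt E' (2 : ℕ) id (fun z => J z (frameField y w z)) y :=
    ContAlongAt.structure (f := id) hA hid hW
  have h1 := covAlong_curvature (f := id) hA hL hid hU hV hW
  have h2 := covAlong_curvature (f := id) hA hL hid hU hV hJW
  have hc (X : Π z : M', TangentSpace 𝓘(ℝ, E') z) (hX : ContAlongAt E' (1 : ℕ) id X y) :
      covAlong nabla id (fun z => covAlong nabla id (fun z => J z (frameField y w z)) z (X z)) y
        = (J y).comp (covAlong (I := 𝓘(ℝ, E')) nabla id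
            (fun z => covAlong nabla id (frameField y w) z (X z)) y) := by
    have hev : ∀ᶠ z in 𝓝 y, covAlong nabla id (fun z => J z (frameField y w z)) z (X z)
        = J z (covAlong nabla id (frameField y w) z (X z)) := by
      filter_upwards [ContAlongAt.eventually (f := id) hid hW] with z hz
      exact covAlong_structure (f := id) hK hid (hz.of_le one_le_two) (X z)
    ext x
    rw [covAlong_congr (f := id) hev]
    exact covAlong_structure (f := id) hK hid (ContAlongAt.covAlong (f := id) hA hL hid hW hX) x
  have h3 := covAlong_structure (f := id) hK hid (hW.of_le one_le_two)
    (VectorField.mlieBracket 𝓘(ℝ, E') (frameField y u) (frameField y v) y)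
  rw [hc _ hU, hc _ hV] at h2
  simp only [mfderiv_id, frameField_self] at h1 h2
  refine (h2.symm.trans ?_).trans (congrArg (J y) h1)
  rw [map_sub, map_sub]
  exact congrArg₂ _ rfl h3

theorem mvfderiv_mvfderiv_metric_along (hA : IsAlmostComplexNorden J g)
    (hL : IsLeviCivita (fun p x y => g p x y) nabla) (hf : ContMDiff 𝓘(ℝ, E) 𝓘(ℝ, E') ∞ f)
    {X Y : Π p : M, TangentSpace 𝓘(ℝ, E) p} (hY : ContAlongAt E (1 : ℕ) id Y q)
    (hV : ContAlongAt E (2 : ℕ) f V q) (hW : ContAlongAt E (2 : ℕ) f W q) :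
    mvfderiv 𝓘(ℝ, E) (fun p => mvfderiv 𝓘(ℝ, E) (fun p => g (f p) (V p) (W p)) p (Y p)) q (X q)
      = (g (f q) (covAlong nabla f (fun p => covAlong nabla f V p (Y p)) q (X q)) (W q)
          + g (f q) (covAlong nabla f V q (Y q)) (covAlong nabla f W q (X q)))
        + (g (f q) (covAlong nabla f V q (X q)) (covAlong nabla f W q (Y q))
          + g (f q) (V q) (covAlong nabla f (fun p => covAlong nabla f W p (Y p)) q (X q))) := by
  have hV₁ := hV.of_le one_le_two
  have hW₁ := hW.of_le one_le_two
  have hDV : ContAlongAt E (1 : ℕ) f (fun p => covAlong nabla f V p (Y p)) q :=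
    hV.covAlong hA hL hf hY
  have hDW : ContAlongAt E (1 : ℕ) f (fun p => covAlong nabla f W p (Y p)) q :=
    hW.covAlong hA hL hf hY
  have hev : (fun p => mvfderiv 𝓘(ℝ, E) (fun p => g (f p) (V p) (W p)) p (Y p)) =ᶠ[𝓝 q]
      (fun p => g (f p) (covAlong nabla f V p (Y p)) (W p))
        + fun p => g (f p) (V p) (covAlong nabla f W p (Y p)) := by
    filter_upwards [hV₁.eventually hf, hW₁.eventually hf] with p hp hp'
    exact mvfderiv_metric_along hA hL hf hp hp' (Y p)
  rw [mvfderiv_eq_of_eventuallyEq hev, mvfderiv_add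
    ((hDV.metric hA hf hW₁).mdifferentiableAt (by simp))
    ((hV₁.metric hA hf hDW).mdifferentiableAt (by simp)), add_apply,
    mvfderiv_metric_along hA hL hf hDV hW₁, mvfderiv_metric_along hA hL hf hV₁ hDW]

/-- Metricity of the curvature: the second derivatives of `g(V, W)` commute up to a bracket. -/
theorem riemann_skew_along (hA : IsAlmostComplexNorden J g)
    (hL : IsLeviCivita (fun p x y => g p x y) nabla) (hf : ContMDiff 𝓘(ℝ, E) 𝓘(ℝ, E') ∞ f)
    {X Y : Π p : M, TangentSpace 𝓘(ℝ, E) p} (hX : ContAlongAt E (1 : ℕ) id X q)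
    (hY : ContAlongAt E (1 : ℕ) id Y q)
    (hV : ContAlongAt E (2 : ℕ) f V q) (hW : ContAlongAt E (2 : ℕ) f W q) :
    g (f q) (riemann g (f q) (mfderiv 𝓘(ℝ, E) 𝓘(ℝ, E') f q (X q))
        (mfderiv 𝓘(ℝ, E) 𝓘(ℝ, E') f q (Y q)) (V q)) (W q)
      = -g (f q) (V q) (riemann g (f q) (mfderiv 𝓘(ℝ, E) 𝓘(ℝ, E') f q (X q))
        (mfderiv 𝓘(ℝ, E) 𝓘(ℝ, E') f q (Y q)) (W q)) := by
  have hbr := mvfderiv_mlieBracket (hV.metric hA hf hW) (hX.diffAlongAt one_ne_zero)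
    (hY.diffAlongAt one_ne_zero)
  rw [mvfderiv_mvfderiv_metric_along hA hL hf hY hV hW,
    mvfderiv_mvfderiv_metric_along hA hL hf hX hV hW,
    mvfderiv_metric_along hA hL hf (hV.of_le one_le_two) (hW.of_le one_le_two)] at hbr
  rw [← covAlong_curvature hA hL hf hX hY hV, ← covAlong_curvature hA hL hf hX hY hW]
  simp only [map_sub, sub_apply]
  linarith

theorem riemann_skew_right (hA : IsAlmostComplexNorden J g)
    (hL : IsLeviCivita (fun p x y => g p x y) nabla) (y : M')
    (a b u v : TangentSpace 𝓘(ℝ, E') y) :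
    g y (riemann g y a b u) v = -g y (riemann g y a b v) u := by
  have h := riemann_skew_along (f := id) hA hL contMDiff_id (contAlongAt_frameField y a 1)
    (contAlongAt_frameField y b 1) (contAlongAt_frameField y u 2) (contAlongAt_frameField y v 2)
  simp only [mfderiv_id, frameField_self] at h
  exact h.trans (congrArg _ (hA.symm y _ _))

end RiemannTensor

/-! ### Algebra of curvature tensors that commute with a complex structure -/

section CurvatureAlgebra

variable {T : Type*} [AddCommGroup T] [Module ℝ T]

/-- `R` has the algebraic symmetries of the Riemann tensor of a Levi-Civita connection. Linearity
in the first argument gives linearity in the others. -/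
structure IsCurvatureLike (R : T → T → T → T → ℝ) : Prop where
  add_left : ∀ x x' y z u, R (x + x') y z u = R x y z u + R x' y z u
  smul_left : ∀ (c : ℝ) x y z u, R (c • x) y z u = c * R x y z u
  skew_left : ∀ x y z u, R x y z u = -R y x z u
  skew_right : ∀ x y z u, R x y z u = -R x y u z
  bianchi : ∀ x y z u, R x y z u + R y z x u + R z x y u = 0

namespace IsCurvatureLike

variable {R : T → T → T → T → ℝ}

theorem pair_symm (hR : IsCurvatureLike R) (x y z u : T) : R x y z u = R z u x y := by
  linarith [hR.bianchi x y z u, hR.bianchi y z u x, hR.bianchi z u x y, hR.bianchi u x y z,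
    hR.skew_right x y z u, hR.skew_right y z x u, hR.skew_right z x y u, hR.skew_right y z u x,
    hR.skew_right z u y x, hR.skew_right u y z x, hR.skew_right z u x y, hR.skew_right u x z y,
    hR.skew_right x z u y, hR.skew_right u x y z, hR.skew_right x y u z, hR.skew_right y u x z,
    hR.skew_left z x y u, hR.skew_left u y z x, hR.skew_left x z u y, hR.skew_left y u x z]

theorem add_second (hR : IsCurvatureLike R) (x y y' z u : T) :
    R x (y + y') z u = R x y z u + R x y' z u := by
  rw [hR.skew_left, hR.add_left, hR.skew_left x y, hR.skew_left x y']; ring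

theorem add_third (hR : IsCurvatureLike R) (x y z z' u : T) :
    R x y (z + z') u = R x y z u + R x y z' u := by
  rw [hR.pair_symm, hR.add_left, hR.pair_symm x y z, hR.pair_symm x y z']

theorem add_fourth (hR : IsCurvatureLike R) (x y z u u' : T) :
    R x y z (u + u') = R x y z u + R x y z u' := by
  rw [hR.skew_right, hR.add_third, hR.skew_right x y z u, hR.skew_right x y z u']; ring

theorem smul_second (hR : IsCurvatureLike R) (c : ℝ) (x y z u : T) :
    R x (c • y) z u = c * R x y z u := by
  rw [hR.skew_left, hR.smul_left, hR.skew_left x y]; ring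

theorem self_left (hR : IsCurvatureLike R) (x z u : T) : R x x z u = 0 := by
  linarith [hR.skew_left x x z u]

/-- A curvature-like tensor is determined by its sectional values. -/
theorem eq_zero_of_sectional (hR : IsCurvatureLike R) {W : Submodule ℝ T}
    (h : ∀ x ∈ W, ∀ y ∈ W, R x y y x = 0) {x y z u : T} (hx : x ∈ W) (hy : y ∈ W) (hz : z ∈ W)
    (hu : u ∈ W) : R x y z u = 0 := by
  have h1 {x y u : T} (hx : x ∈ W) (hy : y ∈ W) (hu : u ∈ W) : R x y y u = 0 := by
    have h2 := h (x + u) (W.add_mem hx hu) y hy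
    rw [hR.add_left, hR.add_fourth, hR.add_fourth, h x hx y hy, h u hu y hy,
      hR.pair_symm u y y x, hR.skew_left y x, hR.skew_right x y u] at h2
    linarith
  have h2 {x y z u : T} (hx : x ∈ W) (hy : y ∈ W) (hz : z ∈ W) (hu : u ∈ W) :
      R x y z u = -R x z y u := by
    have h3 := h1 hx (W.add_mem hy hz) hu
    rw [hR.add_second, hR.add_third, hR.add_third, h1 hx hy hu, h1 hx hz hu] at h3
    linarith
  linarith [hR.bianchi x y z u, h2 hx hy hz hu, h2 hy hz hx hu, h2 hz hx hy hu,
    hR.skew_left x z y u, hR.skew_left y x z u, hR.skew_left z y x u]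

variable {J : T →ₗ[ℝ] T}

/-- If `J` commutes with the curvature operators, the curvature is pure: `J` can be moved between
any two arguments. -/
theorem pure_second (hR : IsCurvatureLike R) (hJ : ∀ x y z u, R x y (J z) u = R x y z (J u))
    (x y z u : T) : R x (J y) z u = R x y (J z) u := by
  have h1 (x y z u : T) : R (J x) y z u = R x (J y) z u := by
    rw [hR.pair_symm, hR.pair_symm x, hJ]
  -- `R(x, Jy, z, u) - R(x, y, Jz, u)` is skew in `x, y` and changes sign under cyclic permutations
  have h2 (x y z : T) : (R y (J z) x u - R y z (J x) u) + (R z (J x) y u - R z x (J y) u) = 0 := by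
    have h3 := hR.bianchi x y (J z) u
    have h4 := hR.bianchi x y z (J u)
    rw [h1 z x] at h3
    rw [← hJ, ← hJ, ← hJ] at h4
    linarith
  linarith [h2 x y z, h2 y z x, h2 z x y]

theorem pure_first (hR : IsCurvatureLike R) (hJ : ∀ x y z u, R x y (J z) u = R x y z (J u))
    (x y z u : T) : R (J x) y z u = R x y (J z) u := by
  rw [hR.skew_left, hR.pure_second hJ, ← hR.skew_left]

end IsCurvatureLike

variable {J : T →ₗ[ℝ] T} {g : T →ₗ[ℝ] T →ₗ[ℝ] ℝ}

/-- A curvature tensor that commutes with `J` and has constant totally real sectional curvatures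
is determined by them, provided that `T` has a positive definite real form. -/
theorem eq_of_constant_totallyReal {R : T → T → T → T → ℝ} {ν νt : ℝ} (hR : IsCurvatureLike R)
    (hJR : ∀ x y z u, R x y (J z) u = R x y z (J u))
    (hs : ∀ x y, g x y = g y x) (hJ : ∀ x, J (J x) = -x) (hg : ∀ x y, g (J x) (J y) = -g x y)
    (hc : ∀ x y, pi1 (fun a b => g a b) x y y x ≠ 0 →
      IsTotallyReal (fun a b => g a b) (fun a => J a) x y →
      R x y y x = ν * pi1 (fun a b => g a b) x y y x ∧
        R x y y (J x) = νt * pi1 (fun a b => g a b) x y y x)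
    {W : Submodule ℝ T} (hW : ∀ x ∈ W, ∀ y ∈ W, g (J x) y = 0)
    (hpos : ∀ x ∈ W, x ≠ 0 → 0 < g x x) (hsp : ∀ x, ∃ a ∈ W, ∃ b ∈ W, x = a + J b)
    (x y z u : T) :
    R x y z u = ν * (pi1 (fun a b => g a b) x y z u - pi2 (fun a b => g a b) (fun a => J a) x y z u)
      + νt * pi3 (fun a b => g a b) (fun a => J a) x y z u := by
  have hsJ (x y : T) : g x (J y) = g y (J x) := by
    have := hg x (J y)
    rw [hJ, map_neg, neg_inj] at this
    rw [← this, hs]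
  set Q : T → T → T → T → ℝ := fun x y z u => R x y z u
    - (ν * (pi1 (fun a b => g a b) x y z u - pi2 (fun a b => g a b) (fun a => J a) x y z u)
      + νt * pi3 (fun a b => g a b) (fun a => J a) x y z u) with hQdef
  have hQ : IsCurvatureLike Q := by
    constructor
    · intro x x' y z u
      simp only [hQdef, pi1, pi2, pi3, map_add, LinearMap.add_apply]
      linear_combination hR.add_left x x' y z u
    · intro c x y z u
      simp only [hQdef, pi1, pi2, pi3, map_smul, LinearMap.smul_apply, smul_eq_mul]
      linear_combination hR.smul_left c x y z u
    · intro x y z u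
      simp only [hQdef, pi1, pi2, pi3]
      linear_combination hR.skew_left x y z u
    · intro x y z u
      simp only [hQdef, pi1, pi2, pi3]
      linear_combination hR.skew_right x y z u
    · intro x y z u
      simp only [hQdef, pi1, pi2, pi3, hs z x, hs y x, hs z y, hsJ z x, hsJ y x, hsJ z y]
      linear_combination hR.bianchi x y z u
  have hJQ (x y z u : T) : Q x y (J z) u = Q x y z (J u) := by
    simp only [hQdef, pi1, pi2, pi3, hJ, map_neg]
    linear_combination hJR x y z u
  have hW' (x : T) (hx : x ∈ W) (y : T) (hy : y ∈ W) : g x (J y) = 0 := by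
    rw [hs]; exact hW y hy x hx
  have hsec (x : T) (hx : x ∈ W) (y : T) (hy : y ∈ W) : Q x y y x = 0 ∧ Q x y y (J x) = 0 := by
    by_cases hΔ : pi1 (fun a b => g a b) x y y x = 0
    · by_cases hx0 : x = 0
      · subst hx0
        have h0 (u : T) : Q 0 y y u = 0 := by simpa using hQ.smul_left 0 0 y y u
        exact ⟨h0 _, h0 _⟩
      · have hxx := hpos x hx hx0
        have hv : y - (g x y / g x x) • x = 0 := by
          by_contra hv
          have h1 := hpos _ (W.sub_mem hy (W.smul_mem (g x y / g x x) hx)) hv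
          have h2 : g (y - (g x y / g x x) • x) (y - (g x y / g x x) • x)
              = pi1 (fun a b => g a b) x y y x / g x x := by
            simp only [pi1, map_sub, map_smul, LinearMap.sub_apply, LinearMap.smul_apply,
              smul_eq_mul, hs y x]
            field_simp
            ring
          rw [h2, hΔ, zero_div] at h1
          exact lt_irrefl _ h1
        rw [sub_eq_zero] at hv
        have h0 (z u : T) : Q x y z u = 0 := by
          rw [hv, hQ.smul_second, hQ.self_left, mul_zero]
        exact ⟨h0 _ _, h0 _ _⟩
    · obtain ⟨h1, h2⟩ := hc x y hΔ ⟨hW x hx x hx, hW x hx y hy, hW y hy x hx, hW y hy y hy⟩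
      have e1 := hW' x hx x hx
      have e2 := hW' x hx y hy
      have e3 := hW' y hy x hx
      have e4 := hW' y hy y hy
      simp only [pi1] at h1 h2
      constructor
      · simp only [hQdef, pi1, pi2, pi3, e1, e2, e3, e4]
        linear_combination h1
      · simp only [hQdef, pi1, pi2, pi3, e1, e2, e3, e4, hJ, map_neg]
        linear_combination h2
  have hQ' : IsCurvatureLike fun x y z u => Q x y z (J u) := by
    refine ⟨fun x x' y z u => hQ.add_left .., fun c x y z u => hQ.smul_left .., fun x y z u =>
      hQ.skew_left .., fun x y z u => ?_, fun x y z u => hQ.bianchi ..⟩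
    rw [hQ.skew_right, hJQ]
  have h0 {x y z : T} (hx : x ∈ W) (hy : y ∈ W) (hz : z ∈ W) (u : T) : Q x y z u = 0 := by
    obtain ⟨a, ha, b, hb, rfl⟩ := hsp u
    rw [hQ.add_fourth, hQ.eq_zero_of_sectional (fun x hx y hy => (hsec x hx y hy).1) hx hy hz ha,
      hQ'.eq_zero_of_sectional (fun x hx y hy => (hsec x hx y hy).2) hx hy hz hb, add_zero]
  have h1 {x y : T} (hx : x ∈ W) (hy : y ∈ W) (z u : T) : Q x y z u = 0 := by
    obtain ⟨a, ha, b, hb, rfl⟩ := hsp z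
    rw [hQ.add_third, hJQ, h0 hx hy ha, h0 hx hy hb, add_zero]
  have h2 {x : T} (hx : x ∈ W) (y z u : T) : Q x y z u = 0 := by
    obtain ⟨a, ha, b, hb, rfl⟩ := hsp y
    rw [hQ.add_second, hQ.pure_second hJQ, h1 hx ha, h1 hx hb, add_zero]
  have h3 : Q x y z u = 0 := by
    obtain ⟨a, ha, b, hb, rfl⟩ := hsp x
    rw [hQ.add_left, hQ.pure_first hJQ, h2 ha, h2 hb, add_zero]
  exact sub_eq_zero.1 h3

/-- The complex structure on `T` in which `i` acts as `J`. -/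
abbrev complexModule (J : T →ₗ[ℝ] T) (hJ : ∀ x, J (J x) = -x) : Module ℂ T :=
  Module.compHom T (Complex.lift (A := Module.End ℝ T) ⟨J, LinearMap.ext hJ⟩).toRingHom

theorem complexModule_smul (hJ : ∀ x, J (J x) = -x) (c : ℂ) (x : T) :
    letI := complexModule J hJ
    c • x = c.re • x + c.im • J x := by
  change (Complex.lift (A := Module.End ℝ T) ⟨J, LinearMap.ext hJ⟩ c) x = _
  simp [Complex.lift_apply, Complex.liftAux_apply, Module.algebraMap_end_apply]

theorem finite_complexModule [FiniteDimensional ℝ T] (hJ : ∀ x, J (J x) = -x) :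
    letI := complexModule J hJ
    FiniteDimensional ℂ T := by
  let _ := complexModule J hJ
  have : IsScalarTower ℝ ℂ T := by
    refine ⟨fun r c x => ?_⟩
    rw [complexModule_smul hJ, complexModule_smul hJ]
    simp [smul_smul]
  exact Module.Finite.of_restrictScalars_finite ℝ ℂ T

/-- A complex structure is conjugate to its negative, through complex conjugation of the
coordinates in a complex basis. -/
theorem trace_complexStructure [FiniteDimensional ℝ T] (hJ : ∀ x, J (J x) = -x) :
    LinearMap.trace ℝ T J = 0 := by
  let _ := complexModule J hJ
  have := finite_complexModule hJ
  set b := Module.finBasis ℂ T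
  have hr (r : ℝ) (x : T) : r • x = (r : ℂ) • x := by
    rw [complexModule_smul hJ]; simp
  have hI (x : T) : J x = Complex.I • x := by
    rw [complexModule_smul hJ]; simp
  let C : T →ₗ[ℝ] T :=
    { toFun := fun x => b.equivFun.symm fun i => (starRingEnd ℂ) (b.equivFun x i)
      map_add' := fun x y => by
        rw [← map_add]; congr 1; ext i; simp
      map_smul' := fun r x => by
        rw [RingHom.id_apply, hr, hr, ← map_smul]; congr 1; ext i
        rw [map_smul]; simp [-Complex.coe_smul] }
  have hC (x : T) : C x = b.equivFun.symm fun i => (starRingEnd ℂ) (b.equivFun x i) := rfl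
  have hCC : C * C = 1 := by
    ext x
    rw [Module.End.mul_apply, hC (C x), hC x, LinearEquiv.apply_symm_apply]
    simp
  have hCJ : C * J = -(J * C) := by
    ext x
    rw [Module.End.mul_apply, LinearMap.neg_apply, Module.End.mul_apply, hI, hI, hC, hC x,
      ← map_smul, ← map_neg]
    congr 1; ext i; simp
  have h1 : LinearMap.trace ℝ T (C * (C * J)) = LinearMap.trace ℝ T J := by
    rw [← mul_assoc, hCC, one_mul]
  rw [hCJ, mul_neg, map_neg, LinearMap.trace_mul_comm, mul_assoc, hCC, mul_one] at h1
  linarith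

/-- A nondegenerate Norden metric is the real part of a complex symmetric form; the real span of
a complex orthonormal basis is a totally real form of `T` on which the metric is positive
definite. -/
theorem exists_realForm [FiniteDimensional ℝ T]
    (hs : ∀ x y, g x y = g y x) (hJ : ∀ x, J (J x) = -x) (hg : ∀ x y, g (J x) (J y) = -g x y)
    (hnd : ∀ x, (∀ y, g x y = 0) → x = 0) :
    ∃ W : Submodule ℝ T, (∀ x ∈ W, ∀ y ∈ W, g (J x) y = 0) ∧ (∀ x ∈ W, x ≠ 0 → 0 < g x x) ∧
      ∀ x, ∃ a ∈ W, ∃ b ∈ W, x = a + J b := by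
  let _ := complexModule J hJ
  have := finite_complexModule hJ
  have hsm (c : ℂ) (x : T) : c • x = c.re • x + c.im • J x := complexModule_smul hJ c x
  have hsJ (x y : T) : g x (J y) = g (J x) y := by
    have := hg x (J y)
    rw [hJ, map_neg, neg_inj] at this
    exact this.symm
  let h : LinearMap.BilinForm ℂ T := LinearMap.mk₂ ℂ (fun x y => (⟨g x y, -g (J x) y⟩ : ℂ))
    (fun x x' y => by apply Complex.ext <;> simp; ring)
    (fun c x y => by
      apply Complex.ext <;> simp [hsm, hJ]
      ring)
    (fun x y y' => by apply Complex.ext <;> simp; ring)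
    (fun c x y => by
      apply Complex.ext <;> simp [hsm, hsJ, hJ]
      ring)
  have hre (x y : T) : (h x y).re = g x y := rfl
  have him (x y : T) : (h x y).im = -g (J x) y := rfl
  have hsymm : LinearMap.IsSymm h := ⟨fun x y => by
    apply Complex.ext
    · exact hs x y
    · change (h x y).im = (h y x).im
      rw [him, him, hs (J x) y, hsJ y x]⟩
  have hsep : h.SeparatingLeft := fun x hx => hnd x fun y => by rw [← hre, hx y]; rfl
  obtain ⟨v, hv⟩ := LinearMap.BilinForm.exists_orthogonal_basis hsymm
  have hvv := hv.not_isOrtho_basis_self_of_separatingLeft hsep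
  choose c hc using fun i => IsAlgClosed.exists_pow_nat_eq (h (v i) (v i))⁻¹ two_pos
  have hc0 (i) : c i ≠ 0 := by
    intro h0
    have := hc i
    rw [h0] at this
    exact hvv i (inv_eq_zero.1 (by simpa using this.symm))
  set e := fun i => c i • v i with he
  have hee (i j) : h (e i) (e j) = if i = j then 1 else 0 := by
    by_cases hij : i = j
    · subst hij
      simp only [he, map_smul, LinearMap.smul_apply, smul_eq_mul, if_true]
      rw [← mul_assoc, ← sq, hc, inv_mul_cancel₀ (hvv i)]
    · have : h (v i) (v j) = 0 := hv hij
      simp [he, this, hij]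
  have hgee (i j) : g (e i) (e j) = if i = j then 1 else 0 := by
    rw [← hre, hee]; split_ifs <;> simp
  have hJee (i j) : g (J (e i)) (e j) = 0 := by
    rw [← neg_eq_zero, ← him, hee]; split_ifs <;> simp
  let L : (Fin (Module.finrank ℂ T) → ℝ) →ₗ[ℝ] T := Fintype.linearCombination ℝ e
  have hL (a) : L a = ∑ i, a i • e i := Fintype.linearCombination_apply ℝ e a
  refine ⟨LinearMap.range L, ?_, ?_, ?_⟩
  · rintro _ ⟨a, rfl⟩ _ ⟨b, rfl⟩
    simp [hL, LinearMap.sum_apply, hJee]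
  · rintro _ ⟨a, rfl⟩ ha
    have h1 : g (L a) (L a) = ∑ i, a i * a i := by
      simp [hL, LinearMap.sum_apply, hgee]
    rw [h1]
    refine lt_of_le_of_ne (Finset.sum_nonneg fun i _ => mul_self_nonneg _) fun h0 => ha ?_
    rw [eq_comm, Finset.sum_eq_zero_iff_of_nonneg fun i _ => mul_self_nonneg _] at h0
    rw [hL]
    exact Finset.sum_eq_zero fun i hi => by rw [mul_self_eq_zero.1 (h0 i hi), zero_smul]
  · intro x
    set r := fun i => v.repr x i / c i with hrdef
    refine ⟨L fun i => (r i).re, ⟨_, rfl⟩, L fun i => (r i).im, ⟨_, rfl⟩, ?_⟩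
    rw [hL, hL, map_sum, ← Finset.sum_add_distrib]
    calc x = ∑ i, v.repr x i • v i := (v.sum_repr x).symm
      _ = ∑ i, ((r i).re • e i + J ((r i).im • e i)) := by
        refine Finset.sum_congr rfl fun i _ => ?_
        rw [map_smul, ← hsm, he, smul_smul, hrdef, div_mul_cancel₀ _ (hc0 i)]

end CurvatureAlgebra

/-! ### Constant totally real sectional curvatures; time-like hyperplanes -/

section ConstantCurvature

variable {E' : Type*} [NormedAddCommGroup E'] [NormedSpace ℝ E'] [FiniteDimensional ℝ E']
  {M' : Type*} [TopologicalSpace M'] [ChartedSpace E' M'] [IsManifold 𝓘(ℝ, E') ∞ M']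
  {J : Π p : M', TangentSpace 𝓘(ℝ, E') p →L[ℝ] TangentSpace 𝓘(ℝ, E') p}
  {g : Π p : M', TangentSpace 𝓘(ℝ, E') p →L[ℝ] TangentSpace 𝓘(ℝ, E') p →L[ℝ] ℝ}
  {nabla : CovariantDerivative 𝓘(ℝ, E') E' (TangentSpace 𝓘(ℝ, E') : M' → Type _)}

theorem finiteDimensional_tangentSpace (y : M') :
    FiniteDimensional ℝ (TangentSpace 𝓘(ℝ, E') y) :=
  inferInstanceAs (FiniteDimensional ℝ E')

theorem isCurvatureLike_riemann (hA : IsAlmostComplexNorden J g)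
    (hL : IsLeviCivita (fun p x y => g p x y) nabla) (y : M') :
    IsCurvatureLike fun a b c d : TangentSpace 𝓘(ℝ, E') y => g y (riemann g y a b c) d where
  add_left x x' z u v := by rw [riemann_add_left, map_add, add_apply]
  smul_left c x z u v := by rw [riemann_smul_left, map_smul, smul_apply, smul_eq_mul]
  skew_left x z u v := by rw [riemann_skew_left, map_neg, neg_apply]
  skew_right x z u v := by rw [riemann_skew_right hA hL]
  bianchi x z u v := by
    rw [← add_apply, ← add_apply, ← map_add, ← map_add, riemann_bianchi hA hL, map_zero, zero_apply]

/-- A Kähler manifold with Norden metric of constant totally real sectional curvatures `ν`, `ν̃` has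
curvature tensor `ν (π₁ - π₂) + ν̃ π₃`. -/
theorem riemann_eq (hK : IsKaehlerNorden J g nabla) {ν νt : M' → ℝ}
    (hν : HasConstantTotallyRealCurvatures J g nabla ν νt) (p : M')
    (x y z u : TangentSpace 𝓘(ℝ, E') p) :
    g p (riemann g p x y z) u
      = ν p * (pi1 (fun a b => g p a b) x y z u
            - pi2 (fun a b => g p a b) (fun a => J p a) x y z u)
        + νt p * pi3 (fun a b => g p a b) (fun a => J p a) x y z u := by
  have hA := hK.almost_complex
  have hL := hK.levi_civita
  have := finiteDimensional_tangentSpace (E' := E') p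
  obtain ⟨W, h1, h2, h3⟩ := exists_realForm (J := (J p).toLinearMap)
    (g := ContinuousLinearMap.toLinearMap₁₂ (g p)) (hA.symm p) (hA.sq p) (hA.norden p)
    (hA.nondegenerate p)
  refine eq_of_constant_totallyReal (J := (J p).toLinearMap)
    (g := ContinuousLinearMap.toLinearMap₁₂ (g p)) (isCurvatureLike_riemann hA hL p) ?_
    (hA.symm p) (hA.sq p) (hA.norden p) ?_ h1 h2 h3 x y z u
  · intro x y z u
    change g p (riemann g p x y (J p z)) u = g p (riemann g p x y z) (J p u)
    rw [riemann_structure hK]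
    have h := hA.norden p (riemann g p x y z) (J p u)
    rw [hA.sq, map_neg, neg_inj] at h
    exact h
  · intro x y hΔ hr
    replace hΔ : pi1 (fun a b => g p a b) x y y x ≠ 0 := hΔ
    have h := hν p x y hΔ hr
    rw [curvatureTensor_eq hA hL, curvatureTensor_eq hA hL, div_eq_iff hΔ, div_eq_iff hΔ] at h
    exact h

end ConstantCurvature

section Hyperplane

variable {T : Type*} [AddCommGroup T] [Module ℝ T] {V : Type*} [AddCommGroup V] [Module ℝ V]

/-- The pointwise data of a time-like real hypersurface: `ι` is the differential of the immersion,
`N` the unit normal and `c = cos t`, `s = sin t`. -/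
structure IsTimelikeHyperplane (g : T →ₗ[ℝ] T →ₗ[ℝ] ℝ) (J : T →ₗ[ℝ] T) (N : T) (ι : V →ₗ[ℝ] T)
    (c s : ℝ) : Prop where
  symm : ∀ x y, g x y = g y x
  nondegenerate : ∀ x, (∀ y, g x y = 0) → x = 0
  sq : ∀ x, J (J x) = -x
  norden : ∀ x y, g (J x) (J y) = -g x y
  injective : Function.Injective ι
  normal : ∀ x, g N (ι x) = 0
  unit : g N N = -1
  finrank_eq : Module.finrank ℝ T = Module.finrank ℝ V + 1
  cos_sq_add_sin_sq : c ^ 2 + s ^ 2 = 1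
  sin_eq : s = c * g N (J N)

/-- The `g`-orthogonal projection along `N` and `JN` (onto the contact distribution), in terms of
`c = cos t` and `s = sin t`. The coefficients come from inverting the Gram matrix of `N`, `JN`, which
is `(-1, tan t; tan t, 1)`. -/
def contactProj (g : T →ₗ[ℝ] T →ₗ[ℝ] ℝ) (J : T →ₗ[ℝ] T) (N : T) (c s : ℝ) : T →ₗ[ℝ] T :=
  LinearMap.id
    - ((c * s) • g.flip (J N) - c ^ 2 • g.flip N).smulRight N
    - (c ^ 2 • g.flip (J N) + (c * s) • g.flip N).smulRight (J N)

theorem contactProj_apply (g : T →ₗ[ℝ] T →ₗ[ℝ] ℝ) (J : T →ₗ[ℝ] T) (N : T) (c s : ℝ) (w : T) :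
    contactProj g J N c s w = w - (c * s * g w (J N) - c ^ 2 * g w N) • N
      - (c ^ 2 * g w (J N) + c * s * g w N) • J N := by
  simp [contactProj]

namespace IsTimelikeHyperplane

variable {g : T →ₗ[ℝ] T →ₗ[ℝ] ℝ} {J : T →ₗ[ℝ] T} {N : T} {ι : V →ₗ[ℝ] T} {c s : ℝ}

theorem structure_symm (h : IsTimelikeHyperplane g J N ι c s) (x y : T) :
    g (J x) y = g x (J y) := by
  have := h.norden x (J y)
  rw [h.sq, map_neg, neg_inj] at this
  exact this

theorem norden_unit (h : IsTimelikeHyperplane g J N ι c s) : g (J N) (J N) = 1 := by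
  rw [h.norden, h.unit, neg_neg]

theorem contactProj_normal (h : IsTimelikeHyperplane g J N ι c s) :
    contactProj g J N c s N = 0 := by
  have h1 : c * s * g N (J N) - c ^ 2 * g N N = 1 := by
    rw [h.unit]; linear_combination h.cos_sq_add_sin_sq - s * h.sin_eq
  have h2 : c ^ 2 * g N (J N) + c * s * g N N = 0 := by
    rw [h.unit]; linear_combination -c * h.sin_eq
  rw [contactProj_apply, h1, h2]; simp

theorem contactProj_structure_normal (h : IsTimelikeHyperplane g J N ι c s) :
    contactProj g J N c s (J N) = 0 := by
  have h1 : c * s * g (J N) (J N) - c ^ 2 * g (J N) N = 0 := by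
    rw [h.norden_unit, h.structure_symm]; linear_combination c * h.sin_eq
  have h2 : c ^ 2 * g (J N) (J N) + c * s * g (J N) N = 1 := by
    rw [h.norden_unit, h.structure_symm]
    linear_combination h.cos_sq_add_sin_sq - s * h.sin_eq
  rw [contactProj_apply, h1, h2]; simp

theorem contactProj_structure (h : IsTimelikeHyperplane g J N ι c s) (w : T) :
    contactProj g J N c s (J w) = J (contactProj g J N c s w) := by
  simp only [contactProj_apply, map_sub, map_smul, h.sq, h.structure_symm, map_neg]
  module

theorem contactProj_symm (h : IsTimelikeHyperplane g J N ι c s) (v w : T) :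
    g (contactProj g J N c s v) w = g v (contactProj g J N c s w) := by
  simp only [contactProj_apply, map_sub, map_smul, LinearMap.sub_apply, LinearMap.smul_apply,
    smul_eq_mul, h.symm N w, h.symm (J N) w]
  ring

/-- The tangent hyperplane is the orthogonal complement of the normal. -/
theorem mem_range [FiniteDimensional ℝ T] [FiniteDimensional ℝ V]
    (h : IsTimelikeHyperplane g J N ι c s) {w : T} (hw : g w N = 0) : ∃ x, ι x = w := by
  have h1 : LinearMap.range ι ≤ LinearMap.ker (g N) := by
    rintro _ ⟨x, rfl⟩
    exact h.normal x
  have h2 : Module.finrank ℝ (LinearMap.ker (g N)) < Module.finrank ℝ T := by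
    refine Submodule.finrank_lt fun htop => ?_
    have h3 : N ∈ LinearMap.ker (g N) := htop ▸ Submodule.mem_top
    rw [LinearMap.mem_ker, h.unit] at h3
    norm_num at h3
  have h3 : LinearMap.range ι = LinearMap.ker (g N) := by
    refine Submodule.eq_of_le_of_finrank_le h1 ?_
    rw [LinearMap.finrank_range_of_inj h.injective]
    have := h.finrank_eq
    omega
  have h4 : w ∈ LinearMap.range ι := by
    rw [h3, LinearMap.mem_ker, h.symm, hw]
  exact h4

/-- A vector orthogonal to the tangent hyperplane is a multiple of the normal. -/
theorem eq_of_orthogonal [FiniteDimensional ℝ T] [FiniteDimensional ℝ V]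
    (h : IsTimelikeHyperplane g J N ι c s) {w : T} (hw : ∀ x, g w (ι x) = 0) :
    w + g w N • N = 0 := by
  refine h.nondegenerate _ fun y => ?_
  obtain ⟨x, hx⟩ := h.mem_range (w := y + g y N • N) (by simp [h.unit])
  have h1 := hw x
  rw [hx] at h1
  simp only [map_add, map_smul, LinearMap.add_apply, LinearMap.smul_apply, smul_eq_mul,
    h.symm N y] at h1 ⊢
  linear_combination h1

theorem contactProj_range (h : IsTimelikeHyperplane g J N ι c s) (x : V) :
    contactProj g J N c s (ι x) = ι x - (c * g (J N) (ι x)) • (s • N + c • J N) := by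
  rw [contactProj_apply, h.symm (ι x) N, h.normal, h.symm (ι x)]
  module

theorem reeb_normal (h : IsTimelikeHyperplane g J N ι c s) : g (s • N + c • J N) N = 0 := by
  simp only [map_add, map_smul, LinearMap.add_apply, LinearMap.smul_apply, smul_eq_mul, h.unit,
    h.structure_symm]
  linear_combination -h.sin_eq

theorem reeb_unit (h : IsTimelikeHyperplane g J N ι c s) :
    g (s • N + c • J N) (s • N + c • J N) = 1 := by
  simp only [map_add, map_smul, LinearMap.add_apply, LinearMap.smul_apply, smul_eq_mul, h.unit,
    h.structure_symm, h.sq, map_neg]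
  linear_combination h.cos_sq_add_sin_sq - 2 * s * h.sin_eq

theorem contactProj_reeb (h : IsTimelikeHyperplane g J N ι c s) :
    contactProj g J N c s (s • N + c • J N) = 0 := by
  rw [map_add, map_smul, map_smul, h.contactProj_normal, h.contactProj_structure_normal]
  simp

theorem reeb_range (h : IsTimelikeHyperplane g J N ι c s) (x : V) :
    g (s • N + c • J N) (ι x) = c * g (J N) (ι x) := by
  simp [h.normal]

theorem contactProj_normal_right (h : IsTimelikeHyperplane g J N ι c s) (w : T) :
    g (contactProj g J N c s w) N = 0 := by
  rw [h.contactProj_symm, h.contactProj_normal, map_zero]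

theorem contactProj_structure_normal_right (h : IsTimelikeHyperplane g J N ι c s) (w : T) :
    g (contactProj g J N c s w) (J N) = 0 := by
  rw [h.contactProj_symm, h.contactProj_structure_normal, map_zero]

theorem contactProj_contactProj (h : IsTimelikeHyperplane g J N ι c s) (w : T) :
    contactProj g J N c s (contactProj g J N c s w) = contactProj g J N c s w := by
  conv_lhs => rw [contactProj_apply _ _ _ _ _ (contactProj g J N c s w)]
  rw [h.contactProj_normal_right, h.contactProj_structure_normal_right]
  simp

theorem trace_structure_comp_contactProj [FiniteDimensional ℝ T]
    (h : IsTimelikeHyperplane g J N ι c s) :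
    LinearMap.trace ℝ T (J ∘ₗ contactProj g J N c s) = 0 := by
  have h1 : J ∘ₗ contactProj g J N c s = J
      - ((c * s) • g.flip (J N) - c ^ 2 • g.flip N).smulRight (J N)
      + (c ^ 2 • g.flip (J N) + (c * s) • g.flip N).smulRight N := by
    ext w
    simp only [contactProj_apply, LinearMap.comp_apply, map_sub, map_smul, h.sq]
    simp
  rw [h1, map_add, map_sub, trace_complexStructure h.sq, LinearMap.trace_smulRight,
    LinearMap.trace_smulRight]
  simp only [LinearMap.sub_apply, LinearMap.add_apply, LinearMap.smul_apply, LinearMap.flip_apply,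
    smul_eq_mul, h.norden_unit, h.unit, h.structure_symm]
  linear_combination -2 * c * h.sin_eq

end IsTimelikeHyperplane

end Hyperplane

/-! ### Curvature tensors and scalar curvatures on an almost contact vector space -/

section AlmostContact

variable {V : Type*} [AddCommGroup V] [Module ℝ V]

/-- Pointwise data of an almost contact structure `(φ, ξ, η)` with compatible metric `g` (for which
`φ` is self-adjoint, so that `g(φx, φy) = -g(x, y) + η(x)η(y)`), together with a self-adjoint
endomorphism `A`. That `φ` is traceless follows from `φ² = -1` on `ker η`; it is kept as a field
since the trace is known directly for hypersurfaces. -/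
structure IsContactShape (g : V →ₗ[ℝ] V →ₗ[ℝ] ℝ) (φ A : V →ₗ[ℝ] V) (ξ : V) (η : V →ₗ[ℝ] ℝ) :
    Prop where
  symm : ∀ x y, g x y = g y x
  nondegenerate : ∀ x, (∀ y, g x y = 0) → x = 0
  phi_phi : ∀ x, φ (φ x) = -x + η x • ξ
  phi_symm : ∀ x y, g (φ x) y = g x (φ y)
  eta_eq : ∀ x, η x = g x ξ
  eta_reeb : η ξ = 1
  phi_reeb : φ ξ = 0
  trace_phi : LinearMap.trace ℝ V φ = 0
  shape_symm : ∀ x y, g (A x) y = g x (A y)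

/-- The tensor `g(Sy, z) g(Tx, u) - g(Sx, z) g(Ty, u)`. -/
def wedge (g : V →ₗ[ℝ] V →ₗ[ℝ] ℝ) (S T : V →ₗ[ℝ] V) (x y z u : V) : ℝ :=
  g (S y) z * g (T x) u - g (S x) z * g (T y) u

/-- The tensor `{ν [π₁ - π₂ - π₄] + ν̃ [π₃ + π₅]}(x, y, z, u)
- c {c [π₁ - π₂ - π₄] + s [π₃ + π₅]}(Ax, Ay, z, u)`. -/
def contactCurvature (g : V →ₗ[ℝ] V →ₗ[ℝ] ℝ) (φ A : V →ₗ[ℝ] V) (η : V →ₗ[ℝ] ℝ)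
    (ν νt c s : ℝ) (x y z u : V) : ℝ :=
  ν * (pi1 (fun a b => g a b) x y z u - pi2 (fun a b => g a b) (fun a => φ a) x y z u
          - pi4 (fun a b => g a b) (fun a => η a) x y z u)
        + νt * (pi3 (fun a b => g a b) (fun a => φ a) x y z u
          + pi5 (fun a b => g a b) (fun a => φ a) (fun a => η a) x y z u)
        - c * (c * (pi1 (fun a b => g a b) (A x) (A y) z u
              - pi2 (fun a b => g a b) (fun a => φ a) (A x) (A y) z u
              - pi4 (fun a b => g a b) (fun a => η a) (A x) (A y) z u)
            + s * (pi3 (fun a b => g a b) (fun a => φ a) (A x) (A y) z u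
              + pi5 (fun a b => g a b) (fun a => φ a) (fun a => η a) (A x) (A y) z u))

section Trace

variable {ι : Type*} [Fintype ι] [DecidableEq ι] (e : Module.Basis ι ℝ V)
  {g : V →ₗ[ℝ] V →ₗ[ℝ] ℝ}

theorem scalarCurvature_add (g : V → V → ℝ) (L L' : V → V → V → V → ℝ) :
    scalarCurvature e g (fun x y z u => L x y z u + L' x y z u)
      = scalarCurvature e g L + scalarCurvature e g L' := by
  simp only [scalarCurvature, mul_add, Finset.sum_add_distrib]

theorem scalarCurvature_smul (g : V → V → ℝ) (r : ℝ) (L : V → V → V → V → ℝ) :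
    scalarCurvature e g (fun x y z u => r * L x y z u) = r * scalarCurvature e g L := by
  simp only [scalarCurvature, Finset.mul_sum]
  refine Finset.sum_congr rfl fun i _ => Finset.sum_congr rfl fun j _ =>
    Finset.sum_congr rfl fun k _ => Finset.sum_congr rfl fun l _ => ?_
  ring

/-- The Gram matrix of a nondegenerate form is invertible. -/
theorem isUnit_gram (hnd : ∀ x, (∀ y, g x y = 0) → x = 0) :
    IsUnit (Matrix.of fun i j => g (e i) (e j)).det := by
  rw [isUnit_iff_ne_zero]
  intro hdet
  obtain ⟨v, hv, hv0⟩ := Matrix.exists_vecMul_eq_zero_iff.2 hdet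
  refine hv ?_
  have h1 : ∑ i, v i • e i = 0 := by
    refine hnd _ fun y => ?_
    rw [← e.sum_repr y]
    simp only [map_sum, map_smul, smul_eq_mul]
    refine Finset.sum_eq_zero fun j _ => ?_
    have h2 := congrFun hv0 j
    simp only [Matrix.vecMul, dotProduct, Matrix.of_apply, Pi.zero_apply] at h2
    rw [LinearMap.sum_apply]
    simp only [LinearMap.smul_apply, smul_eq_mul]
    rw [h2, mul_zero]
  have h3 := Fintype.linearIndependent_iff.1 e.linearIndependent v h1
  exact funext h3

/-- Expansion of a vector by means of the inverse Gram matrix. -/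
theorem sum_gram_inv (hnd : ∀ x, (∀ y, g x y = 0) → x = 0) (hs : ∀ x y, g x y = g y x) (v : V) :
    ∑ i, ∑ j, ((Matrix.of fun i j => g (e i) (e j))⁻¹ i j * g v (e j)) • e i = v := by
  set G := Matrix.of fun i j => g (e i) (e j) with hG
  have hu := isUnit_gram e hnd
  have hgv (j) : g v (e j) = ∑ k, e.repr v k * G k j := by
    have h0 := congrArg (fun w => g w (e j)) (e.sum_repr v).symm
    simpa only [map_sum, LinearMap.sum_apply, map_smul, LinearMap.smul_apply, smul_eq_mul, hG,
      Matrix.of_apply] using h0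
  have hsymm (k j) : G k j = G j k := hs _ _
  have h1 (i) : ∑ j, G⁻¹ i j * g v (e j) = e.repr v i := by
    have h2 : ∑ j, G⁻¹ i j * g v (e j) = (G⁻¹ * G).mulVec (e.repr v) i := by
      rw [← Matrix.mulVec_mulVec]
      refine Finset.sum_congr rfl fun j _ => ?_
      rw [hgv]
      congr 1
      refine Finset.sum_congr rfl fun k _ => ?_
      rw [hsymm, mul_comm]
    rw [h2, Matrix.nonsing_inv_mul _ hu, Matrix.one_mulVec]
  simp only [← Finset.sum_smul, h1]
  exact e.sum_repr v

theorem sum_gram_inv_trace (hnd : ∀ x, (∀ y, g x y = 0) → x = 0) (hs : ∀ x y, g x y = g y x)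
    (S : V →ₗ[ℝ] V) :
    ∑ i, ∑ j, (Matrix.of fun i j => g (e i) (e j))⁻¹ i j * g (S (e i)) (e j)
      = LinearMap.trace ℝ V S := by
  rw [LinearMap.trace_eq_matrix_trace ℝ e, Matrix.trace]
  refine Finset.sum_congr rfl fun i _ => ?_
  rw [Matrix.diag_apply, LinearMap.toMatrix_apply]
  conv_rhs => rw [← sum_gram_inv e hnd hs (S (e i))]
  simp [Finsupp.single_apply, ← Finset.sum_smul]

theorem scalarCurvature_wedge (hnd : ∀ x, (∀ y, g x y = 0) → x = 0)
    (hs : ∀ x y, g x y = g y x) (S T : V →ₗ[ℝ] V) :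
    scalarCurvature e (fun x y => g x y) (wedge g S T)
      = LinearMap.trace ℝ V S * LinearMap.trace ℝ V T - LinearMap.trace ℝ V (T ∘ₗ S) := by
  rw [← sum_gram_inv_trace e hnd hs S, ← sum_gram_inv_trace e hnd hs T,
    ← sum_gram_inv_trace e hnd hs (T ∘ₗ S)]
  set G := Matrix.of fun i j => g (e i) (e j) with hG
  have h1 (i j) : ∑ k, ∑ l, G⁻¹ i j * G⁻¹ k l * wedge g S T (e i) (e k) (e l) (e j)
      = G⁻¹ i j * g (T (e i)) (e j) * ∑ k, ∑ l, G⁻¹ k l * g (S (e k)) (e l)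
        - G⁻¹ i j * g (T (S (e i))) (e j) := by
    have h2 : g (T (S (e i))) (e j)
        = ∑ k, ∑ l, G⁻¹ k l * g (S (e i)) (e l) * g (T (e k)) (e j) := by
      conv_lhs => rw [← sum_gram_inv e hnd hs (S (e i))]
      simp [map_sum, LinearMap.sum_apply, hG]
    rw [h2, Finset.mul_sum, Finset.mul_sum, ← Finset.sum_sub_distrib]
    refine Finset.sum_congr rfl fun k _ => ?_
    rw [Finset.mul_sum, Finset.mul_sum, ← Finset.sum_sub_distrib]
    refine Finset.sum_congr rfl fun l _ => ?_
    unfold wedge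
    ring
  have h3 : scalarCurvature e (fun x y => g x y) (wedge g S T)
      = ∑ i, ∑ j, ∑ k, ∑ l, G⁻¹ i j * G⁻¹ k l * wedge g S T (e i) (e k) (e l) (e j) := rfl
  rw [h3]
  simp only [h1, Finset.sum_sub_distrib, ← Finset.sum_mul, LinearMap.comp_apply]
  ring

end Trace

namespace IsContactShape

variable {g : V →ₗ[ℝ] V →ₗ[ℝ] ℝ} {φ A : V →ₗ[ℝ] V} {ξ : V} {η : V →ₗ[ℝ] ℝ}

theorem eta_phi (h : IsContactShape g φ A ξ η) (x : V) : η (φ x) = 0 := by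
  rw [h.eta_eq, h.phi_symm, h.phi_reeb, map_zero]

theorem metric_phi_phi (h : IsContactShape g φ A ξ η) (x y : V) :
    g x (φ (φ y)) = -g x y + η x * η y := by
  rw [h.phi_phi, map_add, map_neg, map_smul, smul_eq_mul, ← h.eta_eq, mul_comm]

/-- The projection `1 - η ⊗ ξ = -φ²` onto the contact distribution. -/
theorem phi_sq (h : IsContactShape g φ A ξ η) : φ ∘ₗ φ = -(LinearMap.id - η.smulRight ξ) := by
  ext x
  rw [LinearMap.comp_apply, h.phi_phi]
  simp [sub_eq_neg_add]

theorem wedge_proj (h : IsContactShape g φ A ξ η) (B : V →ₗ[ℝ] V) (x y z u : V) :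
    pi1 (fun a b => g a b) (B x) (B y) z u - pi2 (fun a b => g a b) (fun a => φ a) (B x) (B y) z u
        - pi4 (fun a b => g a b) (fun a => η a) (B x) (B y) z u
      = wedge g ((LinearMap.id - η.smulRight ξ) ∘ₗ B) ((LinearMap.id - η.smulRight ξ) ∘ₗ B) x y z u
        - wedge g (φ ∘ₗ B) (φ ∘ₗ B) x y z u := by
  simp only [pi1, pi2, pi4, wedge, LinearMap.comp_apply, LinearMap.sub_apply, LinearMap.id_apply,
    LinearMap.smulRight_apply, map_sub, map_smul, LinearMap.smul_apply, smul_eq_mul, h.phi_symm,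
    h.symm ξ, ← h.eta_eq]
  ring

theorem wedge_proj_phi (h : IsContactShape g φ A ξ η) (B : V →ₗ[ℝ] V) (x y z u : V) :
    pi3 (fun a b => g a b) (fun a => φ a) (B x) (B y) z u
        + pi5 (fun a b => g a b) (fun a => φ a) (fun a => η a) (B x) (B y) z u
      = -(wedge g ((LinearMap.id - η.smulRight ξ) ∘ₗ B) (φ ∘ₗ B) x y z u
        + wedge g (φ ∘ₗ B) ((LinearMap.id - η.smulRight ξ) ∘ₗ B) x y z u) := by
  simp only [pi3, pi5, wedge, LinearMap.comp_apply, LinearMap.sub_apply, LinearMap.id_apply,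
    LinearMap.smulRight_apply, map_sub, map_smul, LinearMap.smul_apply, smul_eq_mul, h.phi_symm,
    h.symm ξ, ← h.eta_eq]
  ring

/-- Together with `phi_phi_right`: replacing `u` by `φ u` permutes the operators `-φ²`, `φ` up to
sign. This gives both the Kählerian symmetry and the second scalar curvature. -/
theorem proj_phi_right (h : IsContactShape g φ A ξ η) (B : V →ₗ[ℝ] V) (x u : V) :
    g (((LinearMap.id - η.smulRight ξ) ∘ₗ B) x) (φ u) = g ((φ ∘ₗ B) x) u := by
  simp only [LinearMap.comp_apply, LinearMap.sub_apply, LinearMap.id_apply,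
    LinearMap.smulRight_apply, map_sub, map_smul, LinearMap.smul_apply, smul_eq_mul, h.phi_symm,
    h.symm ξ, h.phi_reeb, map_zero]
  ring

theorem phi_phi_right (h : IsContactShape g φ A ξ η) (B : V →ₗ[ℝ] V) (x u : V) :
    g ((φ ∘ₗ B) x) (φ u) = -g (((LinearMap.id - η.smulRight ξ) ∘ₗ B) x) u := by
  simp only [LinearMap.comp_apply, LinearMap.sub_apply, LinearMap.id_apply,
    LinearMap.smulRight_apply, map_sub, map_smul, LinearMap.smul_apply, smul_eq_mul, h.phi_symm,
    h.symm ξ, ← h.eta_eq, h.metric_phi_phi]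
  ring

variable {L : V → V → V → V → ℝ} {ν νt c s : ℝ}

/-- The curvature in terms of the wedge products of the projection `1 - η ⊗ ξ`, of `φ` and of
their compositions with `A`. -/
theorem eq_wedge (h : IsContactShape g φ A ξ η)
    (hL : ∀ x y z u, L x y z u = contactCurvature g φ A η ν νt c s x y z u)
    (x y z u : V) :
    L x y z u
      = ν * wedge g (LinearMap.id - η.smulRight ξ) (LinearMap.id - η.smulRight ξ) x y z u
        + (-ν) * wedge g φ φ x y z u
        + (-νt) * wedge g (LinearMap.id - η.smulRight ξ) φ x y z u
        + (-νt) * wedge g φ (LinearMap.id - η.smulRight ξ) x y z u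
        + (-c ^ 2) * wedge g ((LinearMap.id - η.smulRight ξ) ∘ₗ A)
            ((LinearMap.id - η.smulRight ξ) ∘ₗ A) x y z u
        + c ^ 2 * wedge g (φ ∘ₗ A) (φ ∘ₗ A) x y z u
        + (c * s) * wedge g ((LinearMap.id - η.smulRight ξ) ∘ₗ A) (φ ∘ₗ A) x y z u
        + (c * s) * wedge g (φ ∘ₗ A) ((LinearMap.id - η.smulRight ξ) ∘ₗ A) x y z u := by
  have h1 := h.wedge_proj LinearMap.id x y z u
  have h2 := h.wedge_proj_phi LinearMap.id x y z u
  simp only [LinearMap.comp_id, LinearMap.id_apply] at h1 h2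
  rw [hL, contactCurvature, h1, h2, h.wedge_proj A, h.wedge_proj_phi A]
  ring

theorem isKaehlerian (h : IsContactShape g φ A ξ η)
    (hL : ∀ x y z u, L x y z u = contactCurvature g φ A η ν νt c s x y z u) :
    IsKaehlerian (fun a => φ a) L where
  skew_left x y z u := by
    simp only [h.eq_wedge hL, wedge]
    ring
  skew_right x y z u := by
    simp only [h.eq_wedge hL, wedge]
    ring
  anti_invariant x y z u := by
    have e1 := h.proj_phi_right LinearMap.id
    have e2 := h.phi_phi_right LinearMap.id
    simp only [LinearMap.comp_id] at e1 e2
    simp only [h.eq_wedge hL, wedge, h.proj_phi_right A, h.phi_phi_right A, e1, e2]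
    ring

theorem trace_proj [FiniteDimensional ℝ V] (h : IsContactShape g φ A ξ η) :
    LinearMap.trace ℝ V (LinearMap.id - η.smulRight ξ) = Module.finrank ℝ V - 1 := by
  rw [map_sub, LinearMap.trace_smulRight, h.eta_reeb, LinearMap.trace_id]

theorem proj_comp_proj (h : IsContactShape g φ A ξ η) :
    (LinearMap.id - η.smulRight ξ) ∘ₗ (LinearMap.id - η.smulRight ξ)
      = LinearMap.id - η.smulRight ξ := by
  ext x
  simp [h.eta_reeb]

theorem phi_comp_proj (h : IsContactShape g φ A ξ η) :
    φ ∘ₗ (LinearMap.id - η.smulRight ξ) = φ := by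
  ext x
  simp [h.phi_reeb]

theorem proj_comp_phi (h : IsContactShape g φ A ξ η) :
    (LinearMap.id - η.smulRight ξ) ∘ₗ φ = φ := by
  ext x
  simp [h.eta_phi]

theorem trace_proj_comp [FiniteDimensional ℝ V] (B : V →ₗ[ℝ] V) :
    LinearMap.trace ℝ V ((LinearMap.id - η.smulRight ξ) ∘ₗ B)
      = LinearMap.trace ℝ V B - η (B ξ) := by
  have h1 : (LinearMap.id - η.smulRight ξ) ∘ₗ B = B - (η ∘ₗ B).smulRight ξ := by
    ext x; simp
  rw [h1, map_sub, LinearMap.trace_smulRight, LinearMap.comp_apply]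

theorem trace_proj_shape_sq [FiniteDimensional ℝ V] (h : IsContactShape g φ A ξ η) :
    LinearMap.trace ℝ V (((LinearMap.id - η.smulRight ξ) ∘ₗ A)
        ∘ₗ ((LinearMap.id - η.smulRight ξ) ∘ₗ A))
      = LinearMap.trace ℝ V (A ∘ₗ A) - 2 * g (A ξ) (A ξ) + η (A ξ) ^ 2 := by
  rw [LinearMap.comp_assoc, trace_proj_comp]
  have h1 : A ∘ₗ ((LinearMap.id - η.smulRight ξ) ∘ₗ A) = A ∘ₗ A - (η ∘ₗ A).smulRight (A ξ) := by
    ext x; simp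
  rw [h1, map_sub, LinearMap.trace_smulRight]
  simp only [LinearMap.comp_apply, LinearMap.sub_apply, LinearMap.smulRight_apply, map_sub,
    map_smul, smul_eq_mul]
  rw [h.eta_eq (A (A ξ)), h.shape_symm (A ξ)]
  ring

theorem trace_phi_shape_proj_shape [FiniteDimensional ℝ V] (h : IsContactShape g φ A ξ η) :
    LinearMap.trace ℝ V ((φ ∘ₗ A) ∘ₗ ((LinearMap.id - η.smulRight ξ) ∘ₗ A))
      = LinearMap.trace ℝ V ((A ∘ₗ A) ∘ₗ φ) - g (φ (A ξ)) (A ξ) := by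
  have h1 : (φ ∘ₗ A) ∘ₗ ((LinearMap.id - η.smulRight ξ) ∘ₗ A)
      = φ ∘ₗ (A ∘ₗ A) - (η ∘ₗ A).smulRight (φ (A ξ)) := by
    ext x; simp
  rw [h1, map_sub, LinearMap.trace_smulRight, LinearMap.trace_comp_comm', LinearMap.comp_apply,
    h.eta_eq, h.shape_symm]

theorem trace_phi_shape_sq [FiniteDimensional ℝ V] :
    LinearMap.trace ℝ V ((φ ∘ₗ A) ∘ₗ (φ ∘ₗ A)) = LinearMap.trace ℝ V ((A ∘ₗ φ) ∘ₗ (A ∘ₗ φ)) := by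
  rw [LinearMap.comp_assoc, LinearMap.trace_comp_comm']
  rfl

section Scalar

variable {ι : Type*} [Fintype ι] [DecidableEq ι] (e : Module.Basis ι ℝ V)
  {n : ℕ}

theorem scalarCurvature_eq [FiniteDimensional ℝ V] (h : IsContactShape g φ A ξ η)
    {a₁ a₂ a₃ a₄ a₅ a₆ a₇ a₈ : ℝ}
    (hL : ∀ x y z u, L x y z u
      = a₁ * wedge g (LinearMap.id - η.smulRight ξ) (LinearMap.id - η.smulRight ξ) x y z u
        + a₂ * wedge g φ φ x y z u
        + a₃ * wedge g (LinearMap.id - η.smulRight ξ) φ x y z u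
        + a₄ * wedge g φ (LinearMap.id - η.smulRight ξ) x y z u
        + a₅ * wedge g ((LinearMap.id - η.smulRight ξ) ∘ₗ A)
            ((LinearMap.id - η.smulRight ξ) ∘ₗ A) x y z u
        + a₆ * wedge g (φ ∘ₗ A) (φ ∘ₗ A) x y z u
        + a₇ * wedge g ((LinearMap.id - η.smulRight ξ) ∘ₗ A) (φ ∘ₗ A) x y z u
        + a₈ * wedge g (φ ∘ₗ A) ((LinearMap.id - η.smulRight ξ) ∘ₗ A) x y z u)
    (hn : Module.finrank ℝ V = 2 * n + 1) :
    scalarCurvature e (fun x y => g x y) L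
      = a₁ * ((2 * n) ^ 2 - 2 * n) + a₂ * (2 * n)
        + a₅ * ((LinearMap.trace ℝ V A) ^ 2 - LinearMap.trace ℝ V (A ∘ₗ A)
          - 2 * η (A ξ) * LinearMap.trace ℝ V A + 2 * g (A ξ) (A ξ))
        + a₆ * ((LinearMap.trace ℝ V (A ∘ₗ φ)) ^ 2
          - LinearMap.trace ℝ V ((A ∘ₗ φ) ∘ₗ (A ∘ₗ φ)))
        - (a₇ + a₈) * (LinearMap.trace ℝ V ((A ∘ₗ A) ∘ₗ φ)
          - LinearMap.trace ℝ V A * LinearMap.trace ℝ V (A ∘ₗ φ)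
          + η (A ξ) * LinearMap.trace ℝ V (A ∘ₗ φ) - g (φ (A ξ)) (A ξ)) := by
  have hL' : L = _ := funext fun x => funext fun y => funext fun z => funext fun u => hL x y z u
  rw [hL']
  simp only [scalarCurvature_add, scalarCurvature_smul]
  have hw := scalarCurvature_wedge e h.nondegenerate h.symm
  have e1 := hw (LinearMap.id - η.smulRight ξ) (LinearMap.id - η.smulRight ξ)
  have e2 := hw φ φ
  have e3 := hw (LinearMap.id - η.smulRight ξ) φ
  have e4 := hw φ (LinearMap.id - η.smulRight ξ)
  have e5 := hw ((LinearMap.id - η.smulRight ξ) ∘ₗ A) ((LinearMap.id - η.smulRight ξ) ∘ₗ A)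
  have e6 := hw (φ ∘ₗ A) (φ ∘ₗ A)
  have e7 := hw ((LinearMap.id - η.smulRight ξ) ∘ₗ A) (φ ∘ₗ A)
  have e8 := hw (φ ∘ₗ A) ((LinearMap.id - η.smulRight ξ) ∘ₗ A)
  rw [h.proj_comp_proj, h.trace_proj, hn] at e1
  rw [h.phi_sq, map_neg, h.trace_proj, hn, h.trace_phi] at e2
  rw [h.phi_comp_proj, h.trace_phi] at e3
  rw [h.proj_comp_phi, h.trace_phi] at e4
  rw [h.trace_proj_shape_sq, trace_proj_comp] at e5
  rw [trace_phi_shape_sq, LinearMap.trace_comp_comm' A φ] at e6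
  rw [h.trace_phi_shape_proj_shape, trace_proj_comp, LinearMap.trace_comp_comm' A φ] at e7
  rw [LinearMap.trace_comp_comm' (φ ∘ₗ A), h.trace_phi_shape_proj_shape, trace_proj_comp,
    LinearMap.trace_comp_comm' A φ] at e8
  rw [e1, e2, e3, e4, e5, e6, e7, e8]
  push_cast
  ring

/-- For `K̃` the coefficients of the wedge products are those of `K`, permuted as in
`proj_phi_right`, so that both scalar curvatures come from `scalarCurvature_eq`. -/
theorem scalarCurvature_curvature [FiniteDimensional ℝ V] (h : IsContactShape g φ A ξ η)
    (hL : ∀ x y z u, L x y z u = contactCurvature g φ A η ν νt c s x y z u)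
    (hn : Module.finrank ℝ V = 2 * n + 1) {a b : ℝ}
    (ha : a = (LinearMap.trace ℝ V A) ^ 2 - LinearMap.trace ℝ V (A ∘ₗ A)
      - (LinearMap.trace ℝ V (A ∘ₗ φ)) ^ 2 + LinearMap.trace ℝ V ((A ∘ₗ φ) ∘ₗ (A ∘ₗ φ))
      - 2 * η (A ξ) * LinearMap.trace ℝ V A + 2 * g (A ξ) (A ξ))
    (hb : b = LinearMap.trace ℝ V ((A ∘ₗ A) ∘ₗ φ)
      - LinearMap.trace ℝ V A * LinearMap.trace ℝ V (A ∘ₗ φ)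
      + η (A ξ) * LinearMap.trace ℝ V (A ∘ₗ φ) - g (φ (A ξ)) (A ξ)) :
    scalarCurvature e (fun x y => g x y) L
        = 4 * n * (n - 1) * ν - c * (a * c + 2 * b * s) ∧
      scalarCurvature e (fun x y => g x y) (fun x y z u => L x y z (φ u))
        = 4 * n * (n - 1) * νt - c * (a * s - 2 * b * c) := by
  have hw := h.eq_wedge hL
  have e1 := h.proj_phi_right LinearMap.id
  have e2 := h.phi_phi_right LinearMap.id
  simp only [LinearMap.comp_id] at e1 e2
  constructor
  · rw [h.scalarCurvature_eq e hw hn, ha, hb]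
    ring
  · rw [h.scalarCurvature_eq e (L := fun x y z u => L x y z (φ u)) (a₁ := νt) (a₂ := -νt) (a₃ := ν)
      (a₄ := ν) (a₅ := -(c * s)) (a₆ := c * s) (a₇ := -c ^ 2) (a₈ := -c ^ 2) ?_ hn, ha, hb]
    · ring
    · intro x y z u
      simp only [hw, wedge, h.proj_phi_right A, h.phi_phi_right A, e1, e2]
      ring

end Scalar

end IsContactShape

end AlmostContact

/-! ### Immersed hypersurfaces: regularity, and the projection to the contact distribution -/

section Immersions

variable {E : Type*} [NormedAddCommGroup E] [NormedSpace ℝ E] [FiniteDimensional ℝ E]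
  {M : Type*} [TopologicalSpace M] [ChartedSpace E M] [IsManifold 𝓘(ℝ, E) ∞ M]
  {E' : Type*} [NormedAddCommGroup E'] [NormedSpace ℝ E'] [FiniteDimensional ℝ E']
  {M' : Type*} [TopologicalSpace M'] [ChartedSpace E' M'] [IsManifold 𝓘(ℝ, E') ∞ M']
  {f : M → M'} {q : M}

/-- Regularity of a family of linear maps can be tested on vectors, in finite dimensions. -/
theorem contMDiffAt_clm_of_apply {B : M → E →L[ℝ] E'} {k : ℕ}
    (h : ∀ v, ContMDiffAt 𝓘(ℝ, E) 𝓘(ℝ, E') k (fun p => B p v) q) :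
    ContMDiffAt 𝓘(ℝ, E) 𝓘(ℝ, E →L[ℝ] E') k B q := by
  let b := Module.finBasis ℝ E
  have h1 : B = fun p => ∑ i, ContinuousLinearMap.smulRightL ℝ E E'
      (LinearMap.toContinuousLinearMap (b.coord i)) (B p (b i)) := by
    ext p v
    have h2 : B p v = ∑ i, b.repr v i • B p (b i) := by
      conv_lhs => rw [← b.sum_repr v, map_sum]
      simp only [map_smul]
    rw [h2]
    simp
  rw [h1]
  exact ContMDiffAt.sum fun i _ =>
    (ContinuousLinearMap.smulRightL ℝ E E'
      (LinearMap.toContinuousLinearMap (b.coord i))).contMDiff.contMDiffAt.comp q (h (b i))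

/-- A vector field is as regular as its image under the differential of an immersion. -/
theorem ContAlongAt.of_mfderiv_apply {k : ℕ} (hf : ContMDiff 𝓘(ℝ, E) 𝓘(ℝ, E') ∞ f)
    (hinj : Function.Injective (mfderiv 𝓘(ℝ, E) 𝓘(ℝ, E') f q))
    {W : Π p : M, TangentSpace 𝓘(ℝ, E) p}
    (hW : ContAlongAt E k f (fun p => mfderiv 𝓘(ℝ, E) 𝓘(ℝ, E') f p (W p)) q) :
    ContAlongAt E k id W q := by
  have hq : f q ∈ (chartAt E' (f q)).source := mem_chart_source E' (f q)
  have hqM : q ∈ (chartAt E q).source := mem_chart_source E q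
  -- the differential of `f` in charts, and a left inverse of it at `q`
  let B : M → E →L[ℝ] E' := fun p =>
    (mvfderiv 𝓘(ℝ, E) (fun p => extChartAt 𝓘(ℝ, E') (f q) (f p)) p).comp (coordSymm q p)
  have hBdef (p : M) (v : E) : B p v
      = mvfderiv 𝓘(ℝ, E) (fun p => extChartAt 𝓘(ℝ, E') (f q) (f p)) p (coordSymm q p v) := rfl
  have hB : ContMDiffAt 𝓘(ℝ, E) 𝓘(ℝ, E →L[ℝ] E') k B q :=
    contMDiffAt_clm_of_apply fun v => contMDiffAt_mvfderiv_apply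
      (contMDiffAt_chart_comp hf hq (k + 1)) (contAlongAt_coordSymm hqM v k)
  have hBinj : Function.Injective (B q) := by
    intro v w hvw
    rw [hBdef, hBdef, ← coord_mfderiv (mdifferentiableAt_of_smooth hf q) hq,
      ← coord_mfderiv (mdifferentiableAt_of_smooth hf q) hq] at hvw
    have h1 := hinj (coord_injective hq hvw)
    rw [← coord_coordSymm hqM v, h1, coord_coordSymm hqM]
  let L : E' →L[ℝ] E := LinearMap.toContinuousLinearMap (B q).toLinearMap.leftInverse
  have hL (v : E) : L (B q v) = v :=
    LinearMap.leftInverse_apply_of_inj (LinearMap.ker_eq_bot.2 hBinj) v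
  have hLB : ContMDiffAt 𝓘(ℝ, E) 𝓘(ℝ, E →L[ℝ] E) k (fun p => L.comp (B p)) q :=
    ((ContinuousLinearMap.compL ℝ E E' E L).contMDiff.contMDiffAt).comp q hB
  have hLBq : L.comp (B q) = ContinuousLinearEquiv.refl ℝ E := by
    ext v; exact hL v
  have hinv : ContMDiffAt 𝓘(ℝ, E) 𝓘(ℝ, E →L[ℝ] E) k (fun p => (L.comp (B p)).inverse) q := by
    have h1 := contDiffAt_map_inverse (n := (k : ℕ∞ω)) (ContinuousLinearEquiv.refl ℝ E)
    rw [← hLBq] at h1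
    exact ContMDiffAt.comp (g := ContinuousLinearMap.inverse (R := ℝ) (M := E) (M₂ := E)) q
      h1.contMDiffAt hLB
  have hev : ∀ᶠ p in 𝓝 q, (L.comp (B p)).IsInvertible := by
    have h1 := ContinuousLinearEquiv.nhds (ContinuousLinearEquiv.refl ℝ E)
    rw [← hLBq] at h1
    exact hLB.continuousAt h1
  have hWc := hW.contMDiffAt_coord hf hq
  have hLW : ContMDiffAt 𝓘(ℝ, E) 𝓘(ℝ, E) k (fun p => L (coord (f q) (f p)
      (mfderiv 𝓘(ℝ, E) 𝓘(ℝ, E') f p (W p)))) q :=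
    L.contMDiff.contMDiffAt.comp q hWc
  rw [contAlongAt_iff (f := id) hqM contMDiffAt_id]
  refine (hinv.clm_apply hLW).congr_of_eventuallyEq ?_
  filter_upwards [hev, eventually_mem_chart_source hf hq,
    (chartAt E q).open_source.mem_nhds hqM] with p hp hs hpM
  have h2 : L (coord (f q) (f p) (mfderiv 𝓘(ℝ, E) 𝓘(ℝ, E') f p (W p)))
      = (L.comp (B p)) (coord q p (W p)) := by
    rw [ContinuousLinearMap.comp_apply, hBdef, coordSymm_coord hpM,
      coord_mfderiv (mdifferentiableAt_of_smooth hf p) hs]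
  rw [h2, hp.inverse_apply_self]
  rfl

end Immersions

section PointwiseHypersurface

variable {E : Type*} [NormedAddCommGroup E] [NormedSpace ℝ E] [FiniteDimensional ℝ E]
  {M : Type*} [TopologicalSpace M] [ChartedSpace E M] [IsManifold 𝓘(ℝ, E) ∞ M]
  {E' : Type*} [NormedAddCommGroup E'] [NormedSpace ℝ E'] [FiniteDimensional ℝ E']
  {M' : Type*} [TopologicalSpace M'] [ChartedSpace E' M'] [IsManifold 𝓘(ℝ, E') ∞ M']
  {J : Π p : M', TangentSpace 𝓘(ℝ, E') p →L[ℝ] TangentSpace 𝓘(ℝ, E') p}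
  {g' : Π p : M', TangentSpace 𝓘(ℝ, E') p →L[ℝ] TangentSpace 𝓘(ℝ, E') p →L[ℝ] ℝ}
  {nabla' : CovariantDerivative 𝓘(ℝ, E') E' (TangentSpace 𝓘(ℝ, E') : M' → Type _)}
  {f : M → M'} {N : Π p : M, TangentSpace 𝓘(ℝ, E') (f p)}

variable (E J g' nabla' f N) in
/-- `f` is a time-like immersed hypersurface, with unit normal `N`, of a Kähler manifold with Norden
metric. -/
structure IsKaehlerHypersurface : Prop where
  kaehler : IsKaehlerNorden J g' nabla'
  immersion : IsTimelikeImmersion (I := 𝓘(ℝ, E)) g' f N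
  finrank_eq : Module.finrank ℝ E' = Module.finrank ℝ E + 1

theorem IsKaehlerHypersurface.hyperplane (h : IsKaehlerHypersurface E J g' nabla' f N) (p : M) :
    IsTimelikeHyperplane (ContinuousLinearMap.toLinearMap₁₂ (g' (f p))) (J (f p)).toLinearMap (N p)
      (mfderiv 𝓘(ℝ, E) 𝓘(ℝ, E') f p).toLinearMap
      (Real.cos (angle J g' f N p)) (Real.sin (angle J g' f N p)) where
  symm := h.kaehler.almost_complex.symm (f p)
  nondegenerate := h.kaehler.almost_complex.nondegenerate (f p)
  sq := h.kaehler.almost_complex.sq (f p)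
  norden := h.kaehler.almost_complex.norden (f p)
  injective := h.immersion.immersion p
  normal := h.immersion.normal p
  unit := h.immersion.timelike_unit p
  finrank_eq := h.finrank_eq
  cos_sq_add_sin_sq := Real.cos_sq_add_sin_sq _
  sin_eq := by
    unfold angle
    rw [Real.sin_arctan, Real.cos_arctan, one_div, div_eq_inv_mul]
    rfl

variable (J g' f N) in
/-- The vector field `sin t · N + cos t · JN` along the immersion; it is tangent, and it is the
image of `ξ`. -/
def reeb (p : M) : TangentSpace 𝓘(ℝ, E') (f p) :=
  Real.sin (angle J g' f N p) • N p + Real.cos (angle J g' f N p) • J (f p) (N p)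

variable (J g' f N) in
/-- The orthogonal projection of the ambient tangent space at `f p` along the normal `N` and `JN`,
which is also the projection along `N` and `ξ` onto the contact distribution `ker η`. -/
def proj (p : M) : TangentSpace 𝓘(ℝ, E') (f p) →ₗ[ℝ] TangentSpace 𝓘(ℝ, E') (f p) :=
  contactProj (ContinuousLinearMap.toLinearMap₁₂ (g' (f p))) (J (f p)).toLinearMap (N p)
    (Real.cos (angle J g' f N p)) (Real.sin (angle J g' f N p))

namespace IsKaehlerHypersurface

theorem almost_complex (h : IsKaehlerHypersurface E J g' nabla' f N) : IsAlmostComplexNorden J g' :=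
  h.kaehler.almost_complex

theorem levi_civita (h : IsKaehlerHypersurface E J g' nabla' f N) :
    IsLeviCivita (fun p x y => g' p x y) nabla' :=
  h.kaehler.levi_civita

theorem smooth (h : IsKaehlerHypersurface E J g' nabla' f N) :
    ContMDiff 𝓘(ℝ, E) 𝓘(ℝ, E') ∞ f :=
  h.immersion.smooth

variable {p q : M} {V : Π p : M, TangentSpace 𝓘(ℝ, E') (f p)}

theorem proj_normal (h : IsKaehlerHypersurface E J g' nabla' f N) : proj J g' f N p (N p) = 0 :=
  (h.hyperplane p).contactProj_normal

theorem proj_structure_normal (h : IsKaehlerHypersurface E J g' nabla' f N) :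
    proj J g' f N p (J (f p) (N p)) = 0 :=
  (h.hyperplane p).contactProj_structure_normal

theorem proj_reeb (h : IsKaehlerHypersurface E J g' nabla' f N) :
    proj J g' f N p (reeb J g' f N p) = 0 :=
  (h.hyperplane p).contactProj_reeb

theorem proj_proj (h : IsKaehlerHypersurface E J g' nabla' f N) (w : TangentSpace 𝓘(ℝ, E') (f p)) :
    proj J g' f N p (proj J g' f N p w) = proj J g' f N p w :=
  (h.hyperplane p).contactProj_contactProj w

theorem proj_structure (h : IsKaehlerHypersurface E J g' nabla' f N)
    (w : TangentSpace 𝓘(ℝ, E') (f p)) :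
    proj J g' f N p (J (f p) w) = J (f p) (proj J g' f N p w) :=
  (h.hyperplane p).contactProj_structure w

theorem proj_symm (h : IsKaehlerHypersurface E J g' nabla' f N)
    (v w : TangentSpace 𝓘(ℝ, E') (f p)) :
    g' (f p) (proj J g' f N p v) w = g' (f p) v (proj J g' f N p w) :=
  (h.hyperplane p).contactProj_symm v w

theorem metric_proj_normal (h : IsKaehlerHypersurface E J g' nabla' f N)
    (w : TangentSpace 𝓘(ℝ, E') (f p)) : g' (f p) (proj J g' f N p w) (N p) = 0 :=
  (h.hyperplane p).contactProj_normal_right w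

theorem metric_proj_structure_normal (h : IsKaehlerHypersurface E J g' nabla' f N)
    (w : TangentSpace 𝓘(ℝ, E') (f p)) : g' (f p) (proj J g' f N p w) (J (f p) (N p)) = 0 :=
  (h.hyperplane p).contactProj_structure_normal_right w

theorem metric_proj_reeb (h : IsKaehlerHypersurface E J g' nabla' f N)
    (w : TangentSpace 𝓘(ℝ, E') (f p)) : g' (f p) (proj J g' f N p w) (reeb J g' f N p) = 0 := by
  rw [h.proj_symm, h.proj_reeb, map_zero]

theorem structure_symm (h : IsKaehlerHypersurface E J g' nabla' f N)
    (v w : TangentSpace 𝓘(ℝ, E') (f p)) : g' (f p) (J (f p) v) w = g' (f p) v (J (f p) w) :=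
  (h.hyperplane p).structure_symm v w

theorem reeb_normal (h : IsKaehlerHypersurface E J g' nabla' f N) :
    g' (f p) (reeb J g' f N p) (N p) = 0 :=
  (h.hyperplane p).reeb_normal

theorem reeb_unit (h : IsKaehlerHypersurface E J g' nabla' f N) :
    g' (f p) (reeb J g' f N p) (reeb J g' f N p) = 1 :=
  (h.hyperplane p).reeb_unit

theorem mfderiv_normal (h : IsKaehlerHypersurface E J g' nabla' f N) (x : TangentSpace 𝓘(ℝ, E) p) :
    g' (f p) (mfderiv 𝓘(ℝ, E) 𝓘(ℝ, E') f p x) (N p) = 0 := by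
  rw [h.almost_complex.symm, h.immersion.normal]

theorem eta_eq (h : IsKaehlerHypersurface E J g' nabla' f N) (x : TangentSpace 𝓘(ℝ, E) p) :
    eta J g' f N 𝓘(ℝ, E) p x
      = g' (f p) (mfderiv 𝓘(ℝ, E) 𝓘(ℝ, E') f p x) (reeb J g' f N p) := by
  rw [h.almost_complex.symm]
  exact ((h.hyperplane p).reeb_range x).symm

/-- The decomposition of the tangent space into the contact distribution and the line of `ξ`. -/
theorem mfderiv_eq_proj_add (h : IsKaehlerHypersurface E J g' nabla' f N)
    (x : TangentSpace 𝓘(ℝ, E) p) :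
    mfderiv 𝓘(ℝ, E) 𝓘(ℝ, E') f p x
      = proj J g' f N p (mfderiv 𝓘(ℝ, E) 𝓘(ℝ, E') f p x)
        + eta J g' f N 𝓘(ℝ, E) p x • reeb J g' f N p := by
  rw [eq_comm, ← eq_sub_iff_add_eq]
  exact (h.hyperplane p).contactProj_range x

theorem toTangent_mfderiv (h : IsKaehlerHypersurface E J g' nabla' f N) (x : TangentSpace 𝓘(ℝ, E) p) :
    toTangent 𝓘(ℝ, E) 𝓘(ℝ, E') f p (mfderiv 𝓘(ℝ, E) 𝓘(ℝ, E') f p x) = x :=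
  LinearMap.leftInverse_apply_of_inj (LinearMap.ker_eq_bot.2 (h.immersion.immersion p)) x

theorem mfderiv_toTangent (h : IsKaehlerHypersurface E J g' nabla' f N)
    {w : TangentSpace 𝓘(ℝ, E') (f p)} (hw : g' (f p) w (N p) = 0) :
    mfderiv 𝓘(ℝ, E) 𝓘(ℝ, E') f p (toTangent 𝓘(ℝ, E) 𝓘(ℝ, E') f p w) = w := by
  have := finiteDimensional_tangentSpace (E' := E') (f p)
  have := finiteDimensional_tangentSpace (E' := E) p
  obtain ⟨x, rfl⟩ := (h.hyperplane p).mem_range hw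
  exact congrArg (mfderiv 𝓘(ℝ, E) 𝓘(ℝ, E') f p) (h.toTangent_mfderiv x)

theorem eq_of_orthogonal (h : IsKaehlerHypersurface E J g' nabla' f N)
    {w : TangentSpace 𝓘(ℝ, E') (f p)}
    (hw : ∀ x, g' (f p) w (mfderiv 𝓘(ℝ, E) 𝓘(ℝ, E') f p x) = 0) :
    w + g' (f p) w (N p) • N p = 0 := by
  have := finiteDimensional_tangentSpace (E' := E') (f p)
  have := finiteDimensional_tangentSpace (E' := E) p
  exact (h.hyperplane p).eq_of_orthogonal hw

theorem mfderiv_xi (h : IsKaehlerHypersurface E J g' nabla' f N) :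
    mfderiv 𝓘(ℝ, E) 𝓘(ℝ, E') f p (xi J g' f N 𝓘(ℝ, E) p) = reeb J g' f N p :=
  h.mfderiv_toTangent h.reeb_normal

/-- `φ` is the restriction of `J` to the contact distribution. -/
theorem mfderiv_phi (h : IsKaehlerHypersurface E J g' nabla' f N) (x : TangentSpace 𝓘(ℝ, E) p) :
    mfderiv 𝓘(ℝ, E) 𝓘(ℝ, E') f p (phi J g' f N 𝓘(ℝ, E) p x)
      = J (f p) (proj J g' f N p (mfderiv 𝓘(ℝ, E) 𝓘(ℝ, E') f p x)) := by
  have h1 : J (f p) (mfderiv 𝓘(ℝ, E) 𝓘(ℝ, E') f p x) + eta J g' f N 𝓘(ℝ, E) p x •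
        (Real.cos (angle J g' f N p) • N p - Real.sin (angle J g' f N p) • J (f p) (N p))
      = J (f p) (proj J g' f N p (mfderiv 𝓘(ℝ, E) 𝓘(ℝ, E') f p x)) := by
    conv_lhs => rw [h.mfderiv_eq_proj_add x]
    rw [map_add, map_smul, reeb, map_add, map_smul, map_smul, h.almost_complex.sq]
    module
  rw [← h1]
  refine h.mfderiv_toTangent ?_
  have h2 := h.metric_proj_structure_normal (p := p) (mfderiv 𝓘(ℝ, E) 𝓘(ℝ, E') f p x)
  rw [← h.structure_symm, ← h1] at h2
  exact h2

theorem eta_mfderiv_phi (h : IsKaehlerHypersurface E J g' nabla' f N)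
    (x : TangentSpace 𝓘(ℝ, E) p) : eta J g' f N 𝓘(ℝ, E) p (phi J g' f N 𝓘(ℝ, E) p x) = 0 := by
  rw [h.eta_eq, h.mfderiv_phi, ← h.proj_structure, h.metric_proj_reeb]

theorem contAlongAt_normal (h : IsKaehlerHypersurface E J g' nabla' f N) (q : M) (k : ℕ) :
    ContAlongAt E k f N q :=
  (h.immersion.smooth_normal q).of_le (by exact_mod_cast (le_top : ((k : ℕ) : ℕ∞) ≤ ⊤))

theorem contMDiffAt_angle (h : IsKaehlerHypersurface E J g' nabla' f N) (q : M) (k : ℕ) :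
    ContMDiffAt 𝓘(ℝ, E) 𝓘(ℝ, ℝ) k (angle J g' f N) q :=
  (Real.contDiff_arctan.contMDiff.contMDiffAt).comp q
    ((h.contAlongAt_normal q k).metric h.almost_complex h.smooth
      ((h.contAlongAt_normal q k).structure h.almost_complex h.smooth))

theorem contMDiffAt_cos_angle (h : IsKaehlerHypersurface E J g' nabla' f N) (q : M) (k : ℕ) :
    ContMDiffAt 𝓘(ℝ, E) 𝓘(ℝ, ℝ) k (fun p => Real.cos (angle J g' f N p)) q :=
  (Real.contDiff_cos.contMDiff.contMDiffAt).comp q (h.contMDiffAt_angle q k)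

theorem contMDiffAt_sin_angle (h : IsKaehlerHypersurface E J g' nabla' f N) (q : M) (k : ℕ) :
    ContMDiffAt 𝓘(ℝ, E) 𝓘(ℝ, ℝ) k (fun p => Real.sin (angle J g' f N p)) q :=
  (Real.contDiff_sin.contMDiff.contMDiffAt).comp q (h.contMDiffAt_angle q k)

theorem contAlongAt_reeb (h : IsKaehlerHypersurface E J g' nabla' f N) (q : M) (k : ℕ) :
    ContAlongAt E k f (reeb J g' f N) q :=
  ((h.contAlongAt_normal q k).smul h.smooth (h.contMDiffAt_sin_angle q k)).add h.smooth
    (((h.contAlongAt_normal q k).structure h.almost_complex h.smooth).smul h.smooth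
      (h.contMDiffAt_cos_angle q k))

variable (J g' f N) in
/-- The coefficient of `N` in `w - proj w`. -/
def normalCoeff (p : M) (w : TangentSpace 𝓘(ℝ, E') (f p)) : ℝ :=
  Real.cos (angle J g' f N p) * Real.sin (angle J g' f N p) * g' (f p) w (J (f p) (N p))
    - Real.cos (angle J g' f N p) ^ 2 * g' (f p) w (N p)

variable (J g' f N) in
/-- The coefficient of `JN` in `w - proj w`. -/
def structureNormalCoeff (p : M) (w : TangentSpace 𝓘(ℝ, E') (f p)) : ℝ :=
  Real.cos (angle J g' f N p) ^ 2 * g' (f p) w (J (f p) (N p))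
    + Real.cos (angle J g' f N p) * Real.sin (angle J g' f N p) * g' (f p) w (N p)

theorem proj_eq (p : M) (w : TangentSpace 𝓘(ℝ, E') (f p)) :
    proj J g' f N p w = w - normalCoeff J g' f N p w • N p
      - structureNormalCoeff J g' f N p w • J (f p) (N p) :=
  contactProj_apply _ _ _ _ _ w

theorem contMDiffAt_normalCoeff {k : ℕ} (h : IsKaehlerHypersurface E J g' nabla' f N)
    (hV : ContAlongAt E k f V q) :
    ContMDiffAt 𝓘(ℝ, E) 𝓘(ℝ, ℝ) k (fun p => normalCoeff J g' f N p (V p)) q := by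
  have hN := h.contAlongAt_normal q k
  have hc := h.contMDiffAt_cos_angle q k
  exact ((hc.mul (h.contMDiffAt_sin_angle q k)).mul (hV.metric h.almost_complex h.smooth
    (hN.structure h.almost_complex h.smooth))).sub
      ((hc.pow 2).mul (hV.metric h.almost_complex h.smooth hN))

theorem contMDiffAt_structureNormalCoeff {k : ℕ} (h : IsKaehlerHypersurface E J g' nabla' f N)
    (hV : ContAlongAt E k f V q) :
    ContMDiffAt 𝓘(ℝ, E) 𝓘(ℝ, ℝ) k (fun p => structureNormalCoeff J g' f N p (V p)) q := by
  have hN := h.contAlongAt_normal q k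
  have hc := h.contMDiffAt_cos_angle q k
  exact ((hc.pow 2).mul (hV.metric h.almost_complex h.smooth
    (hN.structure h.almost_complex h.smooth))).add
      ((hc.mul (h.contMDiffAt_sin_angle q k)).mul (hV.metric h.almost_complex h.smooth hN))

theorem contAlongAt_proj {k : ℕ} (h : IsKaehlerHypersurface E J g' nabla' f N)
    (hV : ContAlongAt E k f V q) : ContAlongAt E k f (fun p => proj J g' f N p (V p)) q := by
  have hN := h.contAlongAt_normal q k
  simp only [proj_eq]
  exact (hV.sub h.smooth (hN.smul h.smooth (h.contMDiffAt_normalCoeff hV))).sub h.smooth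
    ((hN.structure h.almost_complex h.smooth).smul h.smooth
      (h.contMDiffAt_structureNormalCoeff hV))

theorem contMDiffAt_eta {k : ℕ} (h : IsKaehlerHypersurface E J g' nabla' f N)
    {W : Π p : M, TangentSpace 𝓘(ℝ, E) p} (hW : ContAlongAt E k id W q) :
    ContMDiffAt 𝓘(ℝ, E) 𝓘(ℝ, ℝ) k (fun p => eta J g' f N 𝓘(ℝ, E) p (W p)) q := by
  simp only [h.eta_eq]
  exact (hW.mfderiv_apply h.smooth).metric h.almost_complex h.smooth (h.contAlongAt_reeb q k)

/-- `∇'` commutes with the projection to the contact distribution, up to the shape operator. -/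
theorem proj_covAlong_proj (h : IsKaehlerHypersurface E J g' nabla' f N)
    (hV : ContAlongAt E (1 : ℕ) f V q) (x : TangentSpace 𝓘(ℝ, E) q) :
    proj J g' f N q (covAlong nabla' f (fun p => proj J g' f N p (V p)) q x)
      = proj J g' f N q (covAlong nabla' f V q x)
        - normalCoeff J g' f N q (V q) • proj J g' f N q (covAlong nabla' f N q x)
        - structureNormalCoeff J g' f N q (V q)
            • J (f q) (proj J g' f N q (covAlong nabla' f N q x)) := by
  have hA := h.almost_complex
  have hL := h.levi_civita
  have hN := h.contAlongAt_normal q 1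
  have hJN := hN.structure hA h.smooth
  have ha := h.contMDiffAt_normalCoeff hV
  have hb := h.contMDiffAt_structureNormalCoeff hV
  have hp : (fun p => proj J g' f N p (V p)) = fun p => V p - normalCoeff J g' f N p (V p) • N p
      - structureNormalCoeff J g' f N p (V p) • J (f p) (N p) := funext fun p => proj_eq p (V p)
  rw [hp, covAlong_sub hA hL h.smooth (hV.sub h.smooth (hN.smul h.smooth ha)) (hJN.smul h.smooth hb),
    covAlong_sub hA hL h.smooth hV (hN.smul h.smooth ha), covAlong_smul hA hL h.smooth ha hN,
    covAlong_smul hA hL h.smooth hb hJN, covAlong_structure h.kaehler h.smooth hN]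
  simp only [map_sub, map_add, map_smul, h.proj_normal, h.proj_structure_normal, h.proj_structure]
  module

end IsKaehlerHypersurface

end PointwiseHypersurface

/-! ### The Gauss and Weingarten formulas, and the canonical connection -/

section HypersurfaceConnections

variable {E : Type*} [NormedAddCommGroup E] [NormedSpace ℝ E] [FiniteDimensional ℝ E]
  {M : Type*} [TopologicalSpace M] [ChartedSpace E M] [IsManifold 𝓘(ℝ, E) ∞ M]
  {E' : Type*} [NormedAddCommGroup E'] [NormedSpace ℝ E'] [FiniteDimensional ℝ E']
  {M' : Type*} [TopologicalSpace M'] [ChartedSpace E' M'] [IsManifold 𝓘(ℝ, E') ∞ M']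
  {J : Π p : M', TangentSpace 𝓘(ℝ, E') p →L[ℝ] TangentSpace 𝓘(ℝ, E') p}
  {g' : Π p : M', TangentSpace 𝓘(ℝ, E') p →L[ℝ] TangentSpace 𝓘(ℝ, E') p →L[ℝ] ℝ}
  {nabla' : CovariantDerivative 𝓘(ℝ, E') E' (TangentSpace 𝓘(ℝ, E') : M' → Type _)}
  {f : M → M'} {N : Π p : M, TangentSpace 𝓘(ℝ, E') (f p)}
  {nabla : CovariantDerivative 𝓘(ℝ, E) E (TangentSpace 𝓘(ℝ, E) : M → Type _)}
  {q : M} {W : Π p : M, TangentSpace 𝓘(ℝ, E) p}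

namespace IsKaehlerHypersurface

/-- The Weingarten formula. -/
theorem mfderiv_shapeOperator (h : IsKaehlerHypersurface E J g' nabla' f N)
    (x : TangentSpace 𝓘(ℝ, E) q) :
    mfderiv 𝓘(ℝ, E) 𝓘(ℝ, E') f q (shapeOperator nabla' f N q x) = -covAlong nabla' f N q x := by
  have hN := h.contAlongAt_normal q 1
  have h1 := mvfderiv_metric_along h.almost_complex h.levi_civita h.smooth hN hN x
  have h2 : (fun p => g' (f p) (N p) (N p)) = fun _ => (-1 : ℝ) :=
    funext h.immersion.timelike_unit
  rw [h2, mvfderiv_const, h.almost_complex.symm (f q) (N q)] at h1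
  have h3 : g' (f q) (covAlong nabla' f N q x) (N q) = 0 := by
    have h4 : (0 : TangentSpace 𝓘(ℝ, E) q →L[ℝ] ℝ) x = 0 := rfl
    rw [h4] at h1
    linarith
  change mfderiv 𝓘(ℝ, E) 𝓘(ℝ, E') f q
    (-(toTangent 𝓘(ℝ, E) 𝓘(ℝ, E') f q (covAlong nabla' f N q x))) = _
  rw [map_neg, h.mfderiv_toTangent h3]

/-- The Gauss formula, tested against tangent vectors: by the usual permutation argument the
tangential part of `∇'` and the Levi-Civita connection of the induced metric agree. -/
theorem metric_covAlong_mfderiv (h : IsKaehlerHypersurface E J g' nabla' f N)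
    (hnabla : IsLeviCivita (inducedMetric (I := 𝓘(ℝ, E)) g' f) nabla)
    (hW : ContAlongAt E (1 : ℕ) id W q) (x z : TangentSpace 𝓘(ℝ, E) q) :
    g' (f q) (covAlong nabla' f (fun p => mfderiv 𝓘(ℝ, E) 𝓘(ℝ, E') f p (W p)) q x
        - mfderiv 𝓘(ℝ, E) 𝓘(ℝ, E') f q (nabla W q x)) (mfderiv 𝓘(ℝ, E) 𝓘(ℝ, E') f q z) = 0 := by
  have hA := h.almost_complex
  have hL := h.levi_civita
  have hs := h.smooth
  -- the difference tensor, which is symmetric in `X, Y` and skew in `Y, Z`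
  set S : (X Y Z : Π p : M, TangentSpace 𝓘(ℝ, E) p) → ℝ := fun X Y Z =>
    g' (f q) (covAlong nabla' f (fun p => mfderiv 𝓘(ℝ, E) 𝓘(ℝ, E') f p (Y p)) q (X q)
        - mfderiv 𝓘(ℝ, E) 𝓘(ℝ, E') f q (nabla Y q (X q)))
      (mfderiv 𝓘(ℝ, E) 𝓘(ℝ, E') f q (Z q)) with hS
  have hsymm {X Y : Π p : M, TangentSpace 𝓘(ℝ, E) p} (hX : ContAlongAt E (1 : ℕ) id X q)
      (hY : ContAlongAt E (1 : ℕ) id Y q) (Z : Π p : M, TangentSpace 𝓘(ℝ, E) p) :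
      S X Y Z = S Y X Z := by
    have h1 := covAlong_mfderiv_comm hA hL hs hX hY
    have h2 := hnabla.nabla_sub_nabla (hX.diffAlongAt one_ne_zero) (hY.diffAlongAt one_ne_zero)
    rw [← h2, map_sub] at h1
    have h3 : covAlong nabla' f (fun p => mfderiv 𝓘(ℝ, E) 𝓘(ℝ, E') f p (Y p)) q (X q)
          - mfderiv 𝓘(ℝ, E) 𝓘(ℝ, E') f q (nabla Y q (X q))
        = covAlong nabla' f (fun p => mfderiv 𝓘(ℝ, E) 𝓘(ℝ, E') f p (X p)) q (Y q)
          - mfderiv 𝓘(ℝ, E) 𝓘(ℝ, E') f q (nabla X q (Y q)) := by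
      rw [sub_eq_sub_iff_add_eq_add] at h1 ⊢
      rw [h1, add_comm]
    simp only [hS, h3]
  have hskew {Y Z : Π p : M, TangentSpace 𝓘(ℝ, E) p} (X : Π p : M, TangentSpace 𝓘(ℝ, E) p)
      (hY : ContAlongAt E (1 : ℕ) id Y q) (hZ : ContAlongAt E (1 : ℕ) id Z q) :
      S X Y Z = -S X Z Y := by
    have h1 := mvfderiv_metric_along hA hL hs (hY.mfderiv_apply hs) (hZ.mfderiv_apply hs) (X q)
    have h2 := hnabla.metric Y Z q (X q) (hY.diffAlongAt one_ne_zero) (hZ.diffAlongAt one_ne_zero)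
    have h3 := h1.symm.trans h2
    simp only [inducedMetric] at h3
    simp only [hS, map_sub, sub_apply]
    rw [hA.symm (f q) (mfderiv 𝓘(ℝ, E) 𝓘(ℝ, E') f q (Y q)),
      hA.symm (f q) (mfderiv 𝓘(ℝ, E) 𝓘(ℝ, E') f q (Y q))] at h3
    linarith
  have hX := contAlongAt_frameField q x 1
  have hZ := contAlongAt_frameField q z 1
  have h1 : S (frameField q x) W (frameField q z) = 0 := by
    linarith [hsymm hX hW (frameField q z), hskew W hX hZ, hsymm hW hZ (frameField q x),
      hskew (frameField q z) hW hX, hsymm hZ hX W, hskew (frameField q x) hZ hW]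
  simpa only [hS, frameField_self] using h1

/-- The Gauss formula. -/
theorem mfderiv_nabla (h : IsKaehlerHypersurface E J g' nabla' f N)
    (hnabla : IsLeviCivita (inducedMetric (I := 𝓘(ℝ, E)) g' f) nabla)
    (hW : ContAlongAt E (1 : ℕ) id W q) (x : TangentSpace 𝓘(ℝ, E) q) :
    mfderiv 𝓘(ℝ, E) 𝓘(ℝ, E') f q (nabla W q x)
      = covAlong nabla' f (fun p => mfderiv 𝓘(ℝ, E) 𝓘(ℝ, E') f p (W p)) q x
        + g' (f q) (covAlong nabla' f (fun p => mfderiv 𝓘(ℝ, E) 𝓘(ℝ, E') f p (W p)) q x) (N q)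
          • N q := by
  have h1 := h.eq_of_orthogonal (h.metric_covAlong_mfderiv hnabla hW x)
  rw [map_sub, sub_apply, h.mfderiv_normal, sub_zero, sub_add_eq_add_sub, sub_eq_zero] at h1
  exact h1.symm

theorem proj_mfderiv_nabla (h : IsKaehlerHypersurface E J g' nabla' f N)
    (hnabla : IsLeviCivita (inducedMetric (I := 𝓘(ℝ, E)) g' f) nabla)
    (hW : ContAlongAt E (1 : ℕ) id W q) (x : TangentSpace 𝓘(ℝ, E) q) :
    proj J g' f N q (mfderiv 𝓘(ℝ, E) 𝓘(ℝ, E') f q (nabla W q x))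
      = proj J g' f N q
        (covAlong nabla' f (fun p => mfderiv 𝓘(ℝ, E) 𝓘(ℝ, E') f p (W p)) q x) := by
  rw [h.mfderiv_nabla hnabla hW, map_add, map_smul, h.proj_normal, smul_zero, add_zero]

theorem eta_nabla (h : IsKaehlerHypersurface E J g' nabla' f N)
    (hnabla : IsLeviCivita (inducedMetric (I := 𝓘(ℝ, E)) g' f) nabla)
    (hW : ContAlongAt E (1 : ℕ) id W q) (x : TangentSpace 𝓘(ℝ, E) q) :
    eta J g' f N 𝓘(ℝ, E) q (nabla W q x)
      = g' (f q) (covAlong nabla' f (fun p => mfderiv 𝓘(ℝ, E) 𝓘(ℝ, E') f p (W p)) q x)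
        (reeb J g' f N q) := by
  rw [h.eta_eq, h.mfderiv_nabla hnabla hW, map_add, map_smul, add_apply, smul_apply,
    h.almost_complex.symm (f q) (N q), h.reeb_normal, smul_zero, add_zero]

theorem metric_covAlong_reeb (h : IsKaehlerHypersurface E J g' nabla' f N)
    (x : TangentSpace 𝓘(ℝ, E) q) :
    g' (f q) (covAlong nabla' f (reeb J g' f N) q x) (reeb J g' f N q) = 0 := by
  have hr := h.contAlongAt_reeb q 1
  have h1 := mvfderiv_metric_along h.almost_complex h.levi_civita h.smooth hr hr x
  have h2 : (fun p => g' (f p) (reeb J g' f N p) (reeb J g' f N p)) = fun _ => (1 : ℝ) :=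
    funext fun p => h.reeb_unit
  rw [h2, mvfderiv_const, h.almost_complex.symm (f q) (reeb J g' f N q)] at h1
  have h4 : (0 : TangentSpace 𝓘(ℝ, E) q →L[ℝ] ℝ) x = 0 := rfl
  rw [h4] at h1
  linarith

/-- The canonical connection is induced by `∇'` on the contact distribution `ker η`, and it makes
`ξ` parallel. -/
theorem mfderiv_canonicalConnection (h : IsKaehlerHypersurface E J g' nabla' f N)
    (hnabla : IsLeviCivita (inducedMetric (I := 𝓘(ℝ, E)) g' f) nabla)
    (hW : ContAlongAt E (1 : ℕ) id W q) (x : TangentSpace 𝓘(ℝ, E) q) :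
    mfderiv 𝓘(ℝ, E) 𝓘(ℝ, E') f q (canonicalConnection nabla (phi J g' f N 𝓘(ℝ, E))
        (xi J g' f N 𝓘(ℝ, E)) (eta J g' f N 𝓘(ℝ, E)) W q x)
      = proj J g' f N q (covAlong nabla' f
          (fun p => proj J g' f N p (mfderiv 𝓘(ℝ, E) 𝓘(ℝ, E') f p (W p))) q x)
        + mvfderiv 𝓘(ℝ, E) (fun p => eta J g' f N 𝓘(ℝ, E) p (W p)) q x • reeb J g' f N q := by
  have hA := h.almost_complex
  have hL := h.levi_civita
  have hs := h.smooth
  set ζ : Π p : M, TangentSpace 𝓘(ℝ, E') (f p) :=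
    fun p => proj J g' f N p (mfderiv 𝓘(ℝ, E) 𝓘(ℝ, E') f p (W p))
  have hr := h.contAlongAt_reeb q 1
  have hη := h.contMDiffAt_eta hW
  have hζ : ContAlongAt E (1 : ℕ) f ζ q := h.contAlongAt_proj (hW.mfderiv_apply hs)
  have hξ : (fun p => mfderiv 𝓘(ℝ, E) 𝓘(ℝ, E') f p (xi J g' f N 𝓘(ℝ, E) p)) = reeb J g' f N :=
    funext fun p => h.mfderiv_xi
  have hφ : (fun p => mfderiv 𝓘(ℝ, E) 𝓘(ℝ, E') f p (phi J g' f N 𝓘(ℝ, E) p (W p)))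
      = fun p => J (f p) (ζ p) := funext fun p => h.mfderiv_phi (W p)
  have hφφ : (fun p => mfderiv 𝓘(ℝ, E) 𝓘(ℝ, E') f p
      (phi J g' f N 𝓘(ℝ, E) p (phi J g' f N 𝓘(ℝ, E) p (W p)))) = fun p => -ζ p :=
    funext fun p => by
      rw [h.mfderiv_phi, h.mfderiv_phi, h.proj_structure, h.proj_proj, hA.sq]
  have hdW : (fun p => mfderiv 𝓘(ℝ, E) 𝓘(ℝ, E') f p (W p))
      = fun p => ζ p + eta J g' f N 𝓘(ℝ, E) p (W p) • reeb J g' f N p :=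
    funext fun p => h.mfderiv_eq_proj_add (W p)
  have hξC : ContAlongAt E (1 : ℕ) id (xi J g' f N 𝓘(ℝ, E)) q :=
    ContAlongAt.of_mfderiv_apply hs (h.immersion.immersion q) (by rw [hξ]; exact hr)
  have hφC : ContAlongAt E (1 : ℕ) id (fun p => phi J g' f N 𝓘(ℝ, E) p (W p)) q :=
    ContAlongAt.of_mfderiv_apply hs (h.immersion.immersion q)
      (by rw [hφ]; exact hζ.structure hA hs)
  have hφφC : ContAlongAt E (1 : ℕ) id
      (fun p => phi J g' f N 𝓘(ℝ, E) p (phi J g' f N 𝓘(ℝ, E) p (W p))) q :=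
    ContAlongAt.of_mfderiv_apply hs (h.immersion.immersion q) (by rw [hφφ]; exact hζ.neg hs)
  -- both sides are compared on the contact distribution (`p1`, …, `p4`) and along `ξ` (`e1`, `e3`, `e4`)
  set w := covAlong nabla' f ζ q x
  set r := covAlong nabla' f (reeb J g' f N) q x
  have hrr : g' (f q) r (reeb J g' f N q) = 0 := h.metric_covAlong_reeb x
  have hcov : covAlong nabla' f (fun p => mfderiv 𝓘(ℝ, E) 𝓘(ℝ, E') f p (W p)) q x
      = w + (eta J g' f N 𝓘(ℝ, E) q (W q) • r
        + mvfderiv 𝓘(ℝ, E) (fun p => eta J g' f N 𝓘(ℝ, E) p (W p)) q x • reeb J g' f N q) := by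
    rw [hdW, covAlong_add hA hL hs hζ (hr.smul hs hη), covAlong_smul hA hL hs hη hr]
  have p1 := h.proj_mfderiv_nabla hnabla hW x
  have p2 := h.proj_mfderiv_nabla hnabla hφC x
  have p3 := h.proj_mfderiv_nabla hnabla hφφC x
  have p4 := h.proj_mfderiv_nabla hnabla hξC x
  have e1 := h.eta_nabla hnabla hW x
  have e3 := h.eta_nabla hnabla hφφC x
  have e4 := h.eta_nabla hnabla hξC x
  rw [hcov] at p1 e1
  rw [hφ, covAlong_structure h.kaehler hs hζ, h.proj_structure] at p2
  rw [hφφ, covAlong_neg hA hL hs hζ, map_neg] at p3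
  rw [hφφ, covAlong_neg hA hL hs hζ, map_neg, neg_apply] at e3
  rw [hξ] at p4 e4
  rw [hrr] at e4
  simp only [map_add, map_smul, h.proj_reeb, smul_zero, add_zero] at p1
  simp only [map_add, map_smul, add_apply, smul_apply, hrr, h.reeb_unit, smul_eq_mul, mul_zero,
    mul_one, zero_add] at e1
  rw [h.mfderiv_eq_proj_add]
  congr 1
  · simp only [canonicalConnection, covDerivEnd, map_add, map_sub, map_smul, h.mfderiv_phi,
      h.mfderiv_xi, h.proj_proj, h.proj_reeb, p1, p2, p3, p4, hA.sq, map_neg]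
    module
  · congr 1
    simp only [canonicalConnection, covDerivEnd, covDerivForm, map_add, map_sub, map_smul,
      smul_eq_mul, h.eta_mfderiv_phi, e1, e3, e4]
    have hηξ : eta J g' f N 𝓘(ℝ, E) q (xi J g' f N 𝓘(ℝ, E) q) = 1 := by
      rw [h.eta_eq, h.mfderiv_xi, h.reeb_unit]
    rw [hηξ]
    ring

end IsKaehlerHypersurface

end HypersurfaceConnections

/-! ### The curvature of the canonical connection -/

section HypersurfaceCurvature

variable {E : Type*} [NormedAddCommGroup E] [NormedSpace ℝ E] [FiniteDimensional ℝ E]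
  {M : Type*} [TopologicalSpace M] [ChartedSpace E M] [IsManifold 𝓘(ℝ, E) ∞ M]
  {E' : Type*} [NormedAddCommGroup E'] [NormedSpace ℝ E'] [FiniteDimensional ℝ E']
  {M' : Type*} [TopologicalSpace M'] [ChartedSpace E' M'] [IsManifold 𝓘(ℝ, E') ∞ M']
  {J : Π p : M', TangentSpace 𝓘(ℝ, E') p →L[ℝ] TangentSpace 𝓘(ℝ, E') p}
  {g' : Π p : M', TangentSpace 𝓘(ℝ, E') p →L[ℝ] TangentSpace 𝓘(ℝ, E') p →L[ℝ] ℝ}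
  {nabla' : CovariantDerivative 𝓘(ℝ, E') E' (TangentSpace 𝓘(ℝ, E') : M' → Type _)}
  {f : M → M'} {N : Π p : M, TangentSpace 𝓘(ℝ, E') (f p)}
  {nabla : CovariantDerivative 𝓘(ℝ, E) E (TangentSpace 𝓘(ℝ, E) : M → Type _)}
  {q : M} {X Y Z : Π p : M, TangentSpace 𝓘(ℝ, E) p}

namespace IsKaehlerHypersurface

variable (J g' f N Z) in
/-- The part of a vector field of `M` in the contact distribution, as a field along the
immersion. -/
def contactPart (p : M) : TangentSpace 𝓘(ℝ, E') (f p) :=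
  proj J g' f N p (mfderiv 𝓘(ℝ, E) 𝓘(ℝ, E') f p (Z p))

theorem contAlongAt_contactPart {k : ℕ} (h : IsKaehlerHypersurface E J g' nabla' f N)
    (hZ : ContAlongAt E k id Z q) : ContAlongAt E k f (contactPart J g' f N Z) q :=
  h.contAlongAt_proj (hZ.mfderiv_apply h.smooth)

/-- `D_x D_Y Z`: near `q` the contact part of `D_Y Z` is `P ∇'_Y (P df Z)` and its `η`-component is
`Y(η Z)`, and `mfderiv_canonicalConnection` applies to `D_Y Z`, which is of class `C¹` because its
image under `df` is. -/
theorem mfderiv_canonicalConnection_canonicalConnection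
    (h : IsKaehlerHypersurface E J g' nabla' f N)
    (hnabla : IsLeviCivita (inducedMetric (I := 𝓘(ℝ, E)) g' f) nabla)
    (hY : ContAlongAt E (1 : ℕ) id Y q) (hZ : ContAlongAt E (2 : ℕ) id Z q)
    (x : TangentSpace 𝓘(ℝ, E) q) :
    mfderiv 𝓘(ℝ, E) 𝓘(ℝ, E') f q (canonicalConnection nabla (phi J g' f N 𝓘(ℝ, E))
        (xi J g' f N 𝓘(ℝ, E)) (eta J g' f N 𝓘(ℝ, E))
        (fun p => canonicalConnection nabla (phi J g' f N 𝓘(ℝ, E))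
          (xi J g' f N 𝓘(ℝ, E)) (eta J g' f N 𝓘(ℝ, E)) Z p (Y p)) q x)
      = proj J g' f N q (covAlong nabla' f
            (fun p => covAlong nabla' f (contactPart J g' f N Z) p (Y p)) q x)
        - normalCoeff J g' f N q (covAlong nabla' f (contactPart J g' f N Z) q (Y q))
            • proj J g' f N q (covAlong nabla' f N q x)
        - structureNormalCoeff J g' f N q (covAlong nabla' f (contactPart J g' f N Z) q (Y q))
            • J (f q) (proj J g' f N q (covAlong nabla' f N q x))
        + mvfderiv 𝓘(ℝ, E) (fun p => mvfderiv 𝓘(ℝ, E)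
            (fun p => eta J g' f N 𝓘(ℝ, E) p (Z p)) p (Y p)) q x • reeb J g' f N q := by
  have hA := h.almost_complex
  have hL := h.levi_civita
  have hs := h.smooth
  set W : Π p : M, TangentSpace 𝓘(ℝ, E) p :=
    fun p => canonicalConnection nabla (phi J g' f N 𝓘(ℝ, E))
      (xi J g' f N 𝓘(ℝ, E)) (eta J g' f N 𝓘(ℝ, E)) Z p (Y p)
  set V : Π p : M, TangentSpace 𝓘(ℝ, E') (f p) :=
    fun p => covAlong nabla' f (contactPart J g' f N Z) p (Y p)
  set β : M → ℝ := fun p => mvfderiv 𝓘(ℝ, E) (fun p => eta J g' f N 𝓘(ℝ, E) p (Z p)) p (Y p)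
  have hVC : ContAlongAt E (1 : ℕ) f V q :=
    (h.contAlongAt_contactPart hZ).covAlong hA hL hs hY
  have hβC : ContMDiffAt 𝓘(ℝ, E) 𝓘(ℝ, ℝ) (1 : ℕ) β q :=
    contMDiffAt_mvfderiv_apply (h.contMDiffAt_eta hZ) hY
  have hdW : ∀ᶠ p in 𝓝 q, mfderiv 𝓘(ℝ, E) 𝓘(ℝ, E') f p (W p)
      = proj J g' f N p (V p) + β p • reeb J g' f N p := by
    filter_upwards [hZ.eventually (f := id) contMDiff_id] with p hp
    exact h.mfderiv_canonicalConnection hnabla (hp.of_le (by norm_num)) (Y p)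
  have hWC : ContAlongAt E (1 : ℕ) id W q := by
    refine ContAlongAt.of_mfderiv_apply hs (h.immersion.immersion q) ?_
    exact ((h.contAlongAt_proj hVC).add hs ((h.contAlongAt_reeb q 1).smul hs hβC)).congr hdW
  have h1 : ∀ᶠ p in 𝓝 q, proj J g' f N p (mfderiv 𝓘(ℝ, E) 𝓘(ℝ, E') f p (W p))
      = proj J g' f N p (V p) := hdW.mono fun p hp => by
    rw [hp, map_add, map_smul, h.proj_proj, h.proj_reeb, smul_zero, add_zero]
  have h2 : (fun p => eta J g' f N 𝓘(ℝ, E) p (W p)) =ᶠ[𝓝 q] β := hdW.mono fun p hp => by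
    simp only [h.eta_eq]
    rw [hp, map_add, map_smul, add_apply, smul_apply, h.metric_proj_reeb, h.reeb_unit,
      zero_add, smul_eq_mul, mul_one]
  rw [h.mfderiv_canonicalConnection hnabla hWC, covAlong_congr h1, mvfderiv_eq_of_eventuallyEq h2,
    h.proj_covAlong_proj hVC]

/-- The curvature of the canonical connection: a Gauss equation for the contact distribution. The
components along `ξ` cancel, as second derivatives of the function `η Z`. -/
theorem mfderiv_curvatureField (h : IsKaehlerHypersurface E J g' nabla' f N)
    (hnabla : IsLeviCivita (inducedMetric (I := 𝓘(ℝ, E)) g' f) nabla)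
    (hX : ContAlongAt E (1 : ℕ) id X q) (hY : ContAlongAt E (1 : ℕ) id Y q)
    (hZ : ContAlongAt E (2 : ℕ) id Z q) :
    mfderiv 𝓘(ℝ, E) 𝓘(ℝ, E') f q (curvatureField
        (canonicalConnection nabla (phi J g' f N 𝓘(ℝ, E))
        (xi J g' f N 𝓘(ℝ, E)) (eta J g' f N 𝓘(ℝ, E))) X Y Z q)
      = proj J g' f N q (riemann g' (f q) (mfderiv 𝓘(ℝ, E) 𝓘(ℝ, E') f q (X q))
            (mfderiv 𝓘(ℝ, E) 𝓘(ℝ, E') f q (Y q)) (contactPart J g' f N Z q))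
        - normalCoeff J g' f N q (covAlong nabla' f (contactPart J g' f N Z) q (Y q))
            • proj J g' f N q (covAlong nabla' f N q (X q))
        - structureNormalCoeff J g' f N q (covAlong nabla' f (contactPart J g' f N Z) q (Y q))
            • J (f q) (proj J g' f N q (covAlong nabla' f N q (X q)))
        + normalCoeff J g' f N q (covAlong nabla' f (contactPart J g' f N Z) q (X q))
            • proj J g' f N q (covAlong nabla' f N q (Y q))
        + structureNormalCoeff J g' f N q (covAlong nabla' f (contactPart J g' f N Z) q (X q))
            • J (f q) (proj J g' f N q (covAlong nabla' f N q (Y q))) := by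
  have h1 := mvfderiv_mlieBracket (h.contMDiffAt_eta hZ) (hX.diffAlongAt one_ne_zero)
    (hY.diffAlongAt one_ne_zero)
  rw [curvatureField, map_sub, map_sub,
    h.mfderiv_canonicalConnection_canonicalConnection hnabla hY hZ,
    h.mfderiv_canonicalConnection_canonicalConnection hnabla hX hZ,
    h.mfderiv_canonicalConnection hnabla (hZ.of_le (by norm_num)), h1,
    ← covAlong_curvature h.almost_complex h.levi_civita h.smooth hX hY
      (h.contAlongAt_contactPart hZ), map_sub, map_sub]
  change _ - _ - (proj J g' f N q (covAlong nabla' f (contactPart J g' f N Z) q _) + _) = _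
  module

/-- The contact part is orthogonal to `N`, so the component along `N` of its derivative is given by
the shape operator. -/
theorem metric_covAlong_contactPart_normal (h : IsKaehlerHypersurface E J g' nabla' f N)
    (hZ : ContAlongAt E (1 : ℕ) id Z q) (y : TangentSpace 𝓘(ℝ, E) q) :
    g' (f q) (covAlong nabla' f (contactPart J g' f N Z) q y) (N q)
      = g' (f q) (contactPart J g' f N Z q)
        (mfderiv 𝓘(ℝ, E) 𝓘(ℝ, E') f q (shapeOperator nabla' f N q y)) := by
  have h1 := mvfderiv_metric_along h.almost_complex h.levi_civita h.smooth
    (h.contAlongAt_contactPart hZ) (h.contAlongAt_normal q 1) y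
  have h2 : (fun p => g' (f p) (contactPart J g' f N Z p) (N p)) = fun _ => (0 : ℝ) :=
    funext fun p => h.metric_proj_normal _
  have h4 : (0 : TangentSpace 𝓘(ℝ, E) q →L[ℝ] ℝ) y = 0 := rfl
  rw [h2, mvfderiv_const, h4] at h1
  rw [h.mfderiv_shapeOperator, map_neg]
  linarith

theorem metric_covAlong_contactPart_structure_normal
    (h : IsKaehlerHypersurface E J g' nabla' f N)
    (hZ : ContAlongAt E (1 : ℕ) id Z q) (y : TangentSpace 𝓘(ℝ, E) q) :
    g' (f q) (covAlong nabla' f (contactPart J g' f N Z) q y) (J (f q) (N q))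
      = g' (f q) (contactPart J g' f N Z q)
        (J (f q) (mfderiv 𝓘(ℝ, E) 𝓘(ℝ, E') f q (shapeOperator nabla' f N q y))) := by
  have hN := h.contAlongAt_normal q 1
  have h1 := mvfderiv_metric_along h.almost_complex h.levi_civita h.smooth
    (h.contAlongAt_contactPart hZ) (hN.structure h.almost_complex h.smooth) y
  have h2 : (fun p => g' (f p) (contactPart J g' f N Z p) (J (f p) (N p))) = fun _ => (0 : ℝ) :=
    funext fun p => h.metric_proj_structure_normal _
  have h4 : (0 : TangentSpace 𝓘(ℝ, E) q →L[ℝ] ℝ) y = 0 := rfl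
  rw [h2, mvfderiv_const, h4, covAlong_structure h.kaehler h.smooth hN] at h1
  rw [h.mfderiv_shapeOperator, map_neg, map_neg]
  linarith

theorem metric_mfderiv_proj (h : IsKaehlerHypersurface E J g' nabla' f N)
    (y z : TangentSpace 𝓘(ℝ, E) q) :
    g' (f q) (mfderiv 𝓘(ℝ, E) 𝓘(ℝ, E') f q y)
        (proj J g' f N q (mfderiv 𝓘(ℝ, E) 𝓘(ℝ, E') f q z))
      = inducedMetric g' f q y z - eta J g' f N 𝓘(ℝ, E) q y * eta J g' f N 𝓘(ℝ, E) q z := by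
  rw [eq_sub_of_add_eq (h.mfderiv_eq_proj_add z).symm, map_sub, map_smul, ← h.eta_eq, smul_eq_mul,
    mul_comm (eta J g' f N 𝓘(ℝ, E) q y)]
  rfl

theorem metric_mfderiv_structure_proj (h : IsKaehlerHypersurface E J g' nabla' f N)
    (y z : TangentSpace 𝓘(ℝ, E) q) :
    g' (f q) (mfderiv 𝓘(ℝ, E) 𝓘(ℝ, E') f q y)
        (J (f q) (proj J g' f N q (mfderiv 𝓘(ℝ, E) 𝓘(ℝ, E') f q z)))
      = inducedMetric g' f q y (phi J g' f N 𝓘(ℝ, E) q z) := by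
  rw [inducedMetric, h.mfderiv_phi]

/-- The shape operator is self-adjoint. -/
theorem inducedMetric_shapeOperator (h : IsKaehlerHypersurface E J g' nabla' f N)
    (x y : TangentSpace 𝓘(ℝ, E) q) :
    inducedMetric g' f q (shapeOperator nabla' f N q x) y
      = inducedMetric g' f q x (shapeOperator nabla' f N q y) := by
  have hA := h.almost_complex
  have hL := h.levi_civita
  have hs := h.smooth
  have key {x y : TangentSpace 𝓘(ℝ, E) q} :
      inducedMetric g' f q (shapeOperator nabla' f N q x) y
        = g' (f q) (N q) (covAlong nabla' f
            (fun p => mfderiv 𝓘(ℝ, E) 𝓘(ℝ, E') f p (frameField q y p)) q x) := by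
    have h1 := mvfderiv_metric_along hA hL hs (h.contAlongAt_normal q 1)
      ((contAlongAt_frameField q y 1).mfderiv_apply hs) x
    have h2 : (fun p => g' (f p) (N p) (mfderiv 𝓘(ℝ, E) 𝓘(ℝ, E') f p (frameField q y p)))
        = fun _ => (0 : ℝ) := funext fun p => h.immersion.normal p _
    have h4 : (0 : TangentSpace 𝓘(ℝ, E) q →L[ℝ] ℝ) x = 0 := rfl
    rw [h2, mvfderiv_const, h4, frameField_self] at h1
    rw [inducedMetric, h.mfderiv_shapeOperator, map_neg, neg_apply]
    linarith
  have h1 := covAlong_mfderiv_comm hA hL hs (contAlongAt_frameField q x 1)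
    (contAlongAt_frameField q y 1)
  have h2 := congrArg (g' (f q) (N q)) h1
  rw [map_sub, h.immersion.normal, sub_eq_zero, frameField_self, frameField_self] at h2
  rw [key, h2, ← key]
  exact hA.symm _ _ _

/-- The induced almost contact structure; `φ` is traceless because `J P` is, and the trace of `φ`
can be computed in the ambient tangent space. -/
theorem isContactShape (h : IsKaehlerHypersurface E J g' nabla' f N) (q : M) :
    IsContactShape ((ContinuousLinearMap.toLinearMap₁₂ (g' (f q))).compl₁₂
        (mfderiv 𝓘(ℝ, E) 𝓘(ℝ, E') f q).toLinearMap (mfderiv 𝓘(ℝ, E) 𝓘(ℝ, E') f q).toLinearMap)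
      (phi J g' f N 𝓘(ℝ, E) q) (shapeOperator nabla' f N q) (xi J g' f N 𝓘(ℝ, E) q)
      (eta J g' f N 𝓘(ℝ, E) q) where
  symm x y := h.almost_complex.symm _ _ _
  nondegenerate x hx := by
    have h1 := h.eq_of_orthogonal (w := mfderiv 𝓘(ℝ, E) 𝓘(ℝ, E') f q x) hx
    rw [h.mfderiv_normal, zero_smul, add_zero] at h1
    exact h.immersion.immersion q (h1.trans (map_zero _).symm)
  phi_phi x := by
    apply h.immersion.immersion q
    rw [h.mfderiv_phi, h.mfderiv_phi, h.proj_structure, h.proj_proj, h.almost_complex.sq, map_add,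
      map_neg, map_smul, h.mfderiv_xi,
      eq_sub_of_add_eq (h.mfderiv_eq_proj_add x).symm]
    module
  phi_symm x y := by
    change g' (f q) (mfderiv 𝓘(ℝ, E) 𝓘(ℝ, E') f q _) _
      = g' (f q) _ (mfderiv 𝓘(ℝ, E) 𝓘(ℝ, E') f q _)
    rw [h.mfderiv_phi, h.mfderiv_phi,
      h.structure_symm, h.proj_symm, h.proj_structure]
    rfl
  eta_eq x := by
    rw [h.eta_eq, ← h.mfderiv_xi]
    rfl
  eta_reeb := by rw [h.eta_eq, h.mfderiv_xi, h.reeb_unit]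
  phi_reeb := by
    apply h.immersion.immersion q
    rw [h.mfderiv_phi, h.mfderiv_xi, h.proj_reeb, map_zero, map_zero]
  trace_phi := by
    have := finiteDimensional_tangentSpace (E' := E') (f q)
    have := finiteDimensional_tangentSpace (E' := E) q
    have h1 : phi J g' f N 𝓘(ℝ, E) q = toTangent 𝓘(ℝ, E) 𝓘(ℝ, E') f q
        ∘ₗ (((J (f q)).toLinearMap ∘ₗ proj J g' f N q)
          ∘ₗ (mfderiv 𝓘(ℝ, E) 𝓘(ℝ, E') f q).toLinearMap) := by
      ext x
      have h2 := h.toTangent_mfderiv (phi J g' f N 𝓘(ℝ, E) q x)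
      rw [h.mfderiv_phi] at h2
      exact h2.symm
    have h3 : (mfderiv 𝓘(ℝ, E) 𝓘(ℝ, E') f q).toLinearMap ∘ₗ (toTangent 𝓘(ℝ, E) 𝓘(ℝ, E') f q
        ∘ₗ ((J (f q)).toLinearMap ∘ₗ proj J g' f N q)) = (J (f q)).toLinearMap ∘ₗ proj J g' f N q := by
      ext w
      refine h.mfderiv_toTangent ?_
      change g' (f q) (J (f q) (proj J g' f N q w)) (N q) = 0
      rw [← h.proj_structure, h.metric_proj_normal]
    rw [h1, ← LinearMap.comp_assoc, LinearMap.trace_comp_comm', h3]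
    exact (h.hyperplane q).trace_structure_comp_contactProj
  shape_symm x y := h.inducedMetric_shapeOperator x y

/-- The curvature tensor of the canonical connection of a hypersurface of a manifold of constant
totally real sectional curvatures. -/
theorem canonicalCurvature_eq (h : IsKaehlerHypersurface E J g' nabla' f N)
    (hnabla : IsLeviCivita (inducedMetric (I := 𝓘(ℝ, E)) g' f) nabla) {ν νt : M' → ℝ}
    (hν : HasConstantTotallyRealCurvatures J g' nabla' ν νt) (x y z u : TangentSpace 𝓘(ℝ, E) q) :
    canonicalCurvature J g' f N nabla q x y z u
      = contactCurvature ((ContinuousLinearMap.toLinearMap₁₂ (g' (f q))).compl₁₂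
          (mfderiv 𝓘(ℝ, E) 𝓘(ℝ, E') f q).toLinearMap (mfderiv 𝓘(ℝ, E) 𝓘(ℝ, E') f q).toLinearMap)
        (phi J g' f N 𝓘(ℝ, E) q) (shapeOperator nabla' f N q) (eta J g' f N 𝓘(ℝ, E) q)
        (ν (f q)) (νt (f q)) (Real.cos (angle J g' f N q)) (Real.sin (angle J g' f N q))
        x y z u := by
  have hZ1 := contAlongAt_extend q z 1
  have hA := h.almost_complex
  set ζ : Π p : M, TangentSpace 𝓘(ℝ, E') (f p) :=
    contactPart J g' f N (FiberBundle.extend E z) with hζdef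
  have hζq : ζ q = proj J g' f N q (mfderiv 𝓘(ℝ, E) 𝓘(ℝ, E') f q z) := by
    rw [hζdef, contactPart, extend_self]
  have n1 (y : TangentSpace 𝓘(ℝ, E) q) := h.metric_covAlong_contactPart_normal hZ1 y
  have n2 (y : TangentSpace 𝓘(ℝ, E) q) := h.metric_covAlong_contactPart_structure_normal hZ1 y
  rw [← hζdef, hζq] at n1 n2
  have n1' (y : TangentSpace 𝓘(ℝ, E) q) : g' (f q) (covAlong nabla' f ζ q y) (N q)
      = inducedMetric g' f q (shapeOperator nabla' f N q y) z
        - eta J g' f N 𝓘(ℝ, E) q (shapeOperator nabla' f N q y) * eta J g' f N 𝓘(ℝ, E) q z := by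
    rw [n1, hA.symm, h.metric_mfderiv_proj]
  have n2' (y : TangentSpace 𝓘(ℝ, E) q) : g' (f q) (covAlong nabla' f ζ q y) (J (f q) (N q))
      = inducedMetric g' f q (shapeOperator nabla' f N q y) (phi J g' f N 𝓘(ℝ, E) q z) := by
    rw [n2, hA.symm, h.structure_symm, h.metric_mfderiv_structure_proj]
  have m1 (x : TangentSpace 𝓘(ℝ, E) q) : g' (f q) (proj J g' f N q (covAlong nabla' f N q x))
        (mfderiv 𝓘(ℝ, E) 𝓘(ℝ, E') f q u)
      = -(inducedMetric g' f q (shapeOperator nabla' f N q x) u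
        - eta J g' f N 𝓘(ℝ, E) q (shapeOperator nabla' f N q x) * eta J g' f N 𝓘(ℝ, E) q u) := by
    rw [h.proj_symm, ← neg_eq_iff_eq_neg.2 (h.mfderiv_shapeOperator x), map_neg, neg_apply,
      h.metric_mfderiv_proj]
  have m2 (x : TangentSpace 𝓘(ℝ, E) q) :
      g' (f q) (J (f q) (proj J g' f N q (covAlong nabla' f N q x)))
        (mfderiv 𝓘(ℝ, E) 𝓘(ℝ, E') f q u)
      = -inducedMetric g' f q (shapeOperator nabla' f N q x) (phi J g' f N 𝓘(ℝ, E) q u) := by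
    rw [← h.proj_structure, h.proj_symm, h.structure_symm,
      ← neg_eq_iff_eq_neg.2 (h.mfderiv_shapeOperator x), map_neg, neg_apply,
      h.metric_mfderiv_structure_proj]
  unfold canonicalCurvature curvatureTensor
  rw [inducedMetric, h.mfderiv_curvatureField hnabla (contAlongAt_extend q x 1)
    (contAlongAt_extend q y 1) (contAlongAt_extend q z 2), extend_self, extend_self, ← hζdef]
  simp only [map_sub, map_add, map_smul, sub_apply, add_apply, smul_apply, smul_eq_mul]
  rw [h.proj_symm, riemann_eq h.kaehler hν, hζq, m1, m1, m2, m2]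
  simp only [normalCoeff, structureNormalCoeff, n1', n2']
  simp only [pi1, pi2, pi3, h.metric_mfderiv_proj, h.metric_mfderiv_structure_proj]
  change _ = _ * (pi1 (inducedMetric g' f q) x y z u
      - pi2 (inducedMetric g' f q) (fun a => phi J g' f N 𝓘(ℝ, E) q a) x y z u
      - pi4 (inducedMetric g' f q) (fun a => eta J g' f N 𝓘(ℝ, E) q a) x y z u)
    + _ * (pi3 (inducedMetric g' f q) (fun a => phi J g' f N 𝓘(ℝ, E) q a) x y z u
      + pi5 (inducedMetric g' f q) (fun a => phi J g' f N 𝓘(ℝ, E) q a)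
        (fun a => eta J g' f N 𝓘(ℝ, E) q a) x y z u)
    - _ * (_ * (pi1 (inducedMetric g' f q) (shapeOperator nabla' f N q x)
          (shapeOperator nabla' f N q y) z u
        - pi2 (inducedMetric g' f q) (fun a => phi J g' f N 𝓘(ℝ, E) q a)
          (shapeOperator nabla' f N q x) (shapeOperator nabla' f N q y) z u
        - pi4 (inducedMetric g' f q) (fun a => eta J g' f N 𝓘(ℝ, E) q a)
          (shapeOperator nabla' f N q x) (shapeOperator nabla' f N q y) z u)
      + _ * (pi3 (inducedMetric g' f q) (fun a => phi J g' f N 𝓘(ℝ, E) q a)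
          (shapeOperator nabla' f N q x) (shapeOperator nabla' f N q y) z u
        + pi5 (inducedMetric g' f q) (fun a => phi J g' f N 𝓘(ℝ, E) q a)
          (fun a => eta J g' f N 𝓘(ℝ, E) q a)
          (shapeOperator nabla' f N q x) (shapeOperator nabla' f N q y) z u))
  simp only [pi1, pi2, pi3, pi4, pi5]
  ring

end IsKaehlerHypersurface

end HypersurfaceCurvature

end NordenGeometry

end

theorem proposition2p2 (n : ℕ)
    {M' : Type*} [TopologicalSpace M'] [ChartedSpace (EuclideanSpace ℝ (Fin (2 * n + 2))) M']
    [IsManifold (𝓡 (2 * n + 2)) ∞ M']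
    {M : Type*} [TopologicalSpace M] [ChartedSpace (EuclideanSpace ℝ (Fin (2 * n + 1))) M]
    [IsManifold (𝓡 (2 * n + 1)) ∞ M]
    (J : Π p : M', TangentSpace (𝓡 (2 * n + 2)) p →L[ℝ] TangentSpace (𝓡 (2 * n + 2)) p)
    (g' : Π p : M', TangentSpace (𝓡 (2 * n + 2)) p →L[ℝ] TangentSpace (𝓡 (2 * n + 2)) p →L[ℝ] ℝ)
    (nabla' : CovariantDerivative (𝓡 (2 * n + 2)) (EuclideanSpace ℝ (Fin (2 * n + 2)))
      (TangentSpace (𝓡 (2 * n + 2)) : M' → Type _))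
    (hM' : IsKaehlerNorden J g' nabla')
    (ν νt : M' → ℝ) (hν : HasConstantTotallyRealCurvatures J g' nabla' ν νt)
    (f : M → M') (N : Π p : M, TangentSpace (𝓡 (2 * n + 2)) (f p))
    (hf : IsTimelikeImmersion (I := 𝓡 (2 * n + 1)) g' f N)
    (nabla : CovariantDerivative (𝓡 (2 * n + 1)) (EuclideanSpace ℝ (Fin (2 * n + 1)))
      (TangentSpace (𝓡 (2 * n + 1)) : M → Type _))
    (hnabla : IsLeviCivita (inducedMetric g' f) nabla)
    (p : M) :
    let g : TangentSpace (𝓡 (2 * n + 1)) p → TangentSpace (𝓡 (2 * n + 1)) p → ℝ :=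
      inducedMetric g' f p
    let φ := phi J g' f N (𝓡 (2 * n + 1)) p
    let ξ := xi J g' f N (𝓡 (2 * n + 1)) p
    let η := eta J g' f N (𝓡 (2 * n + 1)) p
    let t := angle J g' f N p
    let A : TangentSpace (𝓡 (2 * n + 1)) p →ₗ[ℝ] TangentSpace (𝓡 (2 * n + 1)) p :=
      shapeOperator nabla' f N p
    let K := canonicalCurvature J g' f N nabla p
    let tr := LinearMap.trace ℝ (TangentSpace (𝓡 (2 * n + 1)) p)
    let a : ℝ := (tr A) ^ 2 - tr (A ∘ₗ A) - (tr (A ∘ₗ φ)) ^ 2 + tr ((A ∘ₗ φ) ∘ₗ (A ∘ₗ φ))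
      - 2 * η (A ξ) * tr A + 2 * g (A ξ) (A ξ)
    let b : ℝ := tr ((A ∘ₗ A) ∘ₗ φ) - tr A * tr (A ∘ₗ φ) + η (A ξ) * tr (A ∘ₗ φ)
      - g (φ (A ξ)) (A ξ)
    IsKaehlerian φ K ∧
    (∀ x y z u, K x y z u =
      ν (f p) * (pi1 g x y z u - pi2 g φ x y z u - pi4 g η x y z u)
        + νt (f p) * (pi3 g φ x y z u + pi5 g φ η x y z u)
        - Real.cos t *
          (Real.cos t * (pi1 g (A x) (A y) z u - pi2 g φ (A x) (A y) z u
              - pi4 g η (A x) (A y) z u)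
            + Real.sin t * (pi3 g φ (A x) (A y) z u + pi5 g φ η (A x) (A y) z u))) ∧
    (∀ e : Module.Basis (Fin (2 * n + 1)) ℝ (TangentSpace (𝓡 (2 * n + 1)) p),
      scalarCurvature e g K
          = 4 * n * (n - 1) * ν (f p)
            - Real.cos t * (a * Real.cos t + 2 * b * Real.sin t) ∧
      scalarCurvature e g (fun x y z u => K x y z (φ u))
          = 4 * n * (n - 1) * νt (f p)
            - Real.cos t * (a * Real.sin t - 2 * b * Real.cos t)) := by
  intro g φ ξ η t A K tr a b
  have h : IsKaehlerHypersurface (EuclideanSpace ℝ (Fin (2 * n + 1))) J g' nabla' f N :=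
    ⟨hM', hf, by rw [finrank_euclideanSpace, finrank_euclideanSpace, Fintype.card_fin,
      Fintype.card_fin]⟩
  have hK : ∀ x y z u, K x y z u = _ := h.canonicalCurvature_eq hnabla hν
  have hn : Module.finrank ℝ (TangentSpace (𝓡 (2 * n + 1)) p) = 2 * n + 1 :=
    finrank_euclideanSpace_fin
  have := finiteDimensional_tangentSpace (E' := EuclideanSpace ℝ (Fin (2 * n + 1))) p
  exact ⟨(h.isContactShape p).isKaehlerian hK, hK,
    fun e => (h.isContactShape p).scalarCurvature_curvature e hK hn rfl rfl⟩
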